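/- Let $K$ be a field and let $\Lambda=\bigoplus_{i\ge 0}\Lambda_i$ be a graded factor of a path algebra: $\Lambda=KQ/I$, where $Q$ is a finite quiver, $KQ$ is graded by the length of paths and $I$ is a homogeneous ideal contained in $\bigoplus_{k\ge 2}KQ_k$ (equivalently, $\Lambda$ is generated by $\Lambda_0\oplus\Lambda_1$, $\Lambda_0$ is a finite product of copies of $K$, and $\dim_K\Lambda_1<\infty$). Let $Gr_\Lambda$ be the category of $\mathbf Z$-graded right $\Lambda$-modules with degree-preserving morphisms, put $M[k]_i=M_{i+k}$, let $D(\Lambda)=\mathcal Hom_{\Lambda_0}(\Lambda,\Lambda_0)$ be the graded dual of $\Lambda$, and let $Soc^{gr}(M)=\{x\in M : x\Lambda_i=0 \text{ for all } i>0\}$ be the graded socle. A graded module is *almost injective* if it is a direct summand of a direct sum of modules $D(\Lambda)[k]$, $k\in\mathbf Z$; it is *cogenerated in degree* $d$ if every nonzero graded submodule is nonzero in degree $d$. Let $n\ge 2$ and $m\in\mathbf Z$. Let ${}_n\mathcal{LC}^*_\Lambda$ be the category of linear $n$-complexes of almost injective modules: its objects are the sequences $I^\cdot=(I^j,\,d^j:I^j\to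 I^{j+1})_{j\in\mathbf Z}$ in $Gr_\Lambda$ such that every composition of $n$ consecutive differentials is zero and each $I^j$ is almost injective and cogenerated in degree $-j$; its morphisms are the families of morphisms in $Gr_\Lambda$ commuting with the differentials. Put $\mathcal U=n\mathbf Z\cup(n\mathbf Z+1)$ and $\mathcal S=m+\mathcal U$, and let $\delta_m:\mathbf Z\to\mathbf Z$ be given by $\delta_m(2k)=m+kn$ and $\delta_m(2k+1)=m+kn+1$. Let $C(Gr_\Lambda)$ be the category of cochain complexes of graded $\Lambda$-modules, and let $H=H_m:{}_n\mathcal{LC}^*_\Lambda\to C(Gr_\Lambda)$ be the contraction functor: $H(I^\cdot)=\tilde I^\cdot$ with $\tilde I^k=I^{\delta_m(k)}$, $\tilde d^{2j}=d^{m+jn}$ and $\tilde d^{2j+1}=d^{m+(j+1)n-1}\circ\cdots\circ d^{m+jn+1}$. A complex is *$H$-liftable* if it lies in the essential image of $H$. Let $\mathcal T^*$ be the class of those $I^\cdot\in{}_n\mathcal{LC}^*_\Lambda$ with $I^j=0$ for all $j\in\mathcal S$. Let $\mathcal G^*(\mathcal S,\mathcal U)$ be ${}_n\mathcal{LC}^*_\Lambda$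 if $n=2$ and, if $n>2$, its full subcategory of those $I^\cdot$ for which $Hom_{Gr_\Lambda}(D(\Lambda)[j],Ker\,d^j)=0$ for all $j\notin\mathcal S$ and $Soc^{gr}(I^j)\subseteq Im\,d^{j-1}$ for all $j\not\equiv m\pmod n$. Then ${}_n\mathcal{LC}^*_\Lambda$ is an abelian category, $H$ is an exact additive functor, and the following hold. 1. $Ker(H)=\mathcal T^*$ (that is, $H(I^\cdot)=0$ if and only if $I^\cdot\in\mathcal T^*$), and $H$ induces a faithful functor ${}_n\mathcal{LC}^*_\Lambda/\mathcal T^*\to C(Gr_\Lambda)$ on the quotient category, the localization of ${}_n\mathcal{LC}^*_\Lambda$ at the morphisms whose kernel and cokernel lie in $\mathcal T^*$. 2. The composition $\mathcal G^*(\mathcal S,\mathcal U)\hookrightarrow{}_n\mathcal{LC}^*_\Lambda\xrightarrow{\,H\,}C(Gr_\Lambda)$ is faithful, and its essential image consists of those $H$-liftable complexes $(\tilde I^\cdot,\tilde d^\cdot)$ that satisfy condition (a), if $n=2$, or both conditions (a) and (b), if $n>2$: (a) $\tilde I^j$ is almost injective and cogenerated in degree $-\delta_m(j)$, for all $j\in\mathbf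 Z$; (b) $Soc^{gr}(\tilde I^{2j+1})\subseteq Im(\tilde d^{2j})$, for all $j\in\mathbf Z$. 3. If $\Lambda$ has relations of degree $\ge n$, that is, if $I$ is generated by homogeneous elements of degrees $\ge n$, then the composition in 2 is also full. -/

import Mathlib

open CategoryTheory

universe w u v₁ v₂

noncomputable section

/-! ### Path algebras of finite quivers -/

/-- The path algebra of a finite quiver `V` over `K`.  An element is a family of finite formal
`K`-linear combinations of paths from `a` to `b`, indexed by the pairs `(a, b)` of vertices; as `V`
is finite this is the vector space with basis the set of all paths. -/
@[ext]
structure PathAlgebra (K : Type w) [Field K] (V : Type v₁) [Quiver.{v₂} V] where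
  coeff : ∀ a b : V, Quiver.Path a b →₀ K

namespace PathAlgebra

section Linear

variable {K : Type w} [Field K] {V : Type v₁} [Quiver.{v₂} V]

theorem coeff_injective : Function.Injective (coeff : PathAlgebra K V → _) := fun _ _ h =>
  PathAlgebra.ext h

instance : Zero (PathAlgebra K V) := ⟨⟨0⟩⟩
instance : Add (PathAlgebra K V) := ⟨fun f g => ⟨f.coeff + g.coeff⟩⟩
instance : Neg (PathAlgebra K V) := ⟨fun f => ⟨-f.coeff⟩⟩
instance : Sub (PathAlgebra K V) := ⟨fun f g => ⟨f.coeff - g.coeff⟩⟩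
instance {S : Type*} [SMulZeroClass S K] : SMul S (PathAlgebra K V) :=
  ⟨fun r f => ⟨fun a b => r • f.coeff a b⟩⟩

instance : AddCommGroup (PathAlgebra K V) :=
  coeff_injective.addCommGroup coeff rfl (fun _ _ => rfl) (fun _ => rfl) (fun _ _ => rfl)
    (fun _ _ => rfl) (fun _ _ => rfl)

/-- `coeff` as an additive map. -/
def coeffHom : PathAlgebra K V →+ (∀ a b : V, Quiver.Path a b →₀ K) where
  toFun := coeff
  map_zero' := rfl
  map_add' _ _ := rfl

instance : Module K (PathAlgebra K V) :=
  coeff_injective.module K coeffHom (fun _ _ => rfl)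

@[simp] theorem coeff_zero (a b : V) : (0 : PathAlgebra K V).coeff a b = 0 := rfl
@[simp] theorem coeff_add (f g : PathAlgebra K V) (a b : V) :
    (f + g).coeff a b = f.coeff a b + g.coeff a b := rfl
@[simp] theorem coeff_smul (r : K) (f : PathAlgebra K V) (a b : V) :
    (r • f).coeff a b = r • f.coeff a b := rfl

/-- The bilinear extension of concatenation of paths. -/
def concat {a b c : V} :
    (Quiver.Path a b →₀ K) →ₗ[K] (Quiver.Path b c →₀ K) →ₗ[K] (Quiver.Path a c →₀ K) :=
  Finsupp.lsum K fun p => (LinearMap.lsmul K _).flip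
    (Finsupp.lmapDomain K K fun q : Quiver.Path b c => p.comp q)

@[simp] theorem concat_single {a b c : V} (p : Quiver.Path a b) (q : Quiver.Path b c) (r s : K) :
    concat (Finsupp.single p r) (Finsupp.single q s) = Finsupp.single (p.comp q) (r * s) := by
  simp [concat]

theorem concat_assoc {a b c d : V} (f : Quiver.Path a b →₀ K) (g : Quiver.Path b c →₀ K)
    (h : Quiver.Path c d →₀ K) : concat (concat f g) h = concat f (concat g h) := by
  induction f using Finsupp.induction_linear with
  | zero => simp
  | add f f' hf hf' => simp [hf, hf']
  | single p r =>
    induction g using Finsupp.induction_linear with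
    | zero => simp
    | add g g' hg hg' => simp [hg, hg']
    | single q s =>
      induction h using Finsupp.induction_linear with
      | zero => simp
      | add h h' hh hh' => rw [map_add, hh, hh', map_add, map_add]
      | single q' t =>
        rw [concat_single, concat_single, concat_single, concat_single, mul_assoc,
          Quiver.Path.comp_assoc]

theorem nil_concat {a b : V} (f : Quiver.Path a b →₀ K) :
    concat (Finsupp.single Quiver.Path.nil (1 : K)) f = f := by
  induction f using Finsupp.induction_linear with
  | zero => simp
  | add f g hf hg => simp [hf, hg]
  | single p r => simp

theorem concat_nil {a b : V} (f : Quiver.Path a b →₀ K) :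
    concat f (Finsupp.single Quiver.Path.nil (1 : K)) = f := by
  induction f using Finsupp.induction_linear with
  | zero => simp
  | add f g hf hg => simp [hf, hg]
  | single p r => simp

end Linear

variable {K : Type w} [Field K] {V : Type v₁} [Quiver.{v₂} V]

open Classical in
/-- The unit is the sum of the trivial paths. -/
instance : One (PathAlgebra K V) :=
  ⟨⟨fun a b => if h : a = b then h ▸ Finsupp.single Quiver.Path.nil 1 else 0⟩⟩

theorem coeff_one_self (a : V) :
    (1 : PathAlgebra K V).coeff a a = Finsupp.single Quiver.Path.nil 1 :=
  dif_pos rfl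

theorem coeff_one_of_ne {a b : V} (h : a ≠ b) : (1 : PathAlgebra K V).coeff a b = 0 :=
  dif_neg h

variable [Fintype V]

/-- The product is given by concatenation of paths. -/
instance : Mul (PathAlgebra K V) :=
  ⟨fun f g => ⟨fun a c => ∑ b, concat (f.coeff a b) (g.coeff b c)⟩⟩

theorem coeff_mul (f g : PathAlgebra K V) (a c : V) :
    (f * g).coeff a c = ∑ b, concat (f.coeff a b) (g.coeff b c) := rfl

private theorem one_mul_aux (f : PathAlgebra K V) : 1 * f = f := by
  ext1
  funext a c
  rw [coeff_mul, Finset.sum_eq_single a, coeff_one_self, nil_concat]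
  · intro b _ hb
    rw [coeff_one_of_ne hb.symm, map_zero, LinearMap.zero_apply]
  · simp

private theorem mul_one_aux (f : PathAlgebra K V) : f * 1 = f := by
  ext1
  funext a c
  rw [coeff_mul, Finset.sum_eq_single c, coeff_one_self, concat_nil]
  · intro b _ hb
    rw [coeff_one_of_ne hb, map_zero]
  · simp

private theorem mul_assoc_aux (f g h : PathAlgebra K V) : f * g * h = f * (g * h) := by
  ext1
  funext a d
  simp only [coeff_mul, map_sum, LinearMap.sum_apply, concat_assoc]
  exact Finset.sum_comm

instance : Ring (PathAlgebra K V) where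
  __ := (inferInstance : AddCommGroup (PathAlgebra K V))
  left_distrib f g h := by
    ext1; funext a c; simp [coeff_mul, Finset.sum_add_distrib]
  right_distrib f g h := by
    ext1; funext a c; simp [coeff_mul, Finset.sum_add_distrib]
  zero_mul f := by ext1; funext a c; simp [coeff_mul]
  mul_zero f := by ext1; funext a c; simp [coeff_mul]
  mul_assoc := mul_assoc_aux
  one_mul := one_mul_aux
  mul_one := mul_one_aux

instance : Algebra K (PathAlgebra K V) :=
  Algebra.ofModule
    (fun r f g => by ext1; funext a c; simp [coeff_mul, Finset.smul_sum])
    (fun r f g => by ext1; funext a c; simp [coeff_mul, Finset.smul_sum])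

variable (K V) in
/-- The homogeneous component of degree `k`: the span of the paths of length `k`. -/
def degreePart (k : ℕ) : Submodule K (PathAlgebra K V) where
  carrier := {f | ∀ (a b : V) (p : Quiver.Path a b), f.coeff a b p ≠ 0 → p.length = k}
  zero_mem' := by intro a b p h; simp at h
  add_mem' {f g} hf hg := by
    intro a b p h
    by_contra hk
    have h1 : f.coeff a b p = 0 := by_contra fun h' => hk (hf a b p h')
    have h2 : g.coeff a b p = 0 := by_contra fun h' => hk (hg a b p h')
    simp [h1, h2] at h
  smul_mem' r f hf := by
    intro a b p h
    refine hf a b p fun h' => h ?_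
    simp [h']

end PathAlgebra

section Algebra

variable {K : Type w} [Field K] {Λ : Type u} [Ring Λ] [Algebra K Λ]
variable {V : Type v₁} [Quiver.{v₂} V] [Fintype V]

/-- `π : KQ → Λ` exhibits the graded algebra `Λ = ⨁ 𝒜 i` as a graded factor of the path algebra of
the finite quiver `Q` (with set of vertices `V`) of `Λ`: it is a surjective homomorphism of graded
algebras which is bijective in degrees `0` and `1`. (It follows that `𝒜 i = 0` for `i < 0`, that
`𝒜 0` is a finite product of copies of `K`, and that `𝒜 0 ⊕ 𝒜 1` generates `Λ`.) -/
structure IsGradedFactor (𝒜 : ℤ → Submodule K Λ) (π : PathAlgebra K V →ₐ[K] Λ) : Prop where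
  surjective : Function.Surjective π
  map_mem : ∀ (k : ℕ), ∀ x ∈ PathAlgebra.degreePart K V k, π x ∈ 𝒜 k
  injOn_zero : ∀ x ∈ PathAlgebra.degreePart K V 0, π x = 0 → x = 0
  injOn_one : ∀ x ∈ PathAlgebra.degreePart K V 1, π x = 0 → x = 0

/-- `Λ = KQ/I`, `I = ker π`, has relations of degree `≥ n`: the ideal `I` is generated by its
homogeneous elements of degrees `k ≥ n`. -/
def HasRelationsOfDegreeGE (π : PathAlgebra K V →ₐ[K] Λ) (n : ℕ) : Prop :=
  TwoSidedIdeal.ker π =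
    TwoSidedIdeal.span {x | π x = 0 ∧ ∃ k, n ≤ k ∧ x ∈ PathAlgebra.degreePart K V k}

end Algebra

/-! ### Graded right modules -/

variable {K : Type w} [Field K] {Λ : Type u} [Ring Λ] [Algebra K Λ]
variable (𝒜 : ℤ → Submodule K Λ) [GradedAlgebra 𝒜]

/-- A `ℤ`-graded right module over the graded algebra `Λ = ⨁ 𝒜 i`, given by its homogeneous
components `M i` and the multiplication maps `M i × 𝒜 j → M (i + j)`. -/
structure GrMod where
  carrier : ℤ → Type u
  [addCommGroup : ∀ i, AddCommGroup (carrier i)]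
  act : ∀ {i j k : ℤ}, i + j = k → carrier i → 𝒜 j → carrier k
  add_act : ∀ {i j k : ℤ} (h : i + j = k) (x y : carrier i) (a : 𝒜 j),
    act h (x + y) a = act h x a + act h y a
  act_add : ∀ {i j k : ℤ} (h : i + j = k) (x : carrier i) (a b : 𝒜 j),
    act h x (a + b) = act h x a + act h x b
  act_one : ∀ {i : ℤ} (x : carrier i), act (add_zero i) x ⟨1, SetLike.GradedOne.one_mem⟩ = x
  act_act : ∀ {i j k l p q : ℤ} (h₁ : i + j = k) (h₂ : k + l = p) (h₃ : j + l = q) (h₄ : i + q = p)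
    (x : carrier i) (a : 𝒜 j) (b : 𝒜 l),
    act h₂ (act h₁ x a) b = act h₄ x ⟨a * b, h₃ ▸ SetLike.GradedMul.mul_mem a.2 b.2⟩

namespace GrMod

attribute [instance] GrMod.addCommGroup

variable {𝒜}

/-- Morphisms of graded modules: homomorphisms of modules which preserve degrees. -/
@[ext]
structure Hom (M N : GrMod 𝒜) where
  app : ∀ i, M.carrier i →+ N.carrier i
  app_act : ∀ {i j k : ℤ} (h : i + j = k) (x : M.carrier i) (a : 𝒜 j),
    app k (M.act h x a) = N.act h (app i x) a

/-- The category `Gr_Λ`. -/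
instance : Category (GrMod 𝒜) where
  Hom := Hom
  id M := ⟨fun i => AddMonoidHom.id _, fun _ _ _ => rfl⟩
  comp f g := ⟨fun i => (g.app i).comp (f.app i), fun h x a => by simp [f.app_act, g.app_act]⟩

@[ext]
theorem hom_ext {M N : GrMod 𝒜} {f g : M ⟶ N} (h : ∀ i x, f.app i x = g.app i x) : f = g :=
  Hom.ext (funext fun i => AddMonoidHom.ext (h i))

@[simp] theorem id_app (M : GrMod 𝒜) (i : ℤ) (x : M.carrier i) : Hom.app (𝟙 M) i x = x := rfl
@[simp] theorem comp_app {M N P : GrMod 𝒜} (f : M ⟶ N) (g : N ⟶ P) (i : ℤ) (x : M.carrier i) :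
    Hom.app (f ≫ g) i x = g.app i (f.app i x) := rfl

/-- Right multiplication by `a` as an additive map. -/
def actHom (M : GrMod 𝒜) {i j k : ℤ} (h : i + j = k) (a : 𝒜 j) : M.carrier i →+ M.carrier k :=
  AddMonoidHom.mk' (fun x => M.act h x a) fun x y => M.add_act h x y a

@[simp] theorem actHom_apply (M : GrMod 𝒜) {i j k : ℤ} (h : i + j = k) (a : 𝒜 j)
    (x : M.carrier i) : M.actHom h a x = M.act h x a := rfl

@[simp] theorem zero_act (M : GrMod 𝒜) {i j k : ℤ} (h : i + j = k) (a : 𝒜 j) :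
    M.act h 0 a = 0 := (M.actHom h a).map_zero
theorem neg_act (M : GrMod 𝒜) {i j k : ℤ} (h : i + j = k) (x : M.carrier i) (a : 𝒜 j) :
    M.act h (-x) a = -M.act h x a := (M.actHom h a).map_neg x
theorem sub_act (M : GrMod 𝒜) {i j k : ℤ} (h : i + j = k) (x y : M.carrier i) (a : 𝒜 j) :
    M.act h (x - y) a = M.act h x a - M.act h y a := (M.actHom h a).map_sub x y

variable {M N : GrMod 𝒜}

instance : Zero (M ⟶ N) := ⟨⟨fun _ => 0, fun _ _ _ => by simp⟩⟩
instance : Add (M ⟶ N) :=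
  ⟨fun f g => ⟨fun i => f.app i + g.app i, fun _ _ _ => by simp [f.app_act, g.app_act, add_act]⟩⟩
instance : Neg (M ⟶ N) :=
  ⟨fun f => ⟨fun i => -f.app i, fun _ _ _ => by simp [f.app_act, neg_act]⟩⟩
instance : Sub (M ⟶ N) :=
  ⟨fun f g => ⟨fun i => f.app i - g.app i, fun _ _ _ => by simp [f.app_act, g.app_act, sub_act]⟩⟩
instance : SMul ℕ (M ⟶ N) := ⟨nsmulRec⟩
instance : SMul ℤ (M ⟶ N) := ⟨zsmulRec⟩

@[simp] theorem zero_app (i : ℤ) (x : M.carrier i) : Hom.app (0 : M ⟶ N) i x = 0 := rfl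
@[simp] theorem add_app (f g : M ⟶ N) (i : ℤ) (x : M.carrier i) :
    Hom.app (f + g) i x = f.app i x + g.app i x := rfl
@[simp] theorem neg_app (f : M ⟶ N) (i : ℤ) (x : M.carrier i) :
    Hom.app (-f) i x = -f.app i x := rfl
@[simp] theorem sub_app (f g : M ⟶ N) (i : ℤ) (x : M.carrier i) :
    Hom.app (f - g) i x = f.app i x - g.app i x := rfl

instance : AddCommGroup (M ⟶ N) where
  add_assoc f g h := by ext; simp [add_assoc]
  zero_add f := by ext; simp
  add_zero f := by ext; simp
  add_comm f g := by ext; simp [add_comm]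
  neg_add_cancel f := by ext; simp
  sub_eq_add_neg f g := by ext; simp [sub_eq_add_neg]
  nsmul := nsmulRec
  zsmul := zsmulRec

instance : Preadditive (GrMod 𝒜) where
  add_comp _ _ _ f g h := by ext; simp
  comp_add _ _ _ f g h := by ext; simp

/-- The shift `M[k]`, with `M[k]_i = M_{i+k}`. -/
def shift (M : GrMod 𝒜) (k : ℤ) : GrMod 𝒜 where
  carrier i := M.carrier (i + k)
  act h x a := M.act (by omega) x a
  add_act h x y a := M.add_act _ x y a
  act_add h x a b := M.act_add _ x a b
  act_one {i} x := by
    have key : ∀ (p q : ℤ) (e : p + 0 = q) (hpq : p = q) (x : M.carrier p),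
        M.act e x ⟨1, SetLike.GradedOne.one_mem⟩ = hpq ▸ x := by
      rintro p q e rfl x
      exact M.act_one x
    exact key _ _ _ rfl x
  act_act h₁ h₂ h₃ h₄ x a b := M.act_act _ _ h₃ _ x a b

/-- The direct sum of a family of graded modules. -/
def directSum {ι : Type u} (F : ι → GrMod 𝒜) : GrMod 𝒜 where
  carrier i := DirectSum ι fun s => (F s).carrier i
  act h x a := DirectSum.map (fun s => (F s).actHom h a) x
  add_act h x y a := map_add _ x y
  act_add h x a b := by
    refine DFinsupp.ext fun s => ?_
    exact (F s).act_add h _ a b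
  act_one x := by
    refine DFinsupp.ext fun s => ?_
    exact (F s).act_one _
  act_act h₁ h₂ h₃ h₄ x a b := by
    refine DFinsupp.ext fun s => ?_
    exact (F s).act_act h₁ h₂ h₃ h₄ _ a b

variable (𝒜) in
/-- The component of degree `k` of `D(Λ) = 𝓗om_{Λ₀}(Λ, Λ₀)`: the `Λ₀`-linear maps
`Λ_{-k} → Λ₀`. -/
def dualPart (k : ℤ) : AddSubgroup (𝒜 (-k) →+ 𝒜 0) where
  carrier := {f | ∀ (x : 𝒜 (-k)) (e : 𝒜 0),
    (f ⟨x * e, by simpa using SetLike.GradedMul.mul_mem x.2 e.2⟩ : Λ) = f x * e}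
  zero_mem' := by intro x e; simp
  add_mem' {f g} hf hg := by intro x e; simp [hf x e, hg x e, add_mul]
  neg_mem' {f} hf := by intro x e; simp [hf x e]

variable (𝒜) in
/-- The graded right `Λ`-module `D(Λ) = 𝓗om_{Λ₀}(Λ, Λ₀)`, with `(f · a)(x) = f (a x)`. As `Λ₀` is a
finite product of copies of `K`, it is identified with the graded `K`-dual of the left module `Λ` by
the trace `Λ₀ → K`. -/
def dual : GrMod 𝒜 where
  carrier k := dualPart 𝒜 k
  act {i j k} h f a :=
    ⟨AddMonoidHom.mk'
      (fun x => f.1 ⟨a * x, by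
        have := SetLike.GradedMul.mul_mem a.2 x.2
        rwa [show j + -k = -i by omega] at this⟩)
      (fun x y => by
        rw [← map_add]; congr 1; ext1; simp [mul_add]),
     fun x e => by
      have h2 := f.2 ⟨a * x, by
        have := SetLike.GradedMul.mul_mem a.2 x.2
        rwa [show j + -k = -i by omega] at this⟩ e
      refine Eq.trans ?_ h2
      change ((f.1 _ : 𝒜 0) : Λ) = f.1 _
      congr 3
      simp [mul_assoc]⟩
  add_act h x y a := by
    ext; rfl
  act_add {i j k} h f a b := by
    ext x
    change ((f.1 _ : 𝒜 0) : Λ) = ((f.1 _ + f.1 _ : 𝒜 0) : Λ)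
    rw [← map_add]
    congr 3
    simp [add_mul]
  act_one f := by
    ext x
    change ((f.1 _ : 𝒜 0) : Λ) = f.1 _
    simp
  act_act h₁ h₂ h₃ h₄ f a b := by
    ext x
    change ((f.1 _ : 𝒜 0) : Λ) = f.1 _
    congr 3
    simp [mul_assoc]

/-- Almost injective graded modules: the direct summands of direct sums of shifts of `D(Λ)`, that
is, the objects of `Add(⨁ₖ D(Λ)[k])`. -/
def IsAlmostInjective (M : GrMod 𝒜) : Prop :=
  ∃ (ι : Type u) (k : ι → ℤ), Nonempty (Retract M (directSum fun s => (dual 𝒜).shift (k s)))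

/-- A family of subgroups of the homogeneous components is a graded submodule. -/
def IsGrSubmodule (M : GrMod 𝒜) (N : ∀ i, AddSubgroup (M.carrier i)) : Prop :=
  ∀ {i j k : ℤ} (h : i + j = k) (x : M.carrier i) (a : 𝒜 j), x ∈ N i → M.act h x a ∈ N k

/-- `M` is cogenerated in degree `d`: the support of every nonzero graded submodule contains `d`. -/
def IsCogeneratedInDegree (M : GrMod 𝒜) (d : ℤ) : Prop :=
  ∀ N : ∀ i, AddSubgroup (M.carrier i), M.IsGrSubmodule N → (∃ i, N i ≠ ⊥) → N d ≠ ⊥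

/-- The component of degree `i` of the graded socle `{x ∈ M | x J = 0}`, `J = ⨁_{j > 0} 𝒜 j`. -/
def socle (M : GrMod 𝒜) (i : ℤ) : AddSubgroup (M.carrier i) where
  carrier := {x | ∀ (j k : ℤ) (h : i + j = k) (a : 𝒜 j), 0 < j → M.act h x a = 0}
  zero_mem' := by intro j k h a _; simp
  add_mem' hx hy := by intro j k h a hj; rw [add_act, hx j k h a hj, hy j k h a hj, add_zero]
  neg_mem' hx := by intro j k h a hj; rw [neg_act, hx j k h a hj, neg_zero]

/-- The graded socle of the target of `f` is contained in the image of `f`. -/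
def SocleLERange (f : M ⟶ N) : Prop := ∀ i, N.socle i ≤ (f.app i).range

end GrMod

/-! ### Linear `n`-complexes of almost injective modules

A pair `(I, d)` consisting of a family `(I^j)` of graded modules and morphisms
`d^j : I^j ⟶ I^{j+1}` is the same thing as a functor from the ordered set `ℤ` to `Gr_Λ`: the map
`I^i ⟶ I^j` induced by `i ≤ j` is the composition `d^{j-1} ∘ ⋯ ∘ d^i`. The morphisms of pairs are
the natural transformations. -/

/-- The linear `n`-complexes of almost injective modules: the composition of any `n` consecutive
differentials is zero, and `I^k` is almost injective and cogenerated in degree `-k`. -/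
def isLinearNComplex (n : ℕ) : ObjectProperty (ℤ ⥤ GrMod 𝒜) := fun I =>
  (∀ k : ℤ, I.map (homOfLE (show k ≤ k + n by omega)) = 0) ∧
    ∀ k : ℤ, (I.obj k).IsAlmostInjective ∧ (I.obj k).IsCogeneratedInDegree (-k)

/-- The category `ₙLC*_Λ` of linear `n`-complexes of almost injective graded modules. -/
abbrev LinearNComplex (n : ℕ) := (isLinearNComplex 𝒜 n).FullSubcategory

/-- The set `𝒮 = (m + nℤ) ∪ (m + nℤ + 1)`. -/
def supportSet (n : ℕ) (m : ℤ) : Set ℤ := {j | ∃ k : ℤ, j = m + k * n ∨ j = m + k * n + 1}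

/-- The class `𝒯*` of the linear `n`-complexes `I` with `I^j = 0` for all `j ∈ 𝒮`. -/
def torsionClass (n : ℕ) (m : ℤ) : ObjectProperty (LinearNComplex 𝒜 n) := fun I =>
  ∀ j ∈ supportSet n m, Limits.IsZero (I.obj.obj j)

/-- The full subcategory `𝒢*(𝒮, 𝒰)`. It is everything for `n = 2`; for `n > 2` it is given by
the conditions that `Hom(D(Λ)[j], Ker d^j) = 0` for `j ∉ 𝒮` and `Soc(I^j) ⊆ Im d^{j-1}` for
`j ≢ m` modulo `n`. (A morphism to `Ker d^j` is a morphism `f` to `I^j` with `d^j ∘ f = 0`.) -/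
def isGStar (n : ℕ) (m : ℤ) : ObjectProperty (LinearNComplex 𝒜 n) := fun I =>
  2 < n →
    (∀ j : ℤ, j ∉ supportSet n m → ∀ f : (GrMod.dual 𝒜).shift j ⟶ I.obj.obj j,
      f ≫ I.obj.map (homOfLE (show j ≤ j + 1 by omega)) = 0 → f = 0) ∧
    (∀ j : ℤ, ¬ j ≡ m [ZMOD n] →
      GrMod.SocleLERange (I.obj.map (homOfLE (show j - 1 ≤ j by omega))))

/-! ### The contraction functor -/

/-- The strictly increasing enumeration `δ_m` of `𝒮`: `δ_m(2k) = m + kn`, `δ_m(2k+1) = m + kn + 1`. -/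
def contractionIndex (n : ℕ) (m j : ℤ) : ℤ := m + j / 2 * n + j % 2

theorem contractionIndex_even (n : ℕ) (m k : ℤ) : contractionIndex n m (2 * k) = m + k * n := by
  simp [contractionIndex]

theorem contractionIndex_odd (n : ℕ) (m k : ℤ) :
    contractionIndex n m (2 * k + 1) = m + k * n + 1 := by
  rw [contractionIndex, show (2 * k + 1) / 2 = k by omega, show (2 * k + 1) % 2 = 1 by omega]

theorem contractionIndex_le {n : ℕ} (hn : 2 ≤ n) (m : ℤ) {i j : ℤ} (h : i + 1 = j) :
    contractionIndex n m i ≤ contractionIndex n m j := by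
  subst h
  obtain ⟨k, rfl | rfl⟩ := Int.even_or_odd' i
  · rw [contractionIndex_even, contractionIndex_odd]; omega
  · rw [show 2 * k + 1 + 1 = 2 * (k + 1) by ring, contractionIndex_even, contractionIndex_odd,
      add_mul]
    omega

theorem contractionIndex_add_two (n : ℕ) (m : ℤ) {i j l : ℤ} (h : i + 1 = j) (h' : j + 1 = l) :
    contractionIndex n m l = contractionIndex n m i + n := by
  subst h h'
  rw [contractionIndex, contractionIndex, show (i + 1 + 1) / 2 = i / 2 + 1 by omega,
    show (i + 1 + 1) % 2 = i % 2 by omega]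
  ring

variable {𝒜}

/-- The contraction of an `n`-complex `I`: the complex with `Ĩ^k = I^{δ_m(k)}`, whose differential
`Ĩ^k ⟶ Ĩ^{k+1}` is the composition of the differentials of `I` from `I^{δ_m(k)}` to
`I^{δ_m(k+1)}`, i.e. `d^{m+jn}` for `k = 2j` and `d^{m+(j+1)n-1} ∘ ⋯ ∘ d^{m+jn+1}` for
`k = 2j + 1`. -/
def contractionObj {n : ℕ} (hn : 2 ≤ n) (m : ℤ) (I : LinearNComplex 𝒜 n) :
    CochainComplex (GrMod 𝒜) ℤ where
  X k := I.obj.obj (contractionIndex n m k)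
  d i j := if h : i + 1 = j then I.obj.map (homOfLE (contractionIndex_le hn m h)) else 0
  shape i j h := dif_neg h
  d_comp_d' i j l h h' := by
    rw [dif_pos (show i + 1 = j from h), dif_pos (show j + 1 = l from h'), ← I.obj.map_comp]
    have key : ∀ (q : ℤ) (f : contractionIndex n m i ⟶ q),
        q = contractionIndex n m i + n → I.obj.map f = 0 := by
      rintro q f rfl
      exact I.property.1 _
    exact key _ _ (contractionIndex_add_two n m h h')

variable (𝒜)

/-- The contraction functor `H = H_m : ₙLC*_Λ ⥤ C(Gr_Λ)`. -/
def contraction {n : ℕ} (hn : 2 ≤ n) (m : ℤ) :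
    LinearNComplex 𝒜 n ⥤ CochainComplex (GrMod 𝒜) ℤ where
  obj I := contractionObj hn m I
  map f :=
    { f := fun k => f.hom.app (contractionIndex n m k)
      comm' := fun i j h => by
        have h' : i + 1 = j := h
        simp [contractionObj, h'] }

/-! ### Abelian categories and quotient categories -/

/-- The preadditive category `C` is abelian. -/
structure IsAbelianCategory (C : Type*) [Category* C] [Preadditive C] : Prop where
  hasFiniteProducts : Limits.HasFiniteProducts C
  hasKernels : Limits.HasKernels C
  hasCokernels : Limits.HasCokernels C
  isNormalMonoCategory : IsNormalMonoCategory C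
  isNormalEpiCategory : IsNormalEpiCategory C

/-- The morphisms whose kernel and cokernel belong to `P`. For a Serre class `P` in an abelian
category `C`, the quotient category `C/P` is the localization of `C` at this class of morphisms. -/
def isoModulo {C : Type*} [Category* C] [Preadditive C] (P : ObjectProperty C) :
    MorphismProperty C := fun _ _ f =>
  (∃ c : Limits.KernelFork f, Nonempty (Limits.IsLimit c) ∧ P c.pt) ∧
    (∃ c : Limits.CokernelCofork f, Nonempty (Limits.IsColimit c) ∧ P c.pt)

end

/-!
An almost injective module cogenerated in degree `d` is cofree on its component of degree `d`: its
morphisms are the `Λ₀`-linear maps between these components, and as `Λ₀` is semisimple, kernels and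
cokernels of morphisms between such modules are again of this kind. A linear `n`-complex `I` is
therefore given by the `Λ₀`-modules `W_j = (I^j)_{-j}` of cogenerators together with maps
`W_j → W_{j+1}` indexed by the arrows of the quiver, and `I` belongs to `𝒢*(𝒮, 𝒰)` (for `n > 2`) if
and only if no nonzero element of `W_j` is annihilated by all arrows for `j ∉ 𝒮`, and the
differential maps onto `W_j` for `j ≢ m` modulo `n`.

By the last condition, a morphism between objects of `𝒢*(𝒮, 𝒰)` propagates from `𝒮` to the
following degrees, whence faithfulness. Any complex whose contraction satisfies (b) is brought into
`𝒢*(𝒮, 𝒰)` without changing its components in `𝒮`: replace it first by the subcomplex generated by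
these components, and then by the quotient by the largest subcomplex vanishing on `𝒮`.

If there are no relations of degree less than `n`, then every path of length less than `n` has dual
elements in `I^j`, so a composition of at most `n - 1` differentials determines the action of the
paths on `W_j`. A morphism of contractions then commutes with the paths leading from `m + kn + 1` to
`m + (k + 1)n`, and these separate the cogenerators in the intermediate degrees, so it extends
there one degree at a time.
-/

noncomputable section

variable {K : Type w} [Field K] {Λ : Type u} [Ring Λ] [Algebra K Λ]
variable {𝒜 : ℤ → Submodule K Λ} [GradedAlgebra 𝒜]

/-! ### Graded modules form an abelian category -/

namespace GrMod

variable {M N P : GrMod 𝒜}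

variable (M) in
/-- A graded submodule of `M`, given by its homogeneous components. -/
structure GrSubmodule where
  part : ∀ i, AddSubgroup (M.carrier i)
  isGrSubmodule : M.IsGrSubmodule part

namespace GrSubmodule

/-- A graded submodule, regarded as a graded module. -/
def toGrMod (S : M.GrSubmodule) : GrMod 𝒜 where
  carrier i := S.part i
  act h x a := ⟨M.act h x a, S.isGrSubmodule h x a x.2⟩
  add_act h x y a := Subtype.ext (M.add_act h x y a)
  act_add h x a b := Subtype.ext (M.act_add h x a b)
  act_one x := Subtype.ext (M.act_one x.1)
  act_act h₁ h₂ h₃ h₄ x a b := Subtype.ext (M.act_act h₁ h₂ h₃ h₄ x.1 a b)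

/-- The inclusion of a graded submodule. -/
def subtype (S : M.GrSubmodule) : S.toGrMod ⟶ M where
  app i := (S.part i).subtype
  app_act _ _ _ := rfl

theorem subtype_injective (S : M.GrSubmodule) (i : ℤ) :
    Function.Injective (S.subtype.app i) :=
  Subtype.val_injective

def codRestrict (S : M.GrSubmodule) (f : N ⟶ M) (hf : ∀ i x, f.app i x ∈ S.part i) :
    N ⟶ S.toGrMod where
  app i := (f.app i).codRestrict (S.part i) (hf i)
  app_act h x a := Subtype.ext (f.app_act h x a)

/-- The quotient of a graded module by a graded submodule. -/
def quotient (S : M.GrSubmodule) : GrMod 𝒜 where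
  carrier i := M.carrier i ⧸ S.part i
  act {i k} _ h x a :=
    QuotientAddGroup.map (S.part i) (S.part _) (M.actHom h a)
      (fun x hx => S.isGrSubmodule h x a hx) x
  add_act _ x y _ := map_add _ x y
  act_add h := by
    rintro ⟨x⟩ a b
    exact congrArg _ (M.act_add h x a b)
  act_one := by
    rintro i ⟨x⟩
    exact congrArg _ (M.act_one x)
  act_act h₁ h₂ h₃ h₄ := by
    rintro ⟨x⟩ a b
    exact congrArg _ (M.act_act h₁ h₂ h₃ h₄ x a b)

/-- The projection to the quotient by a graded submodule. -/
def mkQ (S : M.GrSubmodule) : M ⟶ S.quotient where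
  app i := QuotientAddGroup.mk' (S.part i)
  app_act _ _ _ := rfl

theorem mkQ_surjective (S : M.GrSubmodule) (i : ℤ) : Function.Surjective (S.mkQ.app i) :=
  QuotientAddGroup.mk'_surjective _

theorem mkQ_eq_zero_iff (S : M.GrSubmodule) {i : ℤ} {x : M.carrier i} :
    S.mkQ.app i x = 0 ↔ x ∈ S.part i :=
  QuotientAddGroup.eq_zero_iff x

def liftQ (S : M.GrSubmodule) (f : M ⟶ N) (hf : ∀ i, ∀ x ∈ S.part i, f.app i x = 0) :
    S.quotient ⟶ N where
  app i := QuotientAddGroup.lift (S.part i) (f.app i) (hf i)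
  app_act h := by
    rintro ⟨x⟩ a
    exact f.app_act h x a

end GrSubmodule

theorem Hom.congr_app {f g : M ⟶ N} (h : f = g) (i : ℤ) (x : M.carrier i) :
    f.app i x = g.app i x := by
  rw [h]

/-- The kernel of a morphism, as a graded submodule of its source. -/
def Hom.ker (f : M ⟶ N) : M.GrSubmodule where
  part i := (f.app i).ker
  isGrSubmodule h x a hx := by
    rw [AddMonoidHom.mem_ker] at hx ⊢
    rw [f.app_act, hx, zero_act]

/-- The image of a morphism, as a graded submodule of its target. -/
def Hom.range (f : M ⟶ N) : N.GrSubmodule where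
  part i := (f.app i).range
  isGrSubmodule := by
    rintro i j k h _ a ⟨y, rfl⟩
    exact ⟨M.act h y a, f.app_act h y a⟩

theorem exact_subtype_ker (f : M ⟶ N) (i : ℤ) :
    Function.Exact ((Hom.ker f).subtype.app i) (f.app i) :=
  fun x => ⟨fun hx => ⟨⟨x, hx⟩, rfl⟩, by rintro ⟨y, rfl⟩; exact y.2⟩

theorem exact_mkQ_range (f : M ⟶ N) (i : ℤ) :
    Function.Exact (f.app i) ((Hom.range f).mkQ.app i) :=
  fun _ => (Hom.range f).mkQ_eq_zero_iff

theorem comp_eq_zero_of_exact {f : M ⟶ N} {g : N ⟶ P}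
    (h : ∀ i, Function.Exact (f.app i) (g.app i)) : f ≫ g = 0 := by
  ext i x
  exact (h i).apply_apply_eq_zero x

theorem mono_of_injective (f : M ⟶ N) (hf : ∀ i, Function.Injective (f.app i)) : Mono f where
  right_cancellation g h e := by
    ext i x
    exact hf i (Hom.congr_app e i x)

theorem epi_of_surjective (f : M ⟶ N) (hf : ∀ i, Function.Surjective (f.app i)) : Epi f where
  left_cancellation g h e := by
    ext i x
    obtain ⟨x, rfl⟩ := hf i x
    exact Hom.congr_app e i x

theorem injective_of_mono (f : M ⟶ N) [Mono f] (i : ℤ) : Function.Injective (f.app i) := by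
  rw [injective_iff_map_eq_zero]
  intro x hx
  have subtype_eq_zero : (Hom.ker f).subtype = 0 := by
    rw [← cancel_mono f, comp_eq_zero_of_exact (exact_subtype_ker f), Limits.zero_comp]
  exact Hom.congr_app subtype_eq_zero i ⟨x, hx⟩

theorem surjective_of_epi (f : M ⟶ N) [Epi f] (i : ℤ) : Function.Surjective (f.app i) := by
  intro x
  have mkQ_eq_zero : (Hom.range f).mkQ = 0 := by
    rw [← cancel_epi f, comp_eq_zero_of_exact (exact_mkQ_range f), Limits.comp_zero]
  exact (Hom.range f).mkQ_eq_zero_iff.1 (Hom.congr_app mkQ_eq_zero i x)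

section Exact

variable {f : M ⟶ N} {g : N ⟶ P} (hfg : ∀ i, Function.Exact (f.app i) (g.app i))

def isLimitKernelFork (hf : ∀ i, Function.Injective (f.app i)) :
    Limits.IsLimit (Limits.KernelFork.ofι f (comp_eq_zero_of_exact hfg)) :=
  have := mono_of_injective f hf
  Limits.KernelFork.IsLimit.ofι' f _ fun {A} k hk =>
    let lift (i : ℤ) : A.carrier i →+ M.carrier i :=
      (AddMonoidHom.ofInjective (hf i)).symm.toAddMonoidHom.comp <|
        (k.app i).codRestrict _ fun x => (hfg i _).1 (Hom.congr_app hk i x)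
    have app_lift (i : ℤ) (x : A.carrier i) : f.app i (lift i x) = k.app i x :=
      AddMonoidHom.apply_ofInjective_symm (hf i) _
    ⟨{ app := lift
       app_act := fun h x a => hf _ <| by
        rw [f.app_act, app_lift, app_lift, k.app_act] },
      by ext i x; exact app_lift i x⟩

def isColimitCokernelCofork (hg : ∀ i, Function.Surjective (g.app i)) :
    Limits.IsColimit (Limits.CokernelCofork.ofπ g (comp_eq_zero_of_exact hfg)) :=
  have := epi_of_surjective g hg
  Limits.CokernelCofork.IsColimit.ofπ' g _ fun {A} k hk =>
    have ker_le (i : ℤ) : (g.app i).ker ≤ (k.app i).ker := fun x hx => by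
      obtain ⟨y, rfl⟩ := (hfg i x).1 hx
      exact Hom.congr_app hk i y
    let desc (i : ℤ) : P.carrier i →+ A.carrier i :=
      (g.app i).liftOfSurjective (hg i) ⟨k.app i, ker_le i⟩
    have desc_app (i : ℤ) (x : N.carrier i) : desc i (g.app i x) = k.app i x :=
      AddMonoidHom.liftOfRightInverse_comp_apply ..
    ⟨{ app := desc
       app_act := fun {i j l} h y a => by
        obtain ⟨x, rfl⟩ := hg i y
        rw [← g.app_act, desc_app, desc_app, k.app_act] },
      by ext i x; exact desc_app i x⟩

end Exact

instance : Limits.HasKernels (GrMod 𝒜) where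
  has_limit f := ⟨⟨_, isLimitKernelFork (exact_subtype_ker f)
    (Hom.ker f).subtype_injective⟩⟩

instance : Limits.HasCokernels (GrMod 𝒜) where
  has_colimit f := ⟨⟨_, isColimitCokernelCofork (exact_mkQ_range f)
    (Hom.range f).mkQ_surjective⟩⟩

instance : IsNormalMonoCategory (GrMod 𝒜) where
  normalMonoOfMono f _ :=
    ⟨{  Z := _
        g := (Hom.range f).mkQ
        w := _
        isLimit := isLimitKernelFork (exact_mkQ_range f) (injective_of_mono f) }⟩

instance : IsNormalEpiCategory (GrMod 𝒜) where
  normalEpiOfEpi f _ :=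
    ⟨{  W := _
        g := (Hom.ker f).subtype
        w := _
        isColimit := isColimitCokernelCofork (exact_subtype_ker f) (surjective_of_epi f) }⟩

/-- The product of two graded modules. -/
def prod (M N : GrMod 𝒜) : GrMod 𝒜 where
  carrier i := M.carrier i × N.carrier i
  act h x a := (M.act h x.1 a, N.act h x.2 a)
  add_act h x y a := Prod.ext (M.add_act h x.1 y.1 a) (N.add_act h x.2 y.2 a)
  act_add h x a b := Prod.ext (M.act_add h x.1 a b) (N.act_add h x.2 a b)
  act_one x := Prod.ext (M.act_one x.1) (N.act_one x.2)
  act_act h₁ h₂ h₃ h₄ x a b :=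
    Prod.ext (M.act_act h₁ h₂ h₃ h₄ x.1 a b) (N.act_act h₁ h₂ h₃ h₄ x.2 a b)

def prodBicone (M N : GrMod 𝒜) : Limits.BinaryBicone M N where
  pt := prod M N
  fst := ⟨fun _ => AddMonoidHom.fst _ _, fun _ _ _ => rfl⟩
  snd := ⟨fun _ => AddMonoidHom.snd _ _, fun _ _ _ => rfl⟩
  inl := ⟨fun _ => AddMonoidHom.inl _ _, fun h _ a => Prod.ext rfl (zero_act N h a).symm⟩
  inr := ⟨fun _ => AddMonoidHom.inr _ _, fun h _ a => Prod.ext (zero_act M h a).symm rfl⟩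
  inl_fst := rfl
  inl_snd := rfl
  inr_fst := rfl
  inr_snd := rfl

instance : Limits.HasBinaryBiproducts (GrMod 𝒜) where
  has_binary_biproduct M N := Limits.HasBinaryBiproduct.mk
    ⟨prodBicone M N, Limits.isBinaryBilimitOfTotal _ <| by
      ext i x
      exact Prod.ext (add_zero x.1) (zero_add x.2)⟩

theorem isZero_iff (M : GrMod 𝒜) : Limits.IsZero M ↔ ∀ i (x : M.carrier i), x = 0 := by
  rw [Limits.IsZero.iff_id_eq_zero]
  exact ⟨fun h i x => Hom.congr_app h i x, fun h => by ext i x; exact h i x⟩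

variable (𝒜) in
/-- The zero graded module. -/
def zero : GrMod 𝒜 where
  carrier _ := PUnit
  act _ _ _ := 0
  add_act _ _ _ _ := rfl
  act_add _ _ _ _ := rfl
  act_one _ := rfl
  act_act _ _ _ _ _ _ _ := rfl

instance : Limits.HasZeroObject (GrMod 𝒜) :=
  ⟨⟨zero 𝒜, (isZero_iff _).2 fun _ _ => rfl⟩⟩

instance : Limits.HasFiniteProducts (GrMod 𝒜) :=
  hasFiniteProducts_of_has_binary_and_terminal

instance : Abelian (GrMod 𝒜) where

theorem isIso_iff_bijective (f : M ⟶ N) : IsIso f ↔ ∀ i, Function.Bijective (f.app i) := by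
  refine ⟨fun _ i => ⟨injective_of_mono f i, surjective_of_epi f i⟩, fun h => ?_⟩
  have := mono_of_injective f fun i => (h i).1
  have := epi_of_surjective f fun i => (h i).2
  exact isIso_of_mono_of_epi f

end GrMod

/-! ### Graded factors of path algebras are spanned by paths -/

namespace PathAlgebra

variable {V : Type v₁} [Quiver.{v₂} V]

/-- A path, as an element of the path algebra. -/
def ofPath {a b : V} (p : Quiver.Path a b) : PathAlgebra K V :=
  open Classical in
  ⟨Pi.single a (Pi.single b (Finsupp.single p 1))⟩

theorem coeff_ofPath_self {a b : V} (p : Quiver.Path a b) :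
    (ofPath p : PathAlgebra K V).coeff a b = Finsupp.single p 1 := by
  simp [ofPath]

theorem coeff_ofPath_of_ne {a b c d : V} (p : Quiver.Path a b) (h : ¬ (c = a ∧ d = b)) :
    (ofPath p : PathAlgebra K V).coeff c d = 0 := by
  by_cases hc : c = a
  · subst hc
    have hd : d ≠ b := fun hd => h ⟨rfl, hd⟩
    simp [ofPath, hd]
  · simp [ofPath, hc]

/-- The coefficient of a path, as a linear form on the path algebra. -/
def coeffₗ {a b : V} (p : Quiver.Path a b) : PathAlgebra K V →ₗ[K] K where
  toFun f := f.coeff a b p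
  map_add' _ _ := by simp
  map_smul' _ _ := by simp

@[simp] theorem coeffₗ_apply {a b : V} (p : Quiver.Path a b) (f : PathAlgebra K V) :
    coeffₗ p f = f.coeff a b p := rfl

variable [Fintype V]

theorem ofPath_mem_degreePart {a b : V} (p : Quiver.Path a b) :
    (ofPath p : PathAlgebra K V) ∈ degreePart K V p.length := by
  intro c d q hq
  by_cases h : c = a ∧ d = b
  · obtain ⟨rfl, rfl⟩ := h
    rw [coeff_ofPath_self, Finsupp.single_apply_ne_zero] at hq
    rw [hq.1]
  · rw [coeff_ofPath_of_ne p h] at hq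
    exact absurd rfl hq

theorem eq_sum_ofPath (f : PathAlgebra K V) :
    f = ∑ a, ∑ b, (f.coeff a b).sum fun p c => c • (ofPath p : PathAlgebra K V) := by
  classical
  ext1
  funext a b
  ext p
  change coeffₗ p f = coeffₗ p _
  simp only [map_sum, Finsupp.sum, map_smul]
  rw [Finset.sum_eq_single a, Finset.sum_eq_single b]
  · simp [coeff_ofPath_self, Finsupp.single_apply]
  · intro d _ hd
    exact Finset.sum_eq_zero fun q _ => by simp [coeff_ofPath_of_ne q fun h => hd h.2.symm]
  · simp
  · intro c _ hc
    exact Finset.sum_eq_zero fun d _ => Finset.sum_eq_zero fun q _ => by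
      simp [coeff_ofPath_of_ne q fun h => hc h.1.symm]
  · simp

theorem span_ofPath : Submodule.span K
    {f : PathAlgebra K V | ∃ (a b : V) (p : Quiver.Path a b), ofPath p = f} = ⊤ := by
  refine eq_top_iff.2 fun f _ => ?_
  rw [eq_sum_ofPath f]
  exact sum_mem fun a _ => sum_mem fun b _ => sum_mem fun p _ =>
    Submodule.smul_mem _ _ (Submodule.subset_span ⟨a, b, p, rfl⟩)

theorem ofPath_mul_ofPath {a b c : V} (p : Quiver.Path a b) (q : Quiver.Path b c) :
    (ofPath p * ofPath q : PathAlgebra K V) = ofPath (p.comp q) := by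
  ext1
  funext x y
  rw [coeff_mul]
  by_cases hx : x = a
  · subst hx
    by_cases hy : y = c
    · subst hy
      rw [Finset.sum_eq_single b, coeff_ofPath_self, coeff_ofPath_self, coeff_ofPath_self,
        concat_single, one_mul]
      · intro z _ hz
        rw [coeff_ofPath_of_ne p fun h => hz h.2, map_zero, LinearMap.zero_apply]
      · simp
    · rw [coeff_ofPath_of_ne _ fun h => hy h.2]
      refine Finset.sum_eq_zero fun z _ => ?_
      rw [coeff_ofPath_of_ne q fun h => hy h.2, map_zero]
  · rw [coeff_ofPath_of_ne _ fun h => hx h.1]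
    refine Finset.sum_eq_zero fun z _ => ?_
    rw [coeff_ofPath_of_ne p fun h => hx h.1, map_zero, LinearMap.zero_apply]

theorem ofPath_mul_ofPath_of_ne {a b c d : V} (p : Quiver.Path a b) (q : Quiver.Path c d)
    (h : b ≠ c) : (ofPath p * ofPath q : PathAlgebra K V) = 0 := by
  ext1
  funext x y
  rw [coeff_mul]
  refine Finset.sum_eq_zero fun z _ => ?_
  by_cases hz : z = b
  · rw [coeff_ofPath_of_ne q fun h' => h (hz.symm.trans h'.1), map_zero]
  · rw [coeff_ofPath_of_ne p fun h' => hz h'.2, map_zero, LinearMap.zero_apply]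

theorem sum_ofPath_nil : ∑ a : V, (ofPath (Quiver.Path.nil : Quiver.Path a a)) =
    (1 : PathAlgebra K V) := by
  ext1
  funext x y
  ext p
  change coeffₗ p _ = _
  rw [map_sum, Finset.sum_eq_single x]
  · by_cases h : x = y
    · subst h
      simp [coeff_ofPath_self, coeff_one_self]
    · simp [coeff_one_of_ne h, coeff_ofPath_of_ne (Quiver.Path.nil : Quiver.Path x x)
        (c := x) (d := y) fun h' => h h'.2.symm]
  · intro z _ hz
    simp [coeff_ofPath_of_ne (Quiver.Path.nil : Quiver.Path z z)
        (c := x) (d := y) fun h' => hz h'.1.symm]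
  · simp

end PathAlgebra

namespace IsGradedFactor

variable {V : Type v₁} [Quiver.{v₂} V] [Fintype V] {π : PathAlgebra K V →ₐ[K] Λ}

open PathAlgebra

/-- The image in `Λ` of a path. The degree `k` is a separate argument, so that it need not be
syntactically the length of the path. -/
def path (hπ : IsGradedFactor 𝒜 π) {a b : V} (p : Quiver.Path a b) {k : ℤ}
    (h : (p.length : ℤ) = k) : 𝒜 k :=
  ⟨π (ofPath p), h ▸ hπ.map_mem _ _ (ofPath_mem_degreePart p)⟩

theorem span_path (hπ : IsGradedFactor 𝒜 π) (k : ℤ) :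
    Submodule.span K {x : 𝒜 k | ∃ (a b : V) (p : Quiver.Path a b) (h : (p.length : ℤ) = k),
      hπ.path p h = x} = ⊤ := by
  let proj : PathAlgebra K V →ₗ[K] 𝒜 k :=
    DirectSum.component K ℤ (fun i => 𝒜 i) k ∘ₗ
      (DirectSum.decomposeLinearEquiv 𝒜).toLinearMap ∘ₗ π.toLinearMap
  have proj_surjective : Function.Surjective proj := fun x => by
    obtain ⟨f, hf⟩ := hπ.surjective x
    refine ⟨f, ?_⟩
    change DirectSum.decompose 𝒜 (π f) k = x
    rw [hf, DirectSum.decompose_coe, DirectSum.of_eq_same]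
  rw [← top_le_iff, ← LinearMap.range_eq_top.2 proj_surjective, LinearMap.range_eq_map,
    ← span_ofPath, Submodule.map_span_le]
  rintro _ ⟨a, b, p, rfl⟩
  change DirectSum.decompose 𝒜 (hπ.path p rfl : Λ) k ∈ _
  rw [DirectSum.decompose_coe]
  by_cases hp : (p.length : ℤ) = k
  · subst hp
    rw [DirectSum.of_eq_same]
    exact Submodule.subset_span ⟨a, b, p, rfl, rfl⟩
  · rw [DirectSum.of_eq_of_ne _ _ _ (Ne.symm hp)]
    exact zero_mem _

@[elab_as_elim]
theorem path_induction (hπ : IsGradedFactor 𝒜 π) {k : ℤ} {motive : 𝒜 k → Prop} (x : 𝒜 k)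
    (path : ∀ (a b : V) (p : Quiver.Path a b) (h : (p.length : ℤ) = k), motive (hπ.path p h))
    (zero : motive 0) (add : ∀ x y, motive x → motive y → motive (x + y))
    (smul : ∀ (c : K) x, motive x → motive (c • x)) : motive x := by
  have hx : x ∈ (⊤ : Submodule K (𝒜 k)) := Submodule.mem_top
  rw [← hπ.span_path k] at hx
  induction hx using Submodule.span_induction with
  | mem x hx =>
    obtain ⟨a, b, p, h, rfl⟩ := hx
    exact path a b p h
  | zero => exact zero
  | add x y _ _ hx hy => exact add x y hx hy
  | smul c x _ hx => exact smul c x hx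

theorem eq_zero_of_neg (hπ : IsGradedFactor 𝒜 π) {k : ℤ} (hk : k < 0) (x : 𝒜 k) : x = 0 := by
  induction x using hπ.path_induction with
  | path a b p h => omega
  | zero => rfl
  | add x y hx hy => rw [hx, hy, add_zero]
  | smul c x hx => rw [hx, smul_zero]

theorem exists_mem_degreePart (hπ : IsGradedFactor 𝒜 π) {k : ℕ} (x : 𝒜 k) :
    ∃ f ∈ degreePart K V k, π f = x := by
  induction x using hπ.path_induction with
  | path a b p h => exact ⟨ofPath p, Nat.cast_inj.1 h ▸ ofPath_mem_degreePart p, rfl⟩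
  | zero => exact ⟨0, zero_mem _, map_zero π⟩
  | add x y hx hy =>
    obtain ⟨f, hf, hfx⟩ := hx
    obtain ⟨g, hg, hgy⟩ := hy
    exact ⟨f + g, add_mem hf hg, by rw [map_add, hfx, hgy, Submodule.coe_add]⟩
  | smul c x hx =>
    obtain ⟨f, hf, hfx⟩ := hx
    exact ⟨c • f, Submodule.smul_mem _ c hf, by rw [map_smul, hfx, Submodule.coe_smul]⟩

/-- The idempotent of a vertex. -/
def vertex (hπ : IsGradedFactor 𝒜 π) (a : V) : 𝒜 0 :=
  hπ.path (Quiver.Path.nil : Quiver.Path a a) (by simp)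

theorem sum_vertex (hπ : IsGradedFactor 𝒜 π) : ∑ a, hπ.vertex a = 1 := by
  ext
  rw [AddSubmonoidClass.coe_finsetSum]
  change ∑ a, π (ofPath (Quiver.Path.nil : Quiver.Path a a)) = 1
  rw [← map_sum, sum_ofPath_nil, map_one]

omit [GradedAlgebra 𝒜] in
theorem path_mul_path (hπ : IsGradedFactor 𝒜 π) {a b c : V} (p : Quiver.Path a b)
    (q : Quiver.Path b c) {k l m : ℤ} (hp : (p.length : ℤ) = k) (hq : (q.length : ℤ) = l)
    (h : ((p.comp q).length : ℤ) = m) :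
    (hπ.path p hp * hπ.path q hq : Λ) = hπ.path (p.comp q) h := by
  change π _ * π _ = π _
  rw [← map_mul, ofPath_mul_ofPath]

omit [GradedAlgebra 𝒜] in
theorem path_mul_path_of_ne (hπ : IsGradedFactor 𝒜 π) {a b c d : V} (p : Quiver.Path a b)
    (q : Quiver.Path c d) {k l : ℤ} (hp : (p.length : ℤ) = k) (hq : (q.length : ℤ) = l)
    (h : b ≠ c) : (hπ.path p hp * hπ.path q hq : Λ) = 0 := by
  change π _ * π _ = 0
  rw [← map_mul, ofPath_mul_ofPath_of_ne p q h, map_zero]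

theorem vertex_mul_self (hπ : IsGradedFactor 𝒜 π) (a : V) :
    hπ.vertex a * hπ.vertex a = hπ.vertex a :=
  Subtype.ext (hπ.path_mul_path _ _ _ _ rfl)

theorem vertex_mul_vertex_of_ne (hπ : IsGradedFactor 𝒜 π) {a b : V} (h : a ≠ b) :
    hπ.vertex a * hπ.vertex b = 0 :=
  Subtype.ext (hπ.path_mul_path_of_ne _ _ _ _ h)

/-- The homomorphism `K^V → Λ₀` sending the standard idempotents to those of the vertices. -/
def vertexHom (hπ : IsGradedFactor 𝒜 π) : (V → K) →+* 𝒜 0 where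
  toFun c := ∑ a, c a • hπ.vertex a
  map_zero' := by simp
  map_add' c d := by simp [add_smul, Finset.sum_add_distrib]
  map_one' := by simp [sum_vertex]
  map_mul' c d := by
    have smul_mul_smul (a b : V) : c a • hπ.vertex a * d b • hπ.vertex b =
        (c a * d b) • (hπ.vertex a * hπ.vertex b) :=
      Subtype.ext (smul_mul_smul_comm (c a) (hπ.vertex a : Λ) (d b) (hπ.vertex b : Λ))
    rw [Finset.sum_mul_sum]
    refine Finset.sum_congr rfl fun a _ => ?_
    rw [Finset.sum_eq_single a]
    · rw [smul_mul_smul, vertex_mul_self, Pi.mul_apply]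
    · intro b _ hb
      rw [smul_mul_smul, vertex_mul_vertex_of_ne hπ hb.symm, smul_zero]
    · simp

theorem vertexHom_apply (hπ : IsGradedFactor 𝒜 π) (c : V → K) :
    hπ.vertexHom c = ∑ a, c a • hπ.vertex a := rfl

theorem vertexHom_single (hπ : IsGradedFactor 𝒜 π) [DecidableEq V] (a : V) (r : K) :
    hπ.vertexHom (Pi.single a r) = r • hπ.vertex a := by
  rw [vertexHom_apply, Finset.sum_eq_single a]
  · rw [Pi.single_eq_same]
  · intro b _ hb
    rw [Pi.single_eq_of_ne hb, zero_smul]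
  · simp

theorem vertexHom_surjective (hπ : IsGradedFactor 𝒜 π) : Function.Surjective hπ.vertexHom := by
  classical
  intro x
  induction x using hπ.path_induction with
  | path a b p hp =>
    obtain rfl : a = b := p.eq_of_length_zero (by exact_mod_cast hp)
    obtain rfl : p = Quiver.Path.nil := p.eq_nil_of_length_zero (by exact_mod_cast hp)
    exact ⟨Pi.single a 1, by rw [vertexHom_single, one_smul, vertex]⟩
  | zero => exact ⟨0, map_zero _⟩
  | add x y hx hy =>
    obtain ⟨c, rfl⟩ := hx
    obtain ⟨d, rfl⟩ := hy
    exact ⟨c + d, map_add _ _ _⟩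
  | smul r x hx =>
    obtain ⟨c, rfl⟩ := hx
    exact ⟨r • c, by simp [vertexHom_apply, Finset.smul_sum, mul_smul]⟩

theorem isSemisimpleRing (hπ : IsGradedFactor 𝒜 π) : IsSemisimpleRing (𝒜 0)ᵐᵒᵖ :=
  have := RingHom.isSemisimpleRing_of_surjective _ hπ.vertexHom_surjective
  inferInstance

end IsGradedFactor

/-! ### Cofree modules -/

namespace GrMod

variable (𝒜) in
/-- The regular graded module. -/
def regular : GrMod 𝒜 where
  carrier i := 𝒜 i
  act h x a := ⟨x.1 * a.1, h ▸ SetLike.GradedMul.mul_mem x.2 a.2⟩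
  add_act _ x y a := Subtype.ext (add_mul x.1 y.1 a.1)
  act_add _ x a b := Subtype.ext (mul_add x.1 a.1 b.1)
  act_one x := Subtype.ext (mul_one x.1)
  act_act _ _ _ _ x a b := Subtype.ext (mul_assoc x.1 a.1 b.1)

instance (M : GrMod 𝒜) (i : ℤ) : Module (𝒜 0)ᵐᵒᵖ (M.carrier i) where
  smul r x := M.act (add_zero i) x r.unop
  one_smul x := M.act_one x
  mul_smul r s x := (M.act_act (add_zero i) (add_zero i) (add_zero 0) (add_zero i) x s.unop
    r.unop).symm
  smul_zero r := zero_act M (add_zero i) r.unop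
  smul_add r x y := M.add_act (add_zero i) x y r.unop
  add_smul r s x := M.act_add (add_zero i) x r.unop s.unop
  zero_smul x := by
    have h := M.act_add (add_zero i) x 0 0
    rw [add_zero] at h
    exact left_eq_add.1 h

theorem act_smul_op (M : GrMod 𝒜) {i j k : ℤ} (h : i + j = k) (x : M.carrier i) (a : 𝒜 j)
    (e : 𝒜 0) : M.act h x (show 𝒜 j from MulOpposite.op e • (show (regular 𝒜).carrier j from a)) =
      MulOpposite.op e • M.act h x a :=
  (M.act_act h (add_zero k) (add_zero j) h x a e).symm

theorem smul_op_act (M : GrMod 𝒜) {i j k : ℤ} (h : i + j = k) (x : M.carrier i) (a : 𝒜 j)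
    (e : 𝒜 0) : M.act h (MulOpposite.op e • x) a =
      M.act h x ⟨e * a, by simpa using SetLike.GradedMul.mul_mem e.2 a.2⟩ :=
  M.act_act (add_zero i) h (zero_add j) h x e a

/-- Multiplication of a fixed element by elements of `Λ`, as a `Λ₀`-linear map. -/
def actLinear (M : GrMod 𝒜) {i j k : ℤ} (h : i + j = k) (x : M.carrier i) :
    (regular 𝒜).carrier j →ₗ[(𝒜 0)ᵐᵒᵖ] M.carrier k where
  toFun a := M.act h x a
  map_add' a b := M.act_add h x a b
  map_smul' e a := M.act_smul_op h x a e.unop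

@[simp] theorem act_zero (M : GrMod 𝒜) {i j k : ℤ} (h : i + j = k) (x : M.carrier i) :
    M.act h x 0 = 0 := map_zero (M.actLinear h x)

theorem op_algebraMap_smul {j : ℤ} (c : K) (a : 𝒜 j) :
    MulOpposite.op (algebraMap K (𝒜 0) c) • (show (regular 𝒜).carrier j from a) = c • a := by
  refine Subtype.ext ?_
  change a.1 * algebraMap K Λ c = c • a.1
  rw [← Algebra.commutes, Algebra.smul_def]

theorem act_smul (M : GrMod 𝒜) {i j k : ℤ} (h : i + j = k) (x : M.carrier i) (c : K) (a : 𝒜 j) :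
    M.act h x (c • a) = MulOpposite.op (algebraMap K (𝒜 0) c) • M.act h x a := by
  rw [← act_smul_op, op_algebraMap_smul]

/-- A component of a morphism of graded modules, as a `Λ₀`-linear map. -/
def Hom.appLinear {M N : GrMod 𝒜} (f : M ⟶ N) (i : ℤ) :
    M.carrier i →ₗ[(𝒜 0)ᵐᵒᵖ] N.carrier i where
  toFun := f.app i
  map_add' := map_add _
  map_smul' e x := f.app_act (add_zero i) x e.unop

theorem Hom.app_smul {M N : GrMod 𝒜} (f : M ⟶ N) (i : ℤ) (e : (𝒜 0)ᵐᵒᵖ) (x : M.carrier i) :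
    f.app i (e • x) = e • f.app i x :=
  map_smul (Hom.appLinear f i) e x

/-- `M` is cofree on its component of degree `d`: the component of degree `i` is identified with
the `Λ₀`-linear maps from the component of `Λ` of degree `d - i` to that of `M` of degree `d`. -/
structure IsCofree (M : GrMod 𝒜) (d : ℤ) : Prop where
  eq_zero : ∀ {i k : ℤ} (h : i + k = d) (x : M.carrier i), (∀ a, M.act h x a = 0) → x = 0
  exists_act : ∀ {i k : ℤ} (h : i + k = d)
    (f : (regular 𝒜).carrier k →ₗ[(𝒜 0)ᵐᵒᵖ] M.carrier d), ∃ x, ∀ a : 𝒜 k, M.act h x a = f a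

namespace GrSubmodule

variable {M : GrMod 𝒜}

/-- A graded submodule which is determined by its component of degree `d`: it contains every element
whose multiples of degree `d` it contains. -/
def IsSaturated (S : M.GrSubmodule) (d : ℤ) : Prop :=
  ∀ {i k : ℤ} (h : i + k = d) (x : M.carrier i), (∀ a : 𝒜 k, M.act h x a ∈ S.part d) → x ∈ S.part i

end GrSubmodule

section Cogen

variable (M : GrMod 𝒜) {d : ℤ} (U : Submodule (𝒜 0)ᵐᵒᵖ (M.carrier d))

/-- The largest graded submodule of `M` whose component of degree `d` is contained in `U`. -/
def cogen : M.GrSubmodule where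
  part i :=
    { carrier := {x | ∀ (k : ℤ) (h : i + k = d) (a : 𝒜 k), M.act h x a ∈ U}
      zero_mem' k h a := by simp
      add_mem' hx hy k h a := by
        rw [add_act]
        exact add_mem (hx k h a) (hy k h a)
      neg_mem' hx k h a := by
        rw [neg_act]
        exact neg_mem (hx k h a) }
  isGrSubmodule {i j k} h x a hx l hl b := by
    rw [M.act_act h hl rfl (by omega)]
    exact hx _ _ _

variable {M U}

theorem mem_cogen {i k : ℤ} (h : i + k = d) {x : M.carrier i} :
    x ∈ (M.cogen U).part i ↔ ∀ a : 𝒜 k, M.act h x a ∈ U := by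
  refine ⟨fun hx => hx k h, fun hx l hl => ?_⟩
  obtain rfl : k = l := by omega
  exact hx

theorem mem_cogen_self {x : M.carrier d} : x ∈ (M.cogen U).part d ↔ x ∈ U := by
  rw [mem_cogen (add_zero d)]
  exact ⟨fun h => M.act_one x ▸ h 1, fun h a => U.smul_mem (MulOpposite.op a) h⟩

theorem isSaturated_cogen : (M.cogen U).IsSaturated d :=
  fun h _ hx => (mem_cogen h).2 fun a => mem_cogen_self.1 (hx a)

end Cogen

namespace IsCofree

variable {M N : GrMod 𝒜} {d : ℤ}

theorem ext (hM : M.IsCofree d) {i k : ℤ} (h : i + k = d) {x y : M.carrier i}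
    (hxy : ∀ a, M.act h x a = M.act h y a) : x = y := by
  rw [← sub_eq_zero]
  refine hM.eq_zero h _ fun a => ?_
  rw [sub_act, hxy, sub_self]

theorem hom_ext (hN : N.IsCofree d) {f g : M ⟶ N} (h : ∀ x, f.app d x = g.app d x) : f = g := by
  ext i x
  refine hN.ext (add_sub_cancel i d) fun a => ?_
  rw [← f.app_act, ← g.app_act, h]

theorem exists_hom_app_eq (hN : N.IsCofree d) (φ : M.carrier d →ₗ[(𝒜 0)ᵐᵒᵖ] N.carrier d) :
    ∃ f : M ⟶ N, ∀ x, f.app d x = φ x := by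
  choose g hg using fun (i : ℤ) (x : M.carrier i) =>
    hN.exists_act (add_sub_cancel i d) (φ ∘ₗ M.actLinear (add_sub_cancel i d) x)
  have act_g {i k : ℤ} (h : i + k = d) (x : M.carrier i) (a : 𝒜 k) :
      N.act h (g i x) a = φ (M.act h x a) := by
    obtain rfl : k = d - i := by omega
    exact hg i x a
  refine ⟨⟨fun i => AddMonoidHom.mk' (g i) fun x y => ?_, fun {i j k} h x a => ?_⟩, fun x => ?_⟩
  · refine hN.ext (add_sub_cancel i d) fun a => ?_
    rw [add_act, act_g, act_g, act_g, add_act, map_add]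
  · refine hN.ext (add_sub_cancel k d) fun b => ?_
    change N.act _ (g k (M.act h x a)) b = N.act _ (N.act h (g i x) a) b
    rw [act_g, N.act_act h _ (show j + (d - k) = d - i by omega) (by omega),
      M.act_act h _ (show j + (d - k) = d - i by omega) (by omega), act_g]
  · change g d x = φ x
    refine hN.ext (add_zero d) fun a => ?_
    rw [act_g]
    exact φ.map_smul (MulOpposite.op a) x

theorem of_bijective (hM : M.IsCofree d) (f : M ⟶ N) (hf : ∀ i, Function.Bijective (f.app i)) :
    N.IsCofree d where
  eq_zero {i k} h y hy := by
    obtain ⟨x, rfl⟩ := (hf i).2 y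
    rw [hM.eq_zero h x fun a => (hf d).1 (by rw [f.app_act, hy, map_zero]), map_zero]
  exists_act {i k} h g := by
    let e := LinearEquiv.ofBijective (Hom.appLinear f d) (hf d)
    obtain ⟨x, hx⟩ := hM.exists_act h (e.symm.toLinearMap ∘ₗ g)
    refine ⟨f.app i x, fun a => ?_⟩
    rw [← f.app_act, hx]
    exact e.apply_symm_apply _

theorem of_iso (hM : M.IsCofree d) (e : M ≅ N) : N.IsCofree d :=
  hM.of_bijective e.hom ((isIso_iff_bijective e.hom).1 inferInstance)

theorem of_isZero (hM : Limits.IsZero M) : M.IsCofree d where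
  eq_zero _ x _ := (isZero_iff M).1 hM _ x
  exists_act _ _ := ⟨0, fun _ => ((isZero_iff M).1 hM _ _).trans ((isZero_iff M).1 hM _ _).symm⟩

theorem prod (hM : M.IsCofree d) (hN : N.IsCofree d) : (prod M N).IsCofree d where
  eq_zero h x hx := Prod.ext (hM.eq_zero h x.1 fun a => congrArg Prod.fst (hx a))
    (hN.eq_zero h x.2 fun a => congrArg Prod.snd (hx a))
  exists_act {i k} h f := by
    obtain ⟨x, hx⟩ := hM.exists_act h (Hom.appLinear (prodBicone M N).fst d ∘ₗ f)
    obtain ⟨y, hy⟩ := hN.exists_act h (Hom.appLinear (prodBicone M N).snd d ∘ₗ f)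
    exact ⟨(x, y), fun a => Prod.ext (hx a) (hy a)⟩

theorem toGrMod (hM : M.IsCofree d) {S : M.GrSubmodule} (hS : S.IsSaturated d) :
    S.toGrMod.IsCofree d where
  eq_zero h x hx := Subtype.ext (hM.eq_zero h x.1 fun a => congrArg Subtype.val (hx a))
  exists_act {i k} h g := by
    obtain ⟨x, hx⟩ := hM.exists_act h (Hom.appLinear S.subtype d ∘ₗ g)
    exact ⟨⟨x, hS h x fun a => hx a ▸ (g a).2⟩, fun a => Subtype.ext (hx a)⟩

-- Over a semisimple `Λ₀`, a linear map from a component of `Λ` lifts along the projection.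
theorem quotient (hM : M.IsCofree d) [IsSemisimpleRing (𝒜 0)ᵐᵒᵖ] {S : M.GrSubmodule}
    (hS : S.IsSaturated d) : S.quotient.IsCofree d where
  eq_zero {i k} h y hy := by
    obtain ⟨x, rfl⟩ := S.mkQ_surjective i y
    refine S.mkQ_eq_zero_iff.2 (hS h x fun a => S.mkQ_eq_zero_iff.1 ?_)
    rw [S.mkQ.app_act, hy]
  exists_act {i k} h g := by
    have := Module.projective_of_isSemisimpleRing (𝒜 0)ᵐᵒᵖ ((regular 𝒜).carrier k)
    obtain ⟨g', hg'⟩ :=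
      Module.projective_lifting_property (Hom.appLinear S.mkQ d) g (S.mkQ_surjective d)
    obtain ⟨x, hx⟩ := hM.exists_act h g'
    refine ⟨S.mkQ.app i x, fun a => ?_⟩
    rw [← S.mkQ.app_act, hx]
    exact LinearMap.congr_fun hg' a

theorem isSaturated_ker (hN : N.IsCofree d) (f : M ⟶ N) : (Hom.ker f).IsSaturated d :=
  fun h x hx => hN.eq_zero h _ fun a => by
    rw [← f.app_act]
    exact AddMonoidHom.mem_ker.1 (hx a)

theorem isSaturated_range (hM : M.IsCofree d) (hN : N.IsCofree d) [IsSemisimpleRing (𝒜 0)ᵐᵒᵖ]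
    (f : M ⟶ N) : (Hom.range f).IsSaturated d := by
  intro i k h y hy
  let F := Hom.appLinear f d
  have := Module.projective_of_isSemisimpleRing (𝒜 0)ᵐᵒᵖ ((regular 𝒜).carrier k)
  obtain ⟨g, hg⟩ := Module.projective_lifting_property F.rangeRestrict
    ((N.actLinear h y).codRestrict (LinearMap.range F) hy) F.surjective_rangeRestrict
  obtain ⟨x, hx⟩ := hM.exists_act h g
  refine ⟨x, hN.ext h fun a => ?_⟩
  rw [← f.app_act, hx]
  exact congrArg Subtype.val (LinearMap.congr_fun hg a)

end IsCofree

end GrMod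

/-! ### Almost injective modules cogenerated in one degree -/

namespace GrMod

section Dual

theorem one_mem_neg_of_eq_zero {t : ℤ} (h : t = 0) : (1 : Λ) ∈ 𝒜 (-t) := by
  subst h
  simpa using SetLike.GradedOne.one_mem

/-- The evaluation at `1` of the linear maps `Λ₀ → Λ₀` which form the component of `D(Λ)` of degree
`t = 0`. The degree is kept as a variable, as it is a sum when `D(Λ)` is shifted. -/
def dualEvalOne {t : ℤ} (h : t = 0) :
    (dual 𝒜).carrier t →ₗ[(𝒜 0)ᵐᵒᵖ] (regular 𝒜).carrier 0 where
  toFun f := f.1 ⟨1, one_mem_neg_of_eq_zero h⟩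
  map_add' _ _ := rfl
  map_smul' e f := by
    refine Subtype.ext (Eq.trans ?_ (f.2 ⟨1, one_mem_neg_of_eq_zero h⟩ e.unop))
    change ((f.1 _ : 𝒜 0) : Λ) = f.1 _
    congr 3
    exact (mul_one e.unop.1).trans (one_mul e.unop.1).symm

theorem coe_dual_apply {t : ℤ} (h : t = 0) (f : (dual 𝒜).carrier t) (x : 𝒜 (-t)) :
    (f.1 x : Λ) = (dualEvalOne h f).1 * x := by
  subst h
  refine Eq.trans ?_ (f.2 ⟨1, one_mem_neg_of_eq_zero rfl⟩ ⟨x, by simp⟩)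
  exact congrArg (fun x => (f.1 x : Λ)) (Subtype.ext (one_mul x.1).symm)

theorem dualEvalOne_act {i k t : ℤ} (h : i + k = t) (ht : t = 0) (f : (dual 𝒜).carrier i)
    (a : 𝒜 k) : dualEvalOne ht ((dual 𝒜).act h f a) =
      f.1 ⟨a, by simp [show -i = k by omega]⟩ := by
  change f.1 _ = f.1 _
  congr 2
  exact mul_one a.1

theorem isCofree_dual : (dual 𝒜).IsCofree 0 where
  eq_zero {i k} h f hf := by
    obtain rfl : k = -i := by omega
    refine Subtype.ext (AddMonoidHom.ext fun x => ?_)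
    rw [show f.1 x = _ from (dualEvalOne_act h rfl f x).symm, hf, map_zero]
    rfl
  exists_act {i k} h f := by
    obtain rfl : k = -i := by omega
    let g := dualEvalOne (𝒜 := 𝒜) rfl ∘ₗ f
    refine ⟨⟨AddMonoidHom.mk' g g.map_add, fun x e => ?_⟩, fun a => ?_⟩
    · exact congrArg Subtype.val (g.map_smul (MulOpposite.op e) x)
    · refine Subtype.ext (AddMonoidHom.ext fun x => Subtype.ext ?_)
      rw [coe_dual_apply rfl (f a)]
      exact congrArg Subtype.val (g.map_smul (MulOpposite.op ⟨x, by simp⟩) a)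

theorem IsCofree.shift {M : GrMod 𝒜} {d k : ℤ} (hM : M.IsCofree (d + k)) :
    (M.shift k).IsCofree d where
  eq_zero {i j} h x hx := hM.eq_zero (show i + k + j = d + k by omega) x hx
  exists_act {i j} h f := hM.exists_act (show i + k + j = d + k by omega) f

theorem isCofree_dual_shift {d k : ℤ} (h : d + k = 0) : ((dual 𝒜).shift k).IsCofree d :=
  IsCofree.shift (h ▸ isCofree_dual)

theorem dualEvalOne_surjective {t : ℤ} (h : t = 0) :
    Function.Surjective (dualEvalOne (𝒜 := 𝒜) h) := by
  subst h
  refine fun (a : 𝒜 0) =>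
    ⟨⟨AddMonoidHom.mk' (fun x => a * ⟨x, by simp⟩) fun x y => ?_, fun x e => ?_⟩, ?_⟩
  · exact mul_add a ⟨x, by simp⟩ ⟨y, by simp⟩
  · exact (mul_assoc a.1 x.1 e.1).symm
  · exact mul_one a

theorem IsCofree.exists_dual_shift_hom {M : GrMod 𝒜} {d k : ℤ} (h : d + k = 0)
    (hM : M.IsCofree d) (x : M.carrier d) : ∃ f : (dual 𝒜).shift k ⟶ M,
      ∀ y : ((dual 𝒜).shift k).carrier d,
        f.app d y = M.act (add_zero d) x (dualEvalOne (t := d + k) h y) :=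
  let ev : ((dual 𝒜).shift k).carrier d →ₗ[(𝒜 0)ᵐᵒᵖ] (regular 𝒜).carrier 0 :=
    dualEvalOne (t := d + k) h
  hM.exists_hom_app_eq (M.actLinear (add_zero d) x ∘ₗ ev)

theorem IsCofree.exists_dual_shift_hom_app_eq {M : GrMod 𝒜} {d k : ℤ} (h : d + k = 0)
    (hM : M.IsCofree d) (x : M.carrier d) :
    ∃ (f : (dual 𝒜).shift k ⟶ M) (y : ((dual 𝒜).shift k).carrier d), f.app d y = x := by
  obtain ⟨f, hf⟩ := hM.exists_dual_shift_hom h x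
  obtain ⟨y, hy⟩ := dualEvalOne_surjective (𝒜 := 𝒜) h ⟨1, SetLike.GradedOne.one_mem⟩
  exact ⟨f, y, (hf y).trans (hy ▸ M.act_one x)⟩

theorem dual_eq_zero_of_mem_socle {i : ℤ} (hi : i ≠ 0)
    (hneg : ∀ {k : ℤ}, k < 0 → ∀ x : 𝒜 k, x = 0) {f : (dual 𝒜).carrier i}
    (hf : f ∈ (dual 𝒜).socle i) : f = 0 := by
  rcases lt_or_gt_of_ne hi with hi | hi
  · exact isCofree_dual.eq_zero (add_neg_cancel i) f fun a => hf _ _ _ a (by omega)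
  · refine Subtype.ext (AddMonoidHom.ext fun x => ?_)
    rw [hneg (show -i < 0 by omega) x, map_zero, map_zero]

end Dual

section DirectSum

variable {ι : Type u} {F : ι → GrMod 𝒜}

variable (F) in
/-- The projection of a direct sum to a summand. -/
def directSumProj (s : ι) : directSum F ⟶ F s where
  app _ := DFinsupp.evalAddMonoidHom s
  app_act _ _ _ := rfl

open Classical in
/-- The morphism from a direct sum induced by a family of morphisms. -/
def directSumDesc {M : GrMod 𝒜} (f : ∀ s, F s ⟶ M) : directSum F ⟶ M where
  app i := DirectSum.toAddMonoid fun s => (f s).app i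
  app_act {i j k} h x a := by
    have : (DirectSum.toAddMonoid fun s => (f s).app k).comp
        (DirectSum.map fun s => (F s).actHom h a) =
        (M.actHom h a).comp (DirectSum.toAddMonoid fun s => (f s).app i) := by
      refine DirectSum.addHom_ext fun s x => ?_
      simp [DirectSum.map_of, (f s).app_act]
    exact DFunLike.congr_fun this x

theorem exists_directSumDesc_app_eq {M : GrMod 𝒜} (f : ∀ s, F s ⟶ M) (s : ι) {i : ℤ}
    (x : (F s).carrier i) : ∃ y, (directSumDesc f).app i y = (f s).app i x := by
  classical
  exact ⟨DirectSum.of (fun s => (F s).carrier i) s x, DirectSum.toAddMonoid_of _ _ _⟩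

theorem exists_finset_directSumProj_eq_zero {P : Type*} [AddCommGroup P] [Module (𝒜 0)ᵐᵒᵖ P]
    [Module.Finite (𝒜 0)ᵐᵒᵖ P] {d : ℤ} (g : P →ₗ[(𝒜 0)ᵐᵒᵖ] (directSum F).carrier d) :
    ∃ s : Finset ι, ∀ t ∉ s, ∀ a, (directSumProj F t).app d (g a) = 0 := by
  classical
  obtain ⟨S, hS⟩ := Module.Finite.fg_top (R := (𝒜 0)ᵐᵒᵖ) (M := P)
  refine ⟨S.biUnion fun a => DFinsupp.support (g a), fun t ht a => ?_⟩
  have h : Hom.appLinear (directSumProj F t) d ∘ₗ g = 0 := LinearMap.ext_on hS fun b hb =>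
    DFinsupp.notMem_support_iff.1 fun hb' => ht (Finset.mem_biUnion.2 ⟨b, hb, hb'⟩)
  exact LinearMap.congr_fun h a

variable [∀ k, Module.Finite (𝒜 0)ᵐᵒᵖ ((regular 𝒜).carrier k)]

theorem exists_act_directSum {i k d : ℤ} (h : i + k = d)
    (g : (regular 𝒜).carrier k →ₗ[(𝒜 0)ᵐᵒᵖ] (directSum F).carrier d)
    (hg : ∀ s, ∃ y : (F s).carrier i, ∀ a : 𝒜 k,
      (F s).act h y a = (directSumProj F s).app d (g a)) :
    ∃ y, ∀ a : 𝒜 k, (directSum F).act h y a = g a := by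
  classical
  obtain ⟨S, hS⟩ := exists_finset_directSumProj_eq_zero g
  choose y hy using hg
  let z : Π₀ s, (F s).carrier i := DFinsupp.mk S fun t => y t
  refine ⟨z, fun a => DFinsupp.ext fun t => ?_⟩
  change (F t).act h (z t) a = (directSumProj F t).app d (g a)
  by_cases ht : t ∈ S
  · rw [show z t = y t from dif_pos ht, hy]
  · rw [show z t = 0 from dif_neg ht, zero_act]
    exact (hS t ht a).symm

theorem IsCofree.directSum {d : ℤ} (hF : ∀ s, (F s).IsCofree d) : (directSum F).IsCofree d where
  eq_zero {i k} h x hx := DFinsupp.ext fun s => (hF s).eq_zero h _ fun a => by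
    change (F s).act h ((directSumProj F s).app i x) a = 0
    rw [← Hom.app_act, hx, map_zero]
  exists_act h g := exists_act_directSum h g fun s =>
    (hF s).exists_act h (Hom.appLinear (directSumProj F s) _ ∘ₗ g)

theorem IsCofree.isAlmostInjective [IsSemisimpleRing (𝒜 0)ᵐᵒᵖ] {M : GrMod 𝒜} {d : ℤ}
    (hM : M.IsCofree d) : M.IsAlmostInjective := by
  have hd : d + -d = 0 := add_neg_cancel d
  choose f y hfy using hM.exists_dual_shift_hom_app_eq hd
  let r := directSumDesc f
  have r_surjective : Function.Surjective (Hom.appLinear r d) := fun x =>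
    (exists_directSumDesc_app_eq f x (y x)).imp fun _ hz => hz.trans (hfy x)
  have := Module.projective_of_isSemisimpleRing (𝒜 0)ᵐᵒᵖ (M.carrier d)
  obtain ⟨φ, hφ⟩ :=
    Module.projective_lifting_property (Hom.appLinear r d) LinearMap.id r_surjective
  obtain ⟨i, hi⟩ := (IsCofree.directSum fun _ : M.carrier d =>
    isCofree_dual_shift (𝒜 := 𝒜) hd).exists_hom_app_eq φ
  refine ⟨M.carrier d, fun _ => -d, ⟨⟨i, r, hM.hom_ext fun x => ?_⟩⟩⟩
  rw [comp_app, hi]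
  exact LinearMap.congr_fun hφ x

end DirectSum

theorem IsCofree.isCogeneratedInDegree {M : GrMod 𝒜} {d : ℤ} (hM : M.IsCofree d) :
    M.IsCogeneratedInDegree d := by
  rintro N hN ⟨i, hi⟩ hd
  refine hi ((AddSubgroup.eq_bot_iff_forall _).2 fun x hx => ?_)
  refine hM.eq_zero (add_sub_cancel i d) x fun a => ?_
  exact (AddSubgroup.eq_bot_iff_forall _).1 hd _ (hN _ x a hx)

theorem IsCogeneratedInDegree.eq_zero {M : GrMod 𝒜} {d : ℤ} (hM : M.IsCogeneratedInDegree d)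
    {i k : ℤ} (h : i + k = d) (x : M.carrier i) (hx : ∀ a : 𝒜 k, M.act h x a = 0) : x = 0 := by
  by_contra hne
  let xΛ (l : ℤ) : AddSubgroup (M.carrier l) :=
    (M.actLinear (add_sub_cancel i l) x).toAddMonoidHom.range
  have h_xΛ : M.IsGrSubmodule xΛ := by
    rintro j k l h _ a ⟨b, rfl⟩
    refine ⟨⟨b.1 * a.1, ?_⟩, (M.act_act _ h (show j - i + k = l - i by omega) _ x b a).symm⟩
    have := SetLike.GradedMul.mul_mem b.2 a.2
    rwa [show j - i + k = l - i by omega] at this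
  have x_mem : x ∈ xΛ i := by
    have act_one_of_eq_zero : ∀ (j : ℤ) (_ : j = 0) (e : i + j = i),
        ∃ b : 𝒜 j, M.act e x b = x := by
      rintro _ rfl e
      exact ⟨_, M.act_one x⟩
    exact act_one_of_eq_zero _ (sub_self i) _
  refine hM xΛ h_xΛ ⟨i, fun hi => hne ((AddSubgroup.eq_bot_iff_forall _).1 hi x x_mem)⟩ ?_
  rw [AddSubgroup.eq_bot_iff_forall]
  rintro _ ⟨a, rfl⟩
  obtain rfl : k = d - i := by omega
  exact hx a

-- Elements of degree `d` of `M` are killed by elements of positive degree, and so are their images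
-- in the shifts of `D(Λ)`. Hence only the shifts which are cofree in degree `d` matter.
theorem IsAlmostInjective.isCofree [∀ k, Module.Finite (𝒜 0)ᵐᵒᵖ ((regular 𝒜).carrier k)]
    (hneg : ∀ {k : ℤ}, k < 0 → ∀ x : 𝒜 k, x = 0) {M : GrMod 𝒜} {d : ℤ}
    (hM : M.IsAlmostInjective) (hM' : M.IsCogeneratedInDegree d) : M.IsCofree d where
  eq_zero := hM'.eq_zero
  exists_act {i k} h f := by
    obtain ⟨ι, t, ⟨R⟩⟩ := hM
    have eq_zero_of_lt {l : ℤ} (hl : d < l) (x : M.carrier l) : x = 0 :=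
      hM'.eq_zero (add_sub_cancel l d) x fun a => by rw [hneg (by omega) a, act_zero]
    obtain ⟨y, hy⟩ := exists_act_directSum h (Hom.appLinear R.i d ∘ₗ f) fun s => by
      by_cases hs : d + t s = 0
      · exact (isCofree_dual_shift hs).exists_act h
          (Hom.appLinear (directSumProj _ s) d ∘ₗ Hom.appLinear R.i d ∘ₗ f)
      · refine ⟨0, fun a => ?_⟩
        rw [zero_act]
        refine (dual_eq_zero_of_mem_socle hs hneg fun j k hk b hj => ?_).symm
        obtain ⟨l, rfl⟩ : ∃ l, k = l + t s := ⟨k - t s, by omega⟩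
        have hk' : d + j = l := by omega
        change ((dual 𝒜).shift (t s)).act hk' ((directSumProj _ s).app d (R.i.app d (f a))) b = 0
        rw [← Hom.app_act, ← R.i.app_act, eq_zero_of_lt (by omega) (M.act hk' (f a) b), map_zero,
          map_zero]
    refine ⟨R.r.app i y, fun a => ?_⟩
    rw [← R.r.app_act, hy]
    exact Hom.congr_app R.retract d (f a)

end GrMod

namespace IsGradedFactor

open GrMod

theorem finite_path {V : Type v₁} [Quiver.{v₂} V] [Finite V] [∀ a b : V, Finite (a ⟶ b)] (n : ℕ)
    (a b : V) : Finite {p : Quiver.Path a b // p.length = n} := by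
  induction n generalizing b with
  | zero =>
    refine @Finite.of_subsingleton _ ⟨fun ⟨p, hp⟩ ⟨q, hq⟩ => Subtype.ext ?_⟩
    obtain rfl : a = b := p.eq_of_length_zero hp
    exact (p.eq_nil_of_length_zero hp).trans (q.eq_nil_of_length_zero hq).symm
  | succ n ih =>
    refine Finite.of_surjective (α := Σ c, {p : Quiver.Path a c // p.length = n} × (c ⟶ b))
      (fun x => ⟨x.2.1.1.cons x.2.2, by simp [x.2.1.2]⟩) ?_
    rintro ⟨_ | ⟨p, α⟩, hp⟩
    · simp at hp
    · exact ⟨⟨_, ⟨p, by simpa using hp⟩, α⟩, rfl⟩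

variable {V : Type v₁} [Quiver.{v₂} V] [Fintype V] {π : PathAlgebra K V →ₐ[K] Λ}
variable [∀ a b : V, Finite (a ⟶ b)]

theorem finite_regular (hπ : IsGradedFactor 𝒜 π) (k : ℤ) :
    Module.Finite (𝒜 0)ᵐᵒᵖ ((regular 𝒜).carrier k) := by
  have (a b : V) : Finite {p : Quiver.Path a b // (p.length : ℤ) = k} :=
    have := finite_path k.toNat a b
    Finite.of_injective (β := {p : Quiver.Path a b // p.length = k.toNat})
      (Subtype.map id fun p hp => by dsimp only [id]; omega)
      (Subtype.map_injective _ Function.injective_id)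
  let paths : (Σ (a : V) (b : V), {p : Quiver.Path a b // (p.length : ℤ) = k}) →
      (regular 𝒜).carrier k := fun p => hπ.path p.2.2.1 p.2.2.2
  refine ⟨Submodule.fg_def.2 ⟨Set.range paths, Set.finite_range _, eq_top_iff.2 fun x _ => ?_⟩⟩
  refine hπ.path_induction (motive := fun x => x ∈ Submodule.span (𝒜 0)ᵐᵒᵖ (Set.range paths)) x
    (fun a b p hp => Submodule.subset_span ⟨⟨a, b, p, hp⟩, rfl⟩) (zero_mem _)
    (fun x y hx hy => add_mem hx hy) fun c x hx => ?_
  rw [← op_algebraMap_smul]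
  exact Submodule.smul_mem _ _ hx

theorem isAlmostInjective_and_isCogeneratedInDegree_iff (hπ : IsGradedFactor 𝒜 π) {M : GrMod 𝒜}
    {d : ℤ} : M.IsAlmostInjective ∧ M.IsCogeneratedInDegree d ↔ M.IsCofree d :=
  have := hπ.finite_regular
  have := hπ.isSemisimpleRing
  ⟨fun h => h.1.isCofree hπ.eq_zero_of_neg h.2, fun h =>
    ⟨h.isAlmostInjective, h.isCogeneratedInDegree⟩⟩

end IsGradedFactor

/-! ### The category of linear `n`-complexes -/

namespace IsGradedFactor

variable {V : Type v₁} [Quiver.{v₂} V] [Fintype V] {π : PathAlgebra K V →ₐ[K] Λ}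
variable [∀ a b : V, Finite (a ⟶ b)]

open Limits GrMod ZeroObject

theorem isLinearNComplex_iff (hπ : IsGradedFactor 𝒜 π) {n : ℕ} {I : ℤ ⥤ GrMod 𝒜} :
    isLinearNComplex 𝒜 n I ↔ (∀ k : ℤ, I.map (homOfLE (show k ≤ k + n by omega)) = 0) ∧
      ∀ k : ℤ, (I.obj k).IsCofree (-k) := by
  simp only [isLinearNComplex, hπ.isAlmostInjective_and_isCogeneratedInDegree_iff]

theorem isClosedUnderIsomorphisms_isLinearNComplex (hπ : IsGradedFactor 𝒜 π) (n : ℕ) :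
    (isLinearNComplex 𝒜 n).IsClosedUnderIsomorphisms where
  of_iso {I J} e hI := by
    rw [hπ.isLinearNComplex_iff] at hI ⊢
    refine ⟨fun k => ?_, fun k => (hI.2 k).of_iso (e.app k)⟩
    rw [← cancel_epi (e.hom.app k), ← e.hom.naturality, hI.1, zero_comp, comp_zero]

theorem containsZero_isLinearNComplex (hπ : IsGradedFactor 𝒜 π) (n : ℕ) :
    (isLinearNComplex 𝒜 n).ContainsZero where
  exists_zero := by
    have h : IsZero (0 : ℤ ⥤ GrMod 𝒜) := isZero_zero _
    exact ⟨0, h, hπ.isLinearNComplex_iff.2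
      ⟨fun k => (h.obj k).eq_of_src _ _, fun k => IsCofree.of_isZero (h.obj k)⟩⟩

theorem isLinearNComplex_of_mono (hπ : IsGradedFactor 𝒜 π) {n : ℕ} {I J : ℤ ⥤ GrMod 𝒜} (f : I ⟶ J)
    [Mono f] (hJ : isLinearNComplex 𝒜 n J) (hI : ∀ k, (I.obj k).IsCofree (-k)) :
    isLinearNComplex 𝒜 n I := by
  refine hπ.isLinearNComplex_iff.2 ⟨fun k => ?_, hI⟩
  rw [← cancel_mono (f.app (k + n)), f.naturality, hJ.1, zero_comp, comp_zero]

theorem isLinearNComplex_of_epi (hπ : IsGradedFactor 𝒜 π) {n : ℕ} {I J : ℤ ⥤ GrMod 𝒜} (f : I ⟶ J)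
    [Epi f] (hI : isLinearNComplex 𝒜 n I) (hJ : ∀ k, (J.obj k).IsCofree (-k)) :
    isLinearNComplex 𝒜 n J := by
  refine hπ.isLinearNComplex_iff.2 ⟨fun k => ?_, hJ⟩
  rw [← cancel_epi (f.app k), ← f.naturality, hI.1, zero_comp, comp_zero]

theorem isClosedUnderKernels_isLinearNComplex (hπ : IsGradedFactor 𝒜 π) (n : ℕ) :
    (isLinearNComplex 𝒜 n).IsClosedUnderKernels where
  kernels_le := by
    rintro _ ⟨f, k, hk, hf⟩
    have isCofree_left (j : ℤ) := (hπ.isLinearNComplex_iff.1 hf.1).2 j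
    have isCofree_right (j : ℤ) := (hπ.isLinearNComplex_iff.1 hf.2).2 j
    have : Mono k.ι := Fork.IsLimit.mono hk
    refine hπ.isLinearNComplex_of_mono k.ι hf.1 fun j => ?_
    have h := KernelFork.mapIsLimit k hk ((evaluation ℤ (GrMod 𝒜)).obj j)
    have h' := isLimitKernelFork (exact_subtype_ker (f.app j)) (GrSubmodule.subtype_injective _)
    exact ((isCofree_left j).toGrMod ((isCofree_right j).isSaturated_ker (f.app j))).of_iso
      (h'.conePointUniqueUpToIso h)

theorem isClosedUnderCokernels_isLinearNComplex (hπ : IsGradedFactor 𝒜 π) (n : ℕ) :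
    (isLinearNComplex 𝒜 n).IsClosedUnderCokernels where
  cokernels_le := by
    rintro _ ⟨f, k, hk, hf⟩
    have := hπ.isSemisimpleRing
    have isCofree_left (j : ℤ) := (hπ.isLinearNComplex_iff.1 hf.1).2 j
    have isCofree_right (j : ℤ) := (hπ.isLinearNComplex_iff.1 hf.2).2 j
    have : Epi k.π := Cofork.IsColimit.epi hk
    refine hπ.isLinearNComplex_of_epi k.π hf.2 fun j => ?_
    have h := CokernelCofork.mapIsColimit k hk ((evaluation ℤ (GrMod 𝒜)).obj j)
    have h' := isColimitCokernelCofork (exact_mkQ_range (f.app j)) (GrSubmodule.mkQ_surjective _)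
    exact ((isCofree_right j).quotient
      ((isCofree_left j).isSaturated_range (isCofree_right j) (f.app j))).of_iso
        (h'.coconePointUniqueUpToIso h)

theorem isClosedUnderFiniteProducts_isLinearNComplex (hπ : IsGradedFactor 𝒜 π) (n : ℕ) :
    (isLinearNComplex 𝒜 n).IsClosedUnderFiniteProducts := by
  have := hπ.isClosedUnderIsomorphisms_isLinearNComplex n
  have := hπ.containsZero_isLinearNComplex n
  have : (isLinearNComplex 𝒜 n).IsClosedUnderBinaryProducts := ⟨by
    rintro X ⟨p, hp⟩
    simp only [hπ.isLinearNComplex_iff] at hp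
    have h := fun j => isLimitOfPreserves ((evaluation ℤ (GrMod 𝒜)).obj j) p.isLimit
    rw [hπ.isLinearNComplex_iff]
    refine ⟨fun j => (h (j + n)).hom_ext fun s => ?_, fun j => ?_⟩
    · rw [zero_comp]
      refine ((p.cone.π.app s).naturality _).trans ?_
      change _ ≫ (p.diag.obj s).map _ = 0
      rw [(hp s).1, comp_zero]
    · let A := (p.diag.obj ⟨WalkingPair.left⟩).obj j
      let B := (p.diag.obj ⟨WalkingPair.right⟩).obj j
      have h' : IsLimit (BinaryFan.mk (prodBicone A B).fst (prodBicone A B).snd) :=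
        (isBinaryBilimitOfTotal (prodBicone A B) (by
          ext i x
          exact Prod.ext (add_zero x.1) (zero_add x.2))).isLimit
      exact ((hp _).2 j |>.prod ((hp _).2 j)).of_iso
        (h'.conePointsIsoOfNatIso (h j) (diagramIsoPair (p.diag ⋙ (evaluation _ _).obj j)).symm)⟩
  exact ObjectProperty.IsClosedUnderFiniteProducts.mk'

/-- The abelian structure on the category of linear `n`-complexes. It is not an instance, as it
depends on the presentation `π`. -/
@[reducible]
def abelian (hπ : IsGradedFactor 𝒜 π) (n : ℕ) : Abelian (LinearNComplex 𝒜 n) :=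
  have := hπ.containsZero_isLinearNComplex n
  have := hπ.isClosedUnderKernels_isLinearNComplex n
  have := hπ.isClosedUnderCokernels_isLinearNComplex n
  have := hπ.isClosedUnderFiniteProducts_isLinearNComplex n
  inferInstance

theorem isAbelianCategory (hπ : IsGradedFactor 𝒜 π) (n : ℕ) :
    IsAbelianCategory (LinearNComplex 𝒜 n) :=
  let _ := hπ.abelian n
  ⟨inferInstance, inferInstance, inferInstance, inferInstance, inferInstance⟩

instance {n : ℕ} (hn : 2 ≤ n) (m : ℤ) : (contraction 𝒜 hn m).Additive where
  map_add := by
    intros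
    ext
    rfl

theorem preservesFiniteLimits_contraction (hπ : IsGradedFactor 𝒜 π) {n : ℕ} (hn : 2 ≤ n) (m : ℤ) :
    PreservesFiniteLimits (contraction 𝒜 hn m) where
  preservesFiniteLimits J _ _ := by
    let _ := hπ.abelian n
    have := hπ.isClosedUnderKernels_isLinearNComplex n
    have := (isLinearNComplex 𝒜 n).preservesKernels_ι
    have : PreservesFiniteLimits (isLinearNComplex 𝒜 n).ι :=
      Functor.preservesFiniteLimits_of_preservesKernels _
    refine HomologicalComplex.preservesLimitsOfShape_of_eval _ fun k => ?_
    change PreservesLimitsOfShape J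
      ((isLinearNComplex 𝒜 n).ι ⋙ (evaluation ℤ (GrMod 𝒜)).obj (contractionIndex n m k))
    infer_instance

theorem preservesFiniteColimits_contraction (hπ : IsGradedFactor 𝒜 π) {n : ℕ} (hn : 2 ≤ n)
    (m : ℤ) : PreservesFiniteColimits (contraction 𝒜 hn m) where
  preservesFiniteColimits J _ _ := by
    let _ := hπ.abelian n
    have := hπ.isClosedUnderCokernels_isLinearNComplex n
    have := (isLinearNComplex 𝒜 n).preservesCokernels_ι
    have : PreservesFiniteColimits (isLinearNComplex 𝒜 n).ι :=
      Functor.preservesFiniteColimits_of_preservesCokernels _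
    refine HomologicalComplex.preservesColimitsOfShape_of_eval _ fun k => ?_
    change PreservesColimitsOfShape J
      ((isLinearNComplex 𝒜 n).ι ⋙ (evaluation ℤ (GrMod 𝒜)).obj (contractionIndex n m k))
    infer_instance

end IsGradedFactor

/-! ### The quotient category -/

section Quotient

open Limits ObjectProperty

theorem isoModulo_eq_isoModSerre {C : Type*} [Category* C] [Abelian C] (P : ObjectProperty C)
    [P.IsSerreClass] : isoModulo P = P.isoModSerre := by
  ext X Y f
  refine ⟨?_, fun h => ⟨⟨_, ⟨kernelIsKernel f⟩, h.1⟩, ⟨_, ⟨cokernelIsCokernel f⟩, h.2⟩⟩⟩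
  rintro ⟨⟨c, ⟨hc⟩, h⟩, ⟨c', ⟨hc'⟩, h'⟩⟩
  exact ⟨P.prop_of_iso (hc.conePointUniqueUpToIso (limit.isLimit _)) h,
    P.prop_of_iso (hc'.coconePointUniqueUpToIso (colimit.isColimit _)) h'⟩

section ExactFunctor

variable {C D : Type*} [Category* C] [Abelian C] [Category* D] [Abelian D] (F : C ⥤ D)
  [PreservesFiniteLimits F] [PreservesFiniteColimits F]

theorem isInvertedBy_isoModulo_kernel :
    (isoModulo (inverseImage (IsZero (C := D)) F)).IsInvertedBy F := by
  rw [isoModulo_eq_isoModSerre, isoModSerre_isInvertedBy_iff]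

theorem faithful_of_isoModSerre_Q_comp_eq (P : ObjectProperty C) [P.IsSerreClass]
    (hP : ∀ X, IsZero (F.obj X) → P X) (G : P.isoModSerre.Localization ⥤ D)
    (hG : P.isoModSerre.Q ⋙ G = F) : G.Faithful := by
  subst hG
  refine Functor.faithful_of_comp_of_hasLeftCalculusOfFractions P.isoModSerre.Q P.isoModSerre G
    fun X Y f g hfg => ?_
  let F := P.isoModSerre.Q ⋙ G
  have : F.Additive := Functor.additive_of_preserves_binary_products F
  rw [← sub_eq_zero, ← Functor.map_sub, SerreClassLocalization.map_eq_zero_iff _ P]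
  have map_sub_eq_zero : F.map (f - g) = 0 := by
    rw [F.map_sub, sub_eq_zero]
    exact hfg
  have : F.map (Abelian.factorThruImage (f - g)) = 0 := by
    rw [← cancel_mono (F.map (Abelian.image.ι (f - g))), ← F.map_comp, zero_comp,
      Abelian.image.fac, map_sub_eq_zero]
  exact hP _ (IsZero.of_epi_eq_zero _ this)

theorem faithful_lift_isoModulo_kernel :
    (Localization.Construction.lift F (isInvertedBy_isoModulo_kernel F)).Faithful := by
  have fac := Localization.Construction.fac F (isInvertedBy_isoModulo_kernel F)
  have h := isoModulo_eq_isoModSerre (inverseImage (IsZero (C := D)) F)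
  generalize_proofs hF at fac ⊢
  generalize isoModulo (inverseImage (IsZero (C := D)) F) = W at h hF fac ⊢
  subst h
  exact faithful_of_isoModSerre_Q_comp_eq F (inverseImage (IsZero (C := D)) F)
    (fun _ hX => hX) _ fac

end ExactFunctor

theorem contractionIndex_mem_supportSet (n : ℕ) (m k : ℤ) :
    contractionIndex n m k ∈ supportSet n m := by
  obtain ⟨l, rfl | rfl⟩ := Int.even_or_odd' k
  · exact ⟨l, Or.inl (contractionIndex_even n m l)⟩
  · exact ⟨l, Or.inr (contractionIndex_odd n m l)⟩

theorem exists_contractionIndex_eq {n : ℕ} {m j : ℤ} (hj : j ∈ supportSet n m) :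
    ∃ k, contractionIndex n m k = j := by
  obtain ⟨l, rfl | rfl⟩ := hj
  · exact ⟨_, contractionIndex_even n m l⟩
  · exact ⟨_, contractionIndex_odd n m l⟩

theorem isZero_contraction_iff {n : ℕ} (hn : 2 ≤ n) (m : ℤ) (I : LinearNComplex 𝒜 n) :
    IsZero ((contraction 𝒜 hn m).obj I) ↔ torsionClass 𝒜 n m I := by
  refine ⟨fun h j hj => ?_, fun h => ?_⟩
  · obtain ⟨k, rfl⟩ := exists_contractionIndex_eq hj
    exact (HomologicalComplex.eval (GrMod 𝒜) _ k).map_isZero h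
  · rw [IsZero.iff_id_eq_zero]
    ext k : 1
    exact (h _ (contractionIndex_mem_supportSet n m k)).eq_of_src _ _

theorem inverseImage_contraction_isZero {n : ℕ} (hn : 2 ≤ n) (m : ℤ) :
    inverseImage (IsZero (C := CochainComplex (GrMod 𝒜) ℤ)) (contraction 𝒜 hn m) =
      torsionClass 𝒜 n m :=
  funext fun I => propext (isZero_contraction_iff hn m I)

theorem IsGradedFactor.exists_faithful_lift_contraction {V : Type v₁} [Quiver.{v₂} V] [Fintype V]
    [∀ a b : V, Finite (a ⟶ b)] {π : PathAlgebra K V →ₐ[K] Λ} (hπ : IsGradedFactor 𝒜 π) {n : ℕ}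
    (hn : 2 ≤ n) (m : ℤ) :
    ∃ hH : (isoModulo (torsionClass 𝒜 n m)).IsInvertedBy (contraction 𝒜 hn m),
      (Localization.Construction.lift (contraction 𝒜 hn m) hH).Faithful := by
  let _ := hπ.abelian n
  have := hπ.preservesFiniteLimits_contraction hn m
  have := hπ.preservesFiniteColimits_contraction hn m
  rw [← inverseImage_contraction_isZero hn m]
  exact ⟨_, faithful_lift_isoModulo_kernel (contraction 𝒜 hn m)⟩

end Quotient

/-! ### Dual elements -/

namespace PathAlgebra

variable {V : Type v₁} [Quiver.{v₂} V]

open Classical in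
theorem coeff_ofPath {c e : V} (q : Quiver.Path c e) {a b : V} (p : Quiver.Path a b) :
    (ofPath q : PathAlgebra K V).coeff a b p =
      if (⟨c, e, q⟩ : Σ c e : V, Quiver.Path c e) = ⟨a, b, p⟩ then 1 else 0 := by
  by_cases hce : a = c ∧ b = e
  · obtain ⟨rfl, rfl⟩ := hce
    simp [coeff_ofPath_self, Finsupp.single_apply]
  · rw [coeff_ofPath_of_ne q hce, Finsupp.zero_apply, if_neg]
    rintro ⟨⟩
    exact hce ⟨rfl, rfl⟩

theorem sigma_cons_inj {a b c d e f : V} {p : Quiver.Path a b} {α : b ⟶ c} {q : Quiver.Path d e}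
    {β : e ⟶ f} :
    (⟨d, f, q.cons β⟩ : Σ a b : V, Quiver.Path a b) = ⟨a, c, p.cons α⟩ ↔
      (⟨d, e, q⟩ : Σ a b : V, Quiver.Path a b) = ⟨a, b, p⟩ ∧
        (⟨e, f, β⟩ : Quiver.Total V) = ⟨b, c, α⟩ := by
  refine ⟨fun h => ?_, fun ⟨h₁, h₂⟩ => ?_⟩
  · cases h
    exact ⟨rfl, rfl⟩
  · cases h₁
    cases h₂
    rfl

theorem sigma_toPath_inj {s t : Quiver.Total V} :
    (⟨t.left, t.right, t.hom.toPath⟩ : Σ c e : V, Quiver.Path c e) =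
      ⟨s.left, s.right, s.hom.toPath⟩ ↔ t = s :=
  ⟨fun h => (sigma_cons_inj.1 h).2, fun h => h ▸ rfl⟩

theorem finite_total [Finite V] [∀ a b : V, Finite (a ⟶ b)] : Finite (Quiver.Total V) :=
  Finite.of_surjective (fun s : Σ a b : V, a ⟶ b => ⟨s.1, s.2.1, s.2.2⟩)
    fun t => ⟨⟨t.left, t.right, t.hom⟩, rfl⟩

end PathAlgebra

namespace IsGradedFactor

variable {V : Type v₁} [Quiver.{v₂} V] [Fintype V] {π : PathAlgebra K V →ₐ[K] Λ}

open PathAlgebra GrMod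

theorem vertexHom_mul_vertex (hπ : IsGradedFactor 𝒜 π) (c : V → K) (b : V) :
    hπ.vertexHom c * hπ.vertex b = c b • hπ.vertex b := by
  classical
  rw [← vertexHom_single, ← one_smul K (hπ.vertex b), ← vertexHom_single, ← map_mul,
    ← Pi.single_mul_right, mul_one]

theorem smul_vertex_mul_vertexHom (hπ : IsGradedFactor 𝒜 π) (r : K) (c : V → K) (b : V) :
    (r • hπ.vertex b) * hπ.vertexHom c = (r * c b) • hπ.vertex b := by
  classical
  rw [← vertexHom_single, ← map_mul, ← Pi.single_mul_left, vertexHom_single]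

theorem vertex_mul_vertexHom (hπ : IsGradedFactor 𝒜 π) (c : V → K) (b : V) :
    hπ.vertex b * hπ.vertexHom c = c b • hπ.vertex b := by
  simpa only [one_smul, one_mul] using hπ.smul_vertex_mul_vertexHom 1 c b

omit [GradedAlgebra 𝒜] in
theorem vertex_mul_path (hπ : IsGradedFactor 𝒜 π) {a b : V} (p : Quiver.Path a b) {k : ℤ}
    (hp : (p.length : ℤ) = k) : (hπ.vertex a * hπ.path p hp : Λ) = hπ.path p hp := by
  rw [vertex, path_mul_path hπ _ _ _ _ (by simpa using hp)]
  simp [path]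

omit [GradedAlgebra 𝒜] in
theorem path_mul_vertex (hπ : IsGradedFactor 𝒜 π) {a b : V} (p : Quiver.Path a b) {k : ℤ}
    (hp : (p.length : ℤ) = k) : (hπ.path p hp * hπ.vertex b : Λ) = hπ.path p hp := by
  rw [vertex, path_mul_path hπ _ _ _ _ (by simpa using hp)]
  simp [path]

theorem path_mul_vertexHom (hπ : IsGradedFactor 𝒜 π) {a b : V} (p : Quiver.Path a b) {k : ℤ}
    (hp : (p.length : ℤ) = k) (c : V → K) :
    (hπ.path p hp * hπ.vertexHom c : Λ) = c b • (hπ.path p hp : Λ) := by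
  rw [← path_mul_vertex, mul_assoc, ← SetLike.GradeZero.coe_mul, vertex_mul_vertexHom,
    Submodule.coe_smul, mul_smul_comm]

section PathCoeff

variable (hπ : IsGradedFactor 𝒜 π) {k : ℕ}
  (hinj : ∀ x ∈ degreePart K V k, π x = 0 → x = 0)

/-- The identification of the components of degree `k` of the path algebra and of `Λ`, when `Λ` has
no relations of degree `k`. -/
def degreePartEquiv : degreePart K V k ≃ₗ[K] 𝒜 k :=
  LinearEquiv.ofBijective (π.toLinearMap.restrict (hπ.map_mem k))
    ⟨(injective_iff_map_eq_zero _).2 fun x hx =>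
      Subtype.ext (hinj x x.2 (congrArg Subtype.val hx)), fun y =>
        let ⟨f, hf, hfy⟩ := hπ.exists_mem_degreePart y
        ⟨⟨f, hf⟩, Subtype.ext hfy⟩⟩

/-- The coefficient of a path in an element of a component of `Λ` without relations. -/
def pathCoeff {a b : V} (p : Quiver.Path a b) : 𝒜 k →ₗ[K] K :=
  coeffₗ p ∘ₗ (degreePart K V k).subtype ∘ₗ (hπ.degreePartEquiv hinj).symm

open Classical in
theorem pathCoeff_path {a b c e : V} (p : Quiver.Path a b) (q : Quiver.Path c e)
    (hq : (q.length : ℤ) = k) : hπ.pathCoeff hinj p (hπ.path q hq) =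
      if (⟨c, e, q⟩ : Σ c e : V, Quiver.Path c e) = ⟨a, b, p⟩ then 1 else 0 := by
  have symm_path : (hπ.degreePartEquiv hinj).symm (hπ.path q hq) =
      ⟨ofPath q, Nat.cast_inj.1 hq ▸ ofPath_mem_degreePart q⟩ :=
    (LinearEquiv.symm_apply_eq _).2 rfl
  rw [pathCoeff, LinearMap.comp_apply, LinearMap.comp_apply, LinearEquiv.coe_coe, symm_path]
  exact coeff_ofPath q p

theorem pathCoeff_mul_vertexHom {a b : V} (p : Quiver.Path a b) (c : V → K) (x : 𝒜 k) :
    hπ.pathCoeff hinj p ⟨x * hπ.vertexHom c, by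
      simpa using SetLike.GradedMul.mul_mem x.2 (hπ.vertexHom c).2⟩ =
      c b * hπ.pathCoeff hinj p x := by
  induction x using hπ.path_induction with
  | path a' b' q hq =>
    refine (congrArg (hπ.pathCoeff hinj p) (Subtype.ext (hπ.path_mul_vertexHom q hq c) :
      _ = c b' • hπ.path q hq)).trans ?_
    rw [map_smul, pathCoeff_path, smul_eq_mul]
    split_ifs with h
    · obtain ⟨⟩ := h
      rfl
    · rw [mul_zero, mul_zero]
  | zero =>
    simp only [ZeroMemClass.coe_zero, zero_mul, map_zero, mul_zero]
    exact map_zero _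
  | add x y hx hy =>
    rw [map_add, mul_add, ← hx, ← hy, ← map_add]
    exact congrArg _ (Subtype.ext (add_mul (x : Λ) y _))
  | smul r x hx =>
    rw [map_smul, mul_smul_comm, ← hx, ← map_smul]
    exact congrArg _ (Subtype.ext (smul_mul_assoc r (x : Λ) _))

end PathCoeff

/-- The element `x` is dual to the path `p`, with value the component of `w` at the target of `p`:
its product with `p` is this component, its products with the other paths of the same length
vanish. -/
def IsDual (hπ : IsGradedFactor 𝒜 π) {M : GrMod 𝒜} {i k d : ℤ} (h : i + k = d) {a b : V}
    (p : Quiver.Path a b) (w : M.carrier d) (x : M.carrier i) : Prop :=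
  open Classical in ∀ {c e : V} (q : Quiver.Path c e) (hq : (q.length : ℤ) = k),
    M.act h x (hπ.path q hq) =
      if (⟨c, e, q⟩ : Σ c e : V, Quiver.Path c e) = ⟨a, b, p⟩ then
        MulOpposite.op (hπ.vertex b) • w else 0

theorem exists_isDual (hπ : IsGradedFactor 𝒜 π) {M : GrMod 𝒜} {i k d : ℤ} (hM : M.IsCofree d)
    (h : i + k = d) {a b : V} (p : Quiver.Path a b) (hk : (p.length : ℤ) = k)
    (hinj : ∀ x ∈ degreePart K V p.length, π x = 0 → x = 0) (w : M.carrier d) :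
    ∃ x, hπ.IsDual h p w x := by
  subst hk
  obtain ⟨x, hx⟩ := hM.exists_act h
    { toFun := fun z => MulOpposite.op (hπ.pathCoeff hinj p z • hπ.vertex b) • w
      map_add' := fun y z => by
        rw [← add_smul, ← MulOpposite.op_add, ← add_smul]
        exact congrArg (fun r : K => MulOpposite.op (r • hπ.vertex b) • w)
          (map_add (hπ.pathCoeff hinj p) y z)
      map_smul' := fun e z => by
        obtain ⟨c, hc⟩ := hπ.vertexHom_surjective e.unop
        have pathCoeff_smul := hπ.pathCoeff_mul_vertexHom hinj p c z
        rw [RingHom.id_apply, ← MulOpposite.op_unop e, ← hc, smul_smul, ← MulOpposite.op_mul,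
          smul_vertex_mul_vertexHom, mul_comm, ← pathCoeff_smul]
        rfl }
  refine ⟨x, fun {c e} q hq => (hx _).trans ?_⟩
  change MulOpposite.op (hπ.pathCoeff hinj p (hπ.path q hq) • hπ.vertex b) • w = _
  rw [pathCoeff_path]
  split_ifs
  · rw [one_smul]
  · rw [zero_smul, MulOpposite.op_zero]
    exact zero_smul (𝒜 0)ᵐᵒᵖ w

/-- The element of degree one given by an arrow. -/
def arrow (hπ : IsGradedFactor 𝒜 π) (s : Quiver.Total V) : 𝒜 1 :=
  hπ.path s.hom.toPath (by simp)

theorem mem_cogen_of_act_arrow_mem (hπ : IsGradedFactor 𝒜 π) {M : GrMod 𝒜} {i d : ℤ}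
    (h : i + 1 = d) {U : Submodule (𝒜 0)ᵐᵒᵖ (M.carrier d)} {x : M.carrier i}
    (hx : ∀ s : Quiver.Total V, M.act h x (hπ.arrow s) ∈ U) : x ∈ (M.cogen U).part i := by
  refine (mem_cogen h).2 fun a => ?_
  induction a using hπ.path_induction with
  | path a b p hp =>
    rcases p with _ | ⟨p, α⟩
    · simp at hp
    · obtain rfl := p.eq_of_length_zero (by simpa using hp)
      obtain rfl := p.eq_nil_of_length_zero (by simpa using hp)
      exact hx ⟨_, _, α⟩
  | zero => simpa only [act_zero] using zero_mem U
  | add a b ha hb => simpa only [act_add] using add_mem ha hb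
  | smul c a ha => simpa only [act_smul] using U.smul_mem _ ha

theorem ext_arrow (hπ : IsGradedFactor 𝒜 π) {M : GrMod 𝒜} {i d : ℤ} (hM : M.IsCofree d)
    (h : i + 1 = d) {x y : M.carrier i}
    (hxy : ∀ s : Quiver.Total V, M.act h x (hπ.arrow s) = M.act h y (hπ.arrow s)) : x = y := by
  have hmem : x - y ∈ (M.cogen (⊥ : Submodule (𝒜 0)ᵐᵒᵖ (M.carrier d))).part i :=
    hπ.mem_cogen_of_act_arrow_mem h fun s => by
      rw [sub_act, hxy, sub_self]
      exact zero_mem _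
  exact sub_eq_zero.1 (hM.eq_zero h _ fun a => (Submodule.mem_bot _).1 ((mem_cogen h).1 hmem a))

open Classical in
theorem exists_act_arrow_eq_ite (hπ : IsGradedFactor 𝒜 π) {M : GrMod 𝒜} {i d : ℤ}
    (hM : M.IsCofree d) (h : i + 1 = d) (s : Quiver.Total V) (w : M.carrier d) :
    ∃ x : M.carrier i, ∀ t : Quiver.Total V, M.act h x (hπ.arrow t) =
      if t = s then MulOpposite.op (hπ.vertex s.right) • w else 0 := by
  obtain ⟨x, hx⟩ := hπ.exists_isDual hM h s.hom.toPath (by simp) (by simpa using hπ.injOn_one) w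
  refine ⟨x, fun t => ?_⟩
  rw [arrow, hx]
  simp only [sigma_toPath_inj]

open Classical in
/-- The element dual to the arrow `s`, as an additive function of its value. -/
def dualArrow (hπ : IsGradedFactor 𝒜 π) {M : GrMod 𝒜} {i d : ℤ} (hM : M.IsCofree d)
    (h : i + 1 = d) (s : Quiver.Total V) : M.carrier d →+ M.carrier i :=
  AddMonoidHom.mk' (fun w => (hπ.exists_act_arrow_eq_ite hM h s w).choose) fun w w' =>
    hπ.ext_arrow hM h fun t => by
      rw [add_act, (hπ.exists_act_arrow_eq_ite hM h s (w + w')).choose_spec,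
        (hπ.exists_act_arrow_eq_ite hM h s w).choose_spec,
        (hπ.exists_act_arrow_eq_ite hM h s w').choose_spec]
      split_ifs
      · rw [smul_add]
      · rw [add_zero]

section DualArrow

variable (hπ : IsGradedFactor 𝒜 π) {M : GrMod 𝒜} {i d : ℤ} (hM : M.IsCofree d) (h : i + 1 = d)
  (s : Quiver.Total V) (w : M.carrier d)

open Classical in
theorem dualArrow_act (t : Quiver.Total V) : M.act h (hπ.dualArrow hM h s w) (hπ.arrow t) =
    if t = s then MulOpposite.op (hπ.vertex s.right) • w else 0 :=
  (hπ.exists_act_arrow_eq_ite hM h s w).choose_spec t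

theorem app_dualArrow {N : GrMod 𝒜} (hN : N.IsCofree d) (f : M ⟶ N) :
    f.app i (hπ.dualArrow hM h s w) = hπ.dualArrow hN h s (f.app d w) := by
  refine hπ.ext_arrow hN h fun t => ?_
  rw [← f.app_act, dualArrow_act, dualArrow_act]
  split_ifs
  · rw [Hom.app_smul]
  · rw [map_zero]

theorem dualArrow_vertexHom_smul (c : V → K) :
    hπ.dualArrow hM h s (MulOpposite.op (hπ.vertexHom c) • w) =
      MulOpposite.op (algebraMap K (𝒜 0) (c s.right)) • hπ.dualArrow hM h s w := by
  refine hπ.ext_arrow hM h fun t => ?_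
  have algebraMap_mul_arrow : (⟨algebraMap K (𝒜 0) (c s.right) * hπ.arrow t, by
      simpa using SetLike.GradedMul.mul_mem (algebraMap K (𝒜 0) (c s.right)).2 (hπ.arrow t).2⟩ :
      𝒜 1) = c s.right • hπ.arrow t :=
    Subtype.ext (Algebra.smul_def _ _).symm
  rw [smul_op_act, algebraMap_mul_arrow, act_smul, dualArrow_act, dualArrow_act]
  split_ifs
  · rw [smul_smul, smul_smul, ← MulOpposite.op_mul, ← MulOpposite.op_mul, vertexHom_mul_vertex]
    congr 2
    ext
    change c s.right • (hπ.vertex _ : Λ) = (hπ.vertex _ : Λ) * algebraMap K Λ _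
    rw [← Algebra.commutes, Algebra.smul_def]
  · rw [smul_zero]

theorem dualArrow_vertex_smul :
    hπ.dualArrow hM h s (MulOpposite.op (hπ.vertex s.right) • w) = hπ.dualArrow hM h s w := by
  refine hπ.ext_arrow hM h fun t => ?_
  rw [dualArrow_act, dualArrow_act, smul_smul, ← MulOpposite.op_mul, vertex_mul_self]

theorem vertex_smul_dualArrow :
    MulOpposite.op (hπ.vertex s.left) • hπ.dualArrow hM h s w = hπ.dualArrow hM h s w := by
  refine hπ.ext_arrow hM h fun t => ?_
  rw [smul_op_act]
  by_cases hs : s.left = t.left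
  · congr 1
    ext
    rw [hs]
    exact hπ.vertex_mul_path _ _
  · have vertex_mul_arrow : (⟨hπ.vertex s.left * hπ.arrow t, by
        simpa using SetLike.GradedMul.mul_mem (hπ.vertex s.left).2 (hπ.arrow t).2⟩ : 𝒜 1) = 0 :=
      Subtype.ext (hπ.path_mul_path_of_ne _ _ _ _ hs)
    rw [vertex_mul_arrow, act_zero, dualArrow_act, if_neg]
    rintro rfl
    exact hs rfl

theorem dualArrow_mem_cogen {U : Submodule (𝒜 0)ᵐᵒᵖ (M.carrier d)} (hw : w ∈ U) :
    hπ.dualArrow hM h s w ∈ (M.cogen U).part i := by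
  refine hπ.mem_cogen_of_act_arrow_mem h fun t => ?_
  rw [dualArrow_act]
  split_ifs
  · exact U.smul_mem _ hw
  · exact zero_mem _

theorem eq_sum_dualArrow [Fintype (Quiver.Total V)] (x : M.carrier i) :
    x = ∑ s, hπ.dualArrow hM h s (M.act h x (hπ.arrow s)) := by
  classical
  refine hπ.ext_arrow hM h fun t => ?_
  rw [← actHom_apply, ← actHom_apply, map_sum, Finset.sum_eq_single t]
  · rw [actHom_apply, actHom_apply, dualArrow_act, if_pos rfl, ← act_smul_op]
    congr 1
    ext
    exact (hπ.path_mul_vertex _ _).symm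
  · intro s _ hs
    rw [actHom_apply, dualArrow_act, if_neg hs.symm]
  · simp

end DualArrow

end IsGradedFactor

/-! ### The action of the arrows on the cogenerators of a complex -/

/-- The map `I^i ⟶ I^j` of a complex: the composition of the differentials from `I^i` to `I^j`. -/
def transition (I : ℤ ⥤ GrMod 𝒜) {i j : ℤ} (h : i ≤ j) : I.obj i ⟶ I.obj j := I.map (homOfLE h)

section Transition

open GrMod

variable (I : ℤ ⥤ GrMod 𝒜) {i j l : ℤ}

theorem transition_self_app (x : (I.obj i).carrier l) : (transition I le_rfl).app l x = x :=
  Hom.congr_app (I.map_id i) l x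

theorem transition_transition_app {k : ℤ} (h : i ≤ j) (h' : j ≤ k) (x : (I.obj i).carrier l) :
    (transition I h').app l ((transition I h).app l x) = (transition I (h.trans h')).app l x :=
  (Hom.congr_app (I.map_comp (homOfLE h) (homOfLE h')) l x).symm

variable {I} in
theorem app_transition {J : ℤ ⥤ GrMod 𝒜} (f : I ⟶ J) (h : i ≤ j) (x : (I.obj i).carrier l) :
    (f.app j).app l ((transition I h).app l x) = (transition J h).app l ((f.app i).app l x) :=
  Hom.congr_app (f.naturality (homOfLE h)) l x

end Transition

namespace IsGradedFactor

variable {V : Type v₁} [Quiver.{v₂} V] [Fintype V] {π : PathAlgebra K V →ₐ[K] Λ}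

open PathAlgebra GrMod

/-- The differential `I^i ⟶ I^j` restricted to the elements dual to the arrow `s`. If `I^i` is
cofree on its component of degree `-i`, this is a map between the components of the cogenerators,
and the differential is determined by these maps. -/
def arrowAction (hπ : IsGradedFactor 𝒜 π) {I : ℤ ⥤ GrMod 𝒜} (hI : ∀ k, (I.obj k).IsCofree (-k))
    {i j : ℤ} (h : i + 1 = j) (s : Quiver.Total V) :
    (I.obj i).carrier (-i) →+ (I.obj j).carrier (-j) :=
  ((transition I (show i ≤ j by omega)).app (-j)).comp
    (hπ.dualArrow (hI i) (show -j + 1 = -i by omega) s)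

section ArrowAction

variable (hπ : IsGradedFactor 𝒜 π) {I J : ℤ ⥤ GrMod 𝒜} (hI : ∀ k, (I.obj k).IsCofree (-k))
  {i j : ℤ} (h : i + 1 = j) (s : Quiver.Total V) (w : (I.obj i).carrier (-i))

theorem arrowAction_apply :
    hπ.arrowAction hI h s w = (transition I (show i ≤ j by omega)).app (-j)
      (hπ.dualArrow (hI i) (show -j + 1 = -i by omega) s w) := rfl

theorem app_arrowAction (hJ : ∀ k, (J.obj k).IsCofree (-k)) (f : I ⟶ J) :
    (f.app j).app (-j) (hπ.arrowAction hI h s w) =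
      hπ.arrowAction hJ h s ((f.app i).app (-i) w) := by
  rw [arrowAction_apply, arrowAction_apply, app_transition, hπ.app_dualArrow (hI i) _ _ _ (hJ i)]

theorem arrowAction_vertexHom_smul (c : V → K) :
    hπ.arrowAction hI h s (MulOpposite.op (hπ.vertexHom c) • w) =
      MulOpposite.op (algebraMap K (𝒜 0) (c s.right)) • hπ.arrowAction hI h s w := by
  rw [arrowAction_apply, arrowAction_apply, dualArrow_vertexHom_smul, Hom.app_smul]

theorem arrowAction_vertex_smul :
    hπ.arrowAction hI h s (MulOpposite.op (hπ.vertex s.right) • w) = hπ.arrowAction hI h s w := by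
  rw [arrowAction_apply, arrowAction_apply, dualArrow_vertex_smul]

theorem vertex_smul_arrowAction :
    MulOpposite.op (hπ.vertex s.left) • hπ.arrowAction hI h s w = hπ.arrowAction hI h s w := by
  rw [arrowAction_apply, ← Hom.app_smul, vertex_smul_dualArrow]

theorem vertex_smul_arrowAction_of_ne {b : V} (hb : s.left ≠ b) :
    MulOpposite.op (hπ.vertex b) • hπ.arrowAction hI h s w = 0 := by
  rw [← vertex_smul_arrowAction, smul_smul, ← MulOpposite.op_mul, vertex_mul_vertex_of_ne hπ hb,
    MulOpposite.op_zero]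
  exact zero_smul (𝒜 0)ᵐᵒᵖ (hπ.arrowAction hI h s w)

theorem transition_eq_sum_arrowAction [Fintype (Quiver.Total V)] (x : (I.obj i).carrier (-j)) :
    (transition I (show i ≤ j by omega)).app (-j) x = ∑ s, hπ.arrowAction hI h s
      ((I.obj i).act (show -j + 1 = -i by omega) x (hπ.arrow s)) := by
  conv_lhs => rw [hπ.eq_sum_dualArrow (hI i) (show -j + 1 = -i by omega) x]
  rw [map_sum]
  rfl

end ArrowAction

theorem ext_vertex_smul (hπ : IsGradedFactor 𝒜 π) {M : GrMod 𝒜} {i : ℤ} {w w' : M.carrier i}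
    (h : ∀ b, MulOpposite.op (hπ.vertex b) • w = MulOpposite.op (hπ.vertex b) • w') : w = w' := by
  have eq_sum (w : M.carrier i) : w = ∑ b, MulOpposite.op (hπ.vertex b) • w := by
    rw [← Finset.sum_smul, ← Finset.op_sum, sum_vertex, MulOpposite.op_one, one_smul]
  rw [eq_sum w, eq_sum w', Finset.sum_congr rfl fun b _ => h b]

theorem eq_zero_of_lt (hπ : IsGradedFactor 𝒜 π) {M : GrMod 𝒜} {d i : ℤ} (hM : M.IsCofree d)
    (h : d < i) (x : M.carrier i) : x = 0 :=
  hM.eq_zero (add_sub_cancel i d) x fun a => by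
    rw [hπ.eq_zero_of_neg (by omega) a, act_zero]

theorem socleLERange_iff_surjective (hπ : IsGradedFactor 𝒜 π) {M N : GrMod 𝒜} {d : ℤ}
    (hN : N.IsCofree d) (f : M ⟶ N) : SocleLERange f ↔ Function.Surjective (f.app d) := by
  refine ⟨fun h w => h d fun j k hk a hj => hπ.eq_zero_of_lt hN (by omega) _, fun h i x hx => ?_⟩
  rcases lt_trichotomy i d with hi | rfl | hi
  · rw [hN.eq_zero (add_sub_cancel i d) x fun a => hx _ _ _ a (by omega)]
    exact zero_mem _
  · exact h x
  · rw [hπ.eq_zero_of_lt hN hi x]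
    exact zero_mem _

theorem forall_dual_shift_hom_eq_zero_iff (hπ : IsGradedFactor 𝒜 π) [∀ a b : V, Finite (a ⟶ b)]
    {I : ℤ ⥤ GrMod 𝒜} (hI : ∀ k, (I.obj k).IsCofree (-k)) (j : ℤ) :
    (∀ f : (dual 𝒜).shift j ⟶ I.obj j, f ≫ I.map (homOfLE (show j ≤ j + 1 by omega)) = 0 → f = 0) ↔
      ∀ w : (I.obj j).carrier (-j), (∀ s, hπ.arrowAction hI rfl s w = 0) → w = 0 := by
  have := finite_total (V := V)
  have := Fintype.ofFinite (Quiver.Total V)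
  have hD : ((dual 𝒜).shift j).IsCofree (-j) := isCofree_dual_shift (neg_add_cancel j)
  refine ⟨fun h w hw => ?_, fun h f hf => (hI j).hom_ext fun y => h _ fun s => ?_⟩
  · obtain ⟨f, hf⟩ := (hI j).exists_dual_shift_hom (neg_add_cancel j) w
    obtain ⟨y, hy⟩ := dualEvalOne_surjective (𝒜 := 𝒜) (neg_add_cancel j)
      ⟨1, SetLike.GradedOne.one_mem⟩
    have f_comp_eq_zero : f ≫ transition I (show j ≤ j + 1 by omega) = 0 := by
      refine (hI (j + 1)).hom_ext fun z => ?_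
      refine (hπ.transition_eq_sum_arrowAction hI rfl _).trans (Finset.sum_eq_zero fun s _ => ?_)
      rw [← f.app_act, hf]
      obtain ⟨c, hc⟩ := hπ.vertexHom_surjective (dualEvalOne (neg_add_cancel j)
        (((dual 𝒜).shift j).act (show -(j + 1) + 1 = -j by omega) z (hπ.arrow s)))
      rw [← hc]
      refine (hπ.arrowAction_vertexHom_smul hI rfl s w c).trans ?_
      rw [hw, smul_zero]
    calc w = f.app (-j) y := ((hf y).trans (hy ▸ (I.obj j).act_one w)).symm
      _ = 0 := Hom.congr_app (h f f_comp_eq_zero) _ y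
  · rw [arrowAction_apply, ← hπ.app_dualArrow hD]
    exact Hom.congr_app hf _ _

end IsGradedFactor

/-! ### Faithfulness -/

theorem mem_supportSet_of_dvd {n : ℕ} {m j : ℤ} (h : (n : ℤ) ∣ j - m) : j ∈ supportSet n m := by
  obtain ⟨k, hk⟩ := h
  exact ⟨k, Or.inl (by rw [mul_comm]; omega)⟩

theorem mem_supportSet_iff {n : ℕ} {m j : ℤ} :
    j ∈ supportSet n m ↔ (n : ℤ) ∣ j - m ∨ (n : ℤ) ∣ j - 1 - m := by
  refine ⟨?_, fun h => h.elim mem_supportSet_of_dvd ?_⟩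
  · rintro ⟨k, rfl | rfl⟩
    · exact Or.inl ⟨k, by ring⟩
    · exact Or.inr ⟨k, by ring⟩
  · rintro ⟨k, hk⟩
    exact ⟨k, Or.inr (by rw [mul_comm]; omega)⟩

theorem two_lt_of_notMem_supportSet {n : ℕ} (hn : 2 ≤ n) {m j : ℤ} (hj : j ∉ supportSet n m) :
    2 < n := by
  rcases hn.lt_or_eq with h | rfl
  · exact h
  · refine absurd (mem_supportSet_iff.2 ?_) hj
    push_cast
    omega

theorem supportSet_induction {n : ℕ} (hn : n ≠ 0) (m : ℤ) {motive : ℤ → Prop}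
    (mem : ∀ j ∈ supportSet n m, motive j)
    (succ : ∀ j, j + 1 ∉ supportSet n m → motive j → motive (j + 1)) (j : ℤ) : motive j := by
  have hn0 : (n : ℤ) ≠ 0 := by omega
  suffices ∀ (r : ℕ) (j : ℤ), (n : ℤ) ∣ j - m - r → motive j by
    refine this ((j - m) % n).toNat j ?_
    rw [Int.toNat_of_nonneg (Int.emod_nonneg _ hn0)]
    exact Int.dvd_self_sub_emod
  intro r
  induction r with
  | zero => exact fun j hj => mem j (mem_supportSet_of_dvd (by simpa using hj))
  | succ r ih =>
    intro j hj
    by_cases hS : j ∈ supportSet n m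
    · exact mem j hS
    · have := succ (j - 1) (by rwa [sub_add_cancel]) (ih _ (by
        rwa [show j - 1 - m - (r : ℤ) = j - m - (r + 1 : ℕ) by push_cast; ring]))
      rwa [sub_add_cancel] at this

namespace IsGradedFactor

variable {V : Type v₁} [Quiver.{v₂} V] [Fintype V] {π : PathAlgebra K V →ₐ[K] Λ}
variable [∀ a b : V, Finite (a ⟶ b)]

open PathAlgebra GrMod

theorem isCofree_obj (hπ : IsGradedFactor 𝒜 π) {n : ℕ} (I : LinearNComplex 𝒜 n) (k : ℤ) :
    (I.obj.obj k).IsCofree (-k) :=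
  (hπ.isLinearNComplex_iff.1 I.property).2 k

theorem isGStar_iff (hπ : IsGradedFactor 𝒜 π) {n : ℕ} {m : ℤ} (I : LinearNComplex 𝒜 n) :
    isGStar 𝒜 n m I ↔ 2 < n →
      (∀ j ∉ supportSet n m, ∀ w : (I.obj.obj j).carrier (-j),
        (∀ s, hπ.arrowAction (hπ.isCofree_obj I) rfl s w = 0) → w = 0) ∧
      ∀ {i j : ℤ} (h : i + 1 = j), ¬(n : ℤ) ∣ j - m →
        Function.Surjective ((transition I.obj (show i ≤ j by omega)).app (-j)) := by
  refine imp_congr_right fun _ => and_congr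
    (forall₂_congr fun j _ => hπ.forall_dual_shift_hom_eq_zero_iff (hπ.isCofree_obj I) j) ?_
  have modEq_iff_dvd (j : ℤ) : j ≡ m [ZMOD n] ↔ (n : ℤ) ∣ j - m :=
    Int.modEq_comm.trans Int.modEq_iff_dvd
  refine ⟨fun h i j hij hj => ?_, fun h j hj => ?_⟩
  · obtain rfl : i = j - 1 := by omega
    exact (hπ.socleLERange_iff_surjective (hπ.isCofree_obj I j) _).1
      (h j (mt (modEq_iff_dvd j).1 hj))
  · exact (hπ.socleLERange_iff_surjective (hπ.isCofree_obj I j) _).2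
      (h (sub_add_cancel j 1) (mt (modEq_iff_dvd j).2 hj))

theorem hom_ext_of_isGStar (hπ : IsGradedFactor 𝒜 π) {n : ℕ} (hn : 2 ≤ n) {m : ℤ}
    {I J : LinearNComplex 𝒜 n} (hI : isGStar 𝒜 n m I) {f g : I ⟶ J}
    (hfg : ∀ j ∈ supportSet n m, f.hom.app j = g.hom.app j) : f = g := by
  refine ObjectProperty.hom_ext _ (NatTrans.ext (funext fun j => ?_))
  induction j using supportSet_induction (n := n) (by omega) m with
  | mem j hj => exact hfg j hj
  | succ j hj ih =>
    refine (hπ.isCofree_obj J (j + 1)).hom_ext fun w => ?_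
    obtain ⟨x, rfl⟩ := ((hπ.isGStar_iff I).1 hI (two_lt_of_notMem_supportSet hn hj)).2 rfl
      (mt mem_supportSet_of_dvd hj) w
    rw [app_transition, app_transition, ih]

theorem faithful_restriction (hπ : IsGradedFactor 𝒜 π) {n : ℕ} (hn : 2 ≤ n) (m : ℤ) :
    ((isGStar 𝒜 n m).ι ⋙ contraction 𝒜 hn m).Faithful where
  map_injective {I J} f g hfg := by
    refine ObjectProperty.hom_ext _ (hπ.hom_ext_of_isGStar hn I.property fun j hj => ?_)
    obtain ⟨k, rfl⟩ := exists_contractionIndex_eq hj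
    exact congrArg (fun φ => HomologicalComplex.Hom.f φ k) hfg

end IsGradedFactor

/-! ### Subcomplexes and quotient complexes -/

/-- A subcomplex of `I`: a graded submodule of each term of `I`, stable under the maps of `I`. -/
structure Subcomplex (I : ℤ ⥤ GrMod 𝒜) where
  submodule : ∀ j, (I.obj j).GrSubmodule
  map_mem : ∀ {j k : ℤ} (f : j ⟶ k) (i : ℤ), ∀ x ∈ (submodule j).part i,
    (I.map f).app i x ∈ (submodule k).part i

namespace Subcomplex

open GrMod

variable {I : ℤ ⥤ GrMod 𝒜} (S : Subcomplex I)

/-- A subcomplex, regarded as a complex. -/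
def toFunctor : ℤ ⥤ GrMod 𝒜 where
  obj j := (S.submodule j).toGrMod
  map f := (S.submodule _).codRestrict ((S.submodule _).subtype ≫ I.map f)
    fun i x => S.map_mem f i x.1 x.2
  map_id j := by
    ext i x
    exact Subtype.ext (Hom.congr_app (I.map_id j) i x.1)
  map_comp f g := by
    ext i x
    exact Subtype.ext (Hom.congr_app (I.map_comp f g) i x.1)

/-- The inclusion of a subcomplex. -/
def ι : S.toFunctor ⟶ I where
  app j := (S.submodule j).subtype

/-- The quotient of a complex by a subcomplex. -/
def quotient : ℤ ⥤ GrMod 𝒜 where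
  obj j := (S.submodule j).quotient
  map f := (S.submodule _).liftQ (I.map f ≫ (S.submodule _).mkQ)
    fun i x hx => (S.submodule _).mkQ_eq_zero_iff.2 (S.map_mem f i x hx)
  map_id j := by
    ext i x
    obtain ⟨x, rfl⟩ := (S.submodule j).mkQ_surjective i x
    exact congrArg ((S.submodule j).mkQ.app i) (Hom.congr_app (I.map_id j) i x)
  map_comp {j _ l} f g := by
    ext i x
    obtain ⟨x, rfl⟩ := (S.submodule j).mkQ_surjective i x
    exact congrArg ((S.submodule l).mkQ.app i) (Hom.congr_app (I.map_comp f g) i x)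

/-- The projection to the quotient by a subcomplex. -/
def π : I ⟶ S.quotient where
  app j := (S.submodule j).mkQ

instance : Mono S.ι :=
  (NatTrans.mono_iff_mono_app _).2 fun j =>
    mono_of_injective _ (S.submodule j).subtype_injective

instance : Epi S.π :=
  (NatTrans.epi_iff_epi_app _).2 fun j => epi_of_surjective _ (S.submodule j).mkQ_surjective

end Subcomplex

namespace IsGradedFactor

variable {V : Type v₁} [Quiver.{v₂} V] [Fintype V] {π : PathAlgebra K V →ₐ[K] Λ}

open PathAlgebra GrMod

section

variable (hπ : IsGradedFactor 𝒜 π) {I : ℤ ⥤ GrMod 𝒜} (hI : ∀ k, (I.obj k).IsCofree (-k))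

/-- The subcomplex of `I` determined by its components `U j` on cogenerators. -/
def cogenSubcomplex [∀ a b : V, Finite (a ⟶ b)]
    (U : ∀ j, Submodule (𝒜 0)ᵐᵒᵖ ((I.obj j).carrier (-j)))
    (hU : ∀ {i j : ℤ} (h : i + 1 = j) (s : Quiver.Total V), ∀ w ∈ U i,
      hπ.arrowAction hI h s w ∈ U j) : Subcomplex I where
  submodule j := (I.obj j).cogen (U j)
  map_mem {j k} f i x hx := by
    have := finite_total (V := V)
    have := Fintype.ofFinite (Quiver.Total V)
    suffices ∀ k (h : j ≤ k), (transition I h).app i x ∈ ((I.obj k).cogen (U k)).part i from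
      this k f.le
    intro k h
    induction k, h using Int.leInduction with
    | base => rwa [transition_self_app]
    | succ k h ih =>
      rw [← transition_transition_app I h (show k ≤ k + 1 by omega)]
      intro l hl a
      rw [← Hom.app_act, hπ.transition_eq_sum_arrowAction hI rfl]
      refine sum_mem fun s _ => hU rfl s _ ?_
      rw [(I.obj k).act_act _ _ rfl (by omega)]
      exact ih _ _ _

/-- The cogenerators of `I` lying in the smallest subcomplex, given by components on cogenerators,
which agrees with `I` on `𝒮`. -/
inductive SupportGenerated (n : ℕ) (m : ℤ) : ∀ j : ℤ, (I.obj j).carrier (-j) → Prop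
  | of_mem {j : ℤ} (hj : j ∈ supportSet n m) (w : (I.obj j).carrier (-j)) :
      SupportGenerated n m j w
  | zero {j : ℤ} : SupportGenerated n m j 0
  | add {j : ℤ} {w w' : (I.obj j).carrier (-j)} : SupportGenerated n m j w →
      SupportGenerated n m j w' → SupportGenerated n m j (w + w')
  | smul {j : ℤ} (a : (𝒜 0)ᵐᵒᵖ) {w : (I.obj j).carrier (-j)} : SupportGenerated n m j w →
      SupportGenerated n m j (a • w)
  | arrowAction {i j : ℤ} (h : i + 1 = j) (s : Quiver.Total V) {w : (I.obj i).carrier (-i)} :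
      SupportGenerated n m i w → SupportGenerated n m j (hπ.arrowAction hI h s w)

/-- The elements satisfying `SupportGenerated`, as a `Λ₀`-submodule. -/
def supportGenerated (n : ℕ) (m j : ℤ) : Submodule (𝒜 0)ᵐᵒᵖ ((I.obj j).carrier (-j)) where
  carrier := {w | SupportGenerated hπ hI n m j w}
  zero_mem' := .zero
  add_mem' := .add
  smul_mem' a _ := .smul a

theorem exists_mem_cogen_supportGenerated {n : ℕ} {m : ℤ}
    (surjective_of_dvd : ∀ {i j : ℤ} (h : i + 1 = j), (n : ℤ) ∣ i - m →
      Function.Surjective ((transition I (show i ≤ j by omega)).app (-j)))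
    {i j : ℤ} (h : i + 1 = j) (hj : ¬(n : ℤ) ∣ j - m) {w : (I.obj j).carrier (-j)}
    (hw : w ∈ supportGenerated hπ hI n m j) :
    ∃ x ∈ ((I.obj i).cogen (supportGenerated hπ hI n m i)).part (-j),
      (transition I (show i ≤ j by omega)).app (-j) x = w := by
  induction hw with
  | @of_mem j hjS w =>
    have hi : (n : ℤ) ∣ i - m := by
      obtain rfl : i = j - 1 := by omega
      exact (mem_supportSet_iff.1 hjS).resolve_left hj
    obtain ⟨x, rfl⟩ := surjective_of_dvd h hi w
    exact ⟨x, fun k hk a => .of_mem (mem_supportSet_of_dvd hi) _, rfl⟩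
  | zero => exact ⟨0, zero_mem _, map_zero _⟩
  | add _ _ ih ih' =>
    obtain ⟨x, hx, rfl⟩ := ih h hj
    obtain ⟨x', hx', rfl⟩ := ih' h hj
    exact ⟨x + x', add_mem hx hx', map_add _ _ _⟩
  | smul a _ ih =>
    obtain ⟨x, hx, rfl⟩ := ih h hj
    exact ⟨a • x, ((I.obj i).cogen _).isGrSubmodule _ _ _ hx, Hom.app_smul _ _ _ _⟩
  | @arrowAction i' j h' s w hw _ =>
    obtain rfl : i = i' := by omega
    exact ⟨_, hπ.dualArrow_mem_cogen (hI _) _ s _ hw, rfl⟩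

end

theorem exists_subcomplex_surjective_transition [∀ a b : V, Finite (a ⟶ b)]
    (hπ : IsGradedFactor 𝒜 π) {n : ℕ} {m : ℤ} (I : LinearNComplex 𝒜 n)
    (surjective_of_dvd : ∀ {i j : ℤ} (h : i + 1 = j), (n : ℤ) ∣ i - m →
      Function.Surjective ((transition I.obj (show i ≤ j by omega)).app (-j))) :
    ∃ (J : LinearNComplex 𝒜 n) (f : J ⟶ I), (∀ j ∈ supportSet n m, IsIso (f.hom.app j)) ∧
      ∀ {i j : ℤ} (h : i + 1 = j), ¬(n : ℤ) ∣ j - m →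
        Function.Surjective ((transition J.obj (show i ≤ j by omega)).app (-j)) := by
  have hI := hπ.isCofree_obj I
  let S := hπ.cogenSubcomplex hI (supportGenerated hπ hI n m) fun h s _ => .arrowAction h s
  let J : LinearNComplex 𝒜 n := ⟨S.toFunctor,
    hπ.isLinearNComplex_of_mono S.ι I.property fun k => (hI k).toGrMod isSaturated_cogen⟩
  refine ⟨J, ObjectProperty.homMk S.ι, fun j hj => ?_, fun h hj w => ?_⟩
  · refine (GrMod.isIso_iff_bijective _).2 fun i => ⟨Subtype.val_injective, fun x => ⟨⟨x, ?_⟩, rfl⟩⟩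
    exact fun k hk a => .of_mem hj _
  · obtain ⟨x, hx, hxw⟩ := exists_mem_cogen_supportGenerated hπ hI surjective_of_dvd h hj
      (mem_cogen_self.1 w.2)
    exact ⟨⟨x, hx⟩, Subtype.ext hxw⟩

end IsGradedFactor

/-! ### The essential image of the restriction of the contraction functor -/

/-- The least number of steps leading from `j` to an element of `m + nℤ`. -/
def stepsTo (n : ℕ) (m j : ℤ) : ℕ := ((m - j) % n).toNat

theorem stepsTo_eq_zero {n : ℕ} {m j : ℤ} (h : (n : ℤ) ∣ j - m) : stepsTo n m j = 0 := by
  rw [stepsTo, Int.emod_eq_zero_of_dvd (by rwa [dvd_sub_comm]), Int.toNat_zero]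

theorem stepsTo_eq_succ {n : ℕ} (hn : n ≠ 0) {m j : ℤ} (hj : ¬(n : ℤ) ∣ j - m) :
    stepsTo n m j = stepsTo n m (j + 1) + 1 := by
  have emod_nonneg := Int.emod_nonneg (m - j) (Nat.cast_ne_zero.2 hn)
  have emod_lt := Int.emod_lt_of_pos (m - j) (show (0 : ℤ) < n by omega)
  have emod_ne : (m - j) % n ≠ 0 := fun h => hj (dvd_sub_comm.1 (Int.dvd_of_emod_eq_zero h))
  have emod_succ : (m - (j + 1)) % n = (m - j) % n - 1 := by
    conv_lhs => rw [show m - (j + 1) = (m - j) % n - 1 + n * ((m - j) / n) by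
      linarith [Int.emod_add_mul_ediv (m - j) n]]
    rw [Int.add_mul_emod_self_left, Int.emod_eq_of_lt (by omega) (by omega)]
  rw [stepsTo, stepsTo, emod_succ]
  omega

namespace IsGradedFactor

variable {V : Type v₁} [Quiver.{v₂} V] [Fintype V] {π : PathAlgebra K V →ₐ[K] Λ}

open PathAlgebra GrMod

section

variable (hπ : IsGradedFactor 𝒜 π) {I : ℤ ⥤ GrMod 𝒜} (hI : ∀ k, (I.obj k).IsCofree (-k))

/-- The elements annihilated by all products of `l` duals of arrows. -/
def arrowTorsion : ℕ → ∀ j : ℤ, Submodule (𝒜 0)ᵐᵒᵖ ((I.obj j).carrier (-j))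
  | 0, _ => ⊥
  | l + 1, j =>
    { carrier := {w | ∀ s, hπ.arrowAction hI rfl s w ∈ arrowTorsion l (j + 1)}
      zero_mem' s := by
        rw [map_zero]
        exact zero_mem _
      add_mem' hw hw' s := by
        rw [map_add]
        exact add_mem (hw s) (hw' s)
      smul_mem' a w hw s := by
        obtain ⟨c, hc⟩ := hπ.vertexHom_surjective a.unop
        rw [← MulOpposite.op_unop a, ← hc, arrowAction_vertexHom_smul]
        exact Submodule.smul_mem _ _ (hw s) }

open Classical in
/-- The components on cogenerators of the largest subcomplex of `I` vanishing on `𝒮`: an element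
generates a submodule of such a subcomplex if and only if the products of duals of arrows leading
to the next element of `m + nℤ` annihilate it. -/
def supportTorsion (n : ℕ) (m j : ℤ) : Submodule (𝒜 0)ᵐᵒᵖ ((I.obj j).carrier (-j)) :=
  if j ∈ supportSet n m then ⊥ else hπ.arrowTorsion hI (stepsTo n m j) j

variable {n : ℕ} {m j : ℤ}

theorem supportTorsion_eq_bot (hj : j ∈ supportSet n m) : hπ.supportTorsion hI n m j = ⊥ :=
  if_pos hj

theorem mem_supportTorsion_iff (hn : n ≠ 0) (hj : j ∉ supportSet n m)
    {w : (I.obj j).carrier (-j)} : w ∈ hπ.supportTorsion hI n m j ↔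
      ∀ s, hπ.arrowAction hI rfl s w ∈ hπ.supportTorsion hI n m (j + 1) := by
  have not_dvd : ¬(n : ℤ) ∣ j - m := mt mem_supportSet_of_dvd hj
  have succ_eq : hπ.supportTorsion hI n m (j + 1) =
      hπ.arrowTorsion hI (stepsTo n m (j + 1)) (j + 1) := by
    by_cases h : j + 1 ∈ supportSet n m
    · have dvd := (mem_supportSet_iff.1 h).resolve_right (by rwa [add_sub_cancel_right])
      rw [supportTorsion_eq_bot hπ hI h, stepsTo_eq_zero dvd, arrowTorsion]
    · exact if_neg h
  rw [succ_eq, supportTorsion, if_neg hj, stepsTo_eq_succ hn not_dvd]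
  rfl

theorem arrowAction_mem_supportTorsion (hn : n ≠ 0) {i : ℤ} (h : i + 1 = j) (s : Quiver.Total V)
    (w : (I.obj i).carrier (-i)) (hw : w ∈ hπ.supportTorsion hI n m i) :
    hπ.arrowAction hI h s w ∈ hπ.supportTorsion hI n m j := by
  subst h
  by_cases hi : i ∈ supportSet n m
  · rw [supportTorsion_eq_bot hπ hI hi, Submodule.mem_bot] at hw
    rw [hw, map_zero]
    exact zero_mem _
  · exact (mem_supportTorsion_iff hπ hI hn hi).1 hw s

end

variable [∀ a b : V, Finite (a ⟶ b)]

theorem exists_quotient_isGStar (hπ : IsGradedFactor 𝒜 π) {n : ℕ} (hn : n ≠ 0) {m : ℤ}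
    (I : LinearNComplex 𝒜 n)
    (surjective_of_not_dvd : ∀ {i j : ℤ} (h : i + 1 = j), ¬(n : ℤ) ∣ j - m →
      Function.Surjective ((transition I.obj (show i ≤ j by omega)).app (-j))) :
    ∃ (J : LinearNComplex 𝒜 n) (f : I ⟶ J), (∀ j ∈ supportSet n m, IsIso (f.hom.app j)) ∧
      isGStar 𝒜 n m J := by
  have hI := hπ.isCofree_obj I
  have := hπ.isSemisimpleRing
  let S := hπ.cogenSubcomplex hI (hπ.supportTorsion hI n m)
    (hπ.arrowAction_mem_supportTorsion hI hn)
  have app_eq_zero_iff (j : ℤ) (w : (I.obj.obj j).carrier (-j)) :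
      (S.π.app j).app (-j) w = 0 ↔ w ∈ hπ.supportTorsion hI n m j :=
    (S.submodule j).mkQ_eq_zero_iff.trans mem_cogen_self
  have hJ (j : ℤ) : (S.quotient.obj j).IsCofree (-j) := (hI j).quotient isSaturated_cogen
  let J : LinearNComplex 𝒜 n := ⟨S.quotient, hπ.isLinearNComplex_of_epi S.π I.property hJ⟩
  refine ⟨J, ObjectProperty.homMk S.π, fun j hj => ?_,
    (hπ.isGStar_iff J).2 fun _ => ⟨fun j hj w hw => ?_, fun {i j} h hj w => ?_⟩⟩
  · refine (GrMod.isIso_iff_bijective _).2 fun i => ⟨?_, (S.submodule j).mkQ_surjective i⟩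
    refine (injective_iff_map_eq_zero _).2 fun x hx => ?_
    have hx' : x ∈ (S.submodule j).part i := (S.submodule j).mkQ_eq_zero_iff.1 hx
    refine (hI j).eq_zero (add_sub_cancel i (-j)) x fun a => (Submodule.mem_bot (𝒜 0)ᵐᵒᵖ).1 ?_
    exact hπ.supportTorsion_eq_bot hI hj ▸ hx' _ _ a
  · obtain ⟨w, rfl⟩ := (S.submodule j).mkQ_surjective _ w
    refine (app_eq_zero_iff j w).2 ((hπ.mem_supportTorsion_iff hI hn hj).2 fun s => ?_)
    exact (app_eq_zero_iff _ _).1 ((hπ.app_arrowAction hI rfl s w hJ S.π).trans (hw s))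
  · obtain ⟨w, rfl⟩ := (S.submodule j).mkQ_surjective _ w
    obtain ⟨x, rfl⟩ := surjective_of_not_dvd h hj w
    exact ⟨(S.π.app i).app (-j) x, (app_transition S.π _ x).symm⟩

end IsGradedFactor

theorem nonempty_contraction_obj_iso {n : ℕ} (hn : 2 ≤ n) {m : ℤ} {I J : LinearNComplex 𝒜 n}
    (f : I ⟶ J) (hf : ∀ j ∈ supportSet n m, IsIso (f.hom.app j)) :
    Nonempty ((contraction 𝒜 hn m).obj I ≅ (contraction 𝒜 hn m).obj J) := by
  have (k : ℤ) : IsIso (((contraction 𝒜 hn m).map f).f k) :=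
    hf _ (contractionIndex_mem_supportSet n m k)
  have := HomologicalComplex.Hom.isIso_of_components ((contraction 𝒜 hn m).map f)
  exact ⟨asIso ((contraction 𝒜 hn m).map f)⟩

theorem contraction_obj_d {n : ℕ} (hn : 2 ≤ n) (m : ℤ) (I : LinearNComplex 𝒜 n) {i j : ℤ}
    (h : i + 1 = j) : ((contraction 𝒜 hn m).obj I).d i j =
      transition I.obj (contractionIndex_le hn m h) := dif_pos h

namespace IsGradedFactor

variable {V : Type v₁} [Quiver.{v₂} V] [Fintype V] {π : PathAlgebra K V →ₐ[K] Λ}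
variable [∀ a b : V, Finite (a ⟶ b)]

open PathAlgebra GrMod

theorem socleLERange_iff_of_contraction_iso (hπ : IsGradedFactor 𝒜 π) {n : ℕ} (hn : 2 ≤ n) (m : ℤ)
    {C : CochainComplex (GrMod 𝒜) ℤ} {I : LinearNComplex 𝒜 n}
    (e : (contraction 𝒜 hn m).obj I ≅ C) (k : ℤ) {i j : ℤ} (hi : m + k * n = i) (h : i + 1 = j) :
    SocleLERange (C.d (2 * k) (2 * k + 1)) ↔
      Function.Surjective ((transition I.obj (show i ≤ j by omega)).app (-j)) := by
  obtain rfl : contractionIndex n m (2 * k) = i := (contractionIndex_even n m k).trans hi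
  obtain rfl : contractionIndex n m (2 * k + 1) = j := by rw [contractionIndex_odd, hi, h]
  let d := -contractionIndex n m (2 * k + 1)
  have hC : (C.X (2 * k + 1)).IsCofree d :=
    (hπ.isCofree_obj I _).of_iso ((HomologicalComplex.eval (GrMod 𝒜) _ (2 * k + 1)).mapIso e)
  have bijective_app (l : ℤ) : Function.Bijective ((e.hom.f l).app d) :=
    (GrMod.isIso_iff_bijective (e.hom.f l)).1 inferInstance d
  have comm := e.hom.comm (2 * k) (2 * k + 1)
  rw [contraction_obj_d hn m I rfl] at comm
  rw [hπ.socleLERange_iff_surjective hC,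
    ← Function.Surjective.of_comp_iff _ (bijective_app (2 * k)).surjective]
  exact (iff_of_eq (congrArg Function.Surjective (funext (Hom.congr_app comm d)))).trans
    (Function.Surjective.of_comp_iff' (bijective_app (2 * k + 1)) _)

theorem essImage_iff (hπ : IsGradedFactor 𝒜 π) {n : ℕ} (hn : 2 ≤ n) (m : ℤ)
    (C : CochainComplex (GrMod 𝒜) ℤ) :
    ((isGStar 𝒜 n m).ι ⋙ contraction 𝒜 hn m).essImage C ↔
      (contraction 𝒜 hn m).essImage C ∧
      (∀ j : ℤ, (C.X j).IsAlmostInjective ∧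
        (C.X j).IsCogeneratedInDegree (-contractionIndex n m j)) ∧
      (2 < n → ∀ j : ℤ, GrMod.SocleLERange (C.d (2 * j) (2 * j + 1))) := by
  constructor
  · rintro ⟨I, ⟨e⟩⟩
    refine ⟨⟨I.obj, ⟨e⟩⟩, fun j => ?_, fun hn2 k => ?_⟩
    · exact hπ.isAlmostInjective_and_isCogeneratedInDegree_iff.2 ((hπ.isCofree_obj I.obj _).of_iso
        ((HomologicalComplex.eval (GrMod 𝒜) _ j).mapIso e))
    · refine (hπ.socleLERange_iff_of_contraction_iso hn m e k rfl rfl).2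
        (((hπ.isGStar_iff I.obj).1 I.property hn2).2 rfl ?_)
      rw [show m + k * n + 1 - m = 1 + n * k by ring, Int.dvd_add_left (dvd_mul_right _ _)]
      exact fun h => absurd (Int.le_of_dvd one_pos h) (by omega)
  · rintro ⟨⟨I, ⟨e⟩⟩, -, h⟩
    rcases hn.eq_or_lt with rfl | hn2
    · exact ⟨⟨I, fun h => absurd h (lt_irrefl 2)⟩, ⟨e⟩⟩
    obtain ⟨J, f, hf, hJ⟩ := hπ.exists_subcomplex_surjective_transition (m := m) I
      fun hij ⟨k, hk⟩ => (hπ.socleLERange_iff_of_contraction_iso hn m e k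
        (by rw [mul_comm]; omega) hij).1 (h hn2 k)
    obtain ⟨L, g, hg, hL⟩ := hπ.exists_quotient_isGStar (by omega) J hJ
    obtain ⟨e₁⟩ := nonempty_contraction_obj_iso hn f hf
    obtain ⟨e₂⟩ := nonempty_contraction_obj_iso hn g hg
    exact ⟨⟨L, hL⟩, ⟨e₂.symm ≪≫ e₁ ≪≫ e⟩⟩

end IsGradedFactor

/-! ### Relations of high degree -/

namespace PathAlgebra

variable {V : Type v₁} [Quiver.{v₂} V]

theorem concat_eq_sum {a b c : V} (f : Quiver.Path a b →₀ K) (g : Quiver.Path b c →₀ K) :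
    concat f g = f.sum fun p r => g.sum fun q s => Finsupp.single (p.comp q) (r * s) := by
  conv_lhs => rw [← f.sum_single, ← g.sum_single]
  simp only [Finsupp.sum, map_sum, LinearMap.sum_apply, concat_single]
  exact Finset.sum_comm

theorem concat_apply_eq_zero {a b c : V} {f : Quiver.Path a b →₀ K} {g : Quiver.Path b c →₀ K}
    {r : Quiver.Path a c} (h : ∀ p q, p.comp q = r → f p = 0 ∨ g q = 0) : concat f g r = 0 := by
  rw [concat_eq_sum, Finsupp.sum_apply]
  refine Finset.sum_eq_zero fun p hp => ?_
  change (g.sum fun q s => Finsupp.single (p.comp q) (f p * s)) r = 0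
  rw [Finsupp.sum_apply]
  refine Finset.sum_eq_zero fun q hq => Finsupp.single_eq_of_ne fun hpq => ?_
  rcases h p q hpq.symm with h | h
  · exact Finsupp.mem_support_iff.1 hp h
  · exact Finsupp.mem_support_iff.1 hq h

variable [Fintype V]

theorem coeff_eq_zero_of_hasRelationsOfDegreeGE {π : PathAlgebra K V →ₐ[K] Λ} {n : ℕ}
    (hn : HasRelationsOfDegreeGE π n) {x : PathAlgebra K V} (hx : π x = 0) {a b : V}
    (p : Quiver.Path a b) (hp : p.length < n) : x.coeff a b p = 0 := by
  rw [← TwoSidedIdeal.mem_ker, hn] at hx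
  induction hx using TwoSidedIdeal.span_induction generalizing a b p with
  | mem x hx =>
    obtain ⟨-, k, hk, hxk⟩ := hx
    by_contra h
    have := hxk a b p h
    omega
  | zero => rfl
  | add x y _ _ hx hy =>
    rw [coeff_add, Finsupp.add_apply, hx p hp, hy p hp, add_zero]
  | neg x _ hx => exact neg_eq_zero.2 (hx p hp)
  | left_absorb y x _ hx =>
    rw [coeff_mul, Finsupp.finsetSum_apply]
    refine Finset.sum_eq_zero fun c _ => concat_apply_eq_zero fun q r hqr => Or.inr (hx r ?_)
    rw [← hqr, Quiver.Path.length_comp] at hp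
    omega
  | right_absorb y x _ hx =>
    rw [coeff_mul, Finsupp.finsetSum_apply]
    refine Finset.sum_eq_zero fun c _ => concat_apply_eq_zero fun q r hqr => Or.inl (hx q ?_)
    rw [← hqr, Quiver.Path.length_comp] at hp
    omega

theorem eq_zero_of_hasRelationsOfDegreeGE {π : PathAlgebra K V →ₐ[K] Λ} {n : ℕ}
    (hn : HasRelationsOfDegreeGE π n) {k : ℕ} (hk : k < n) {x : PathAlgebra K V}
    (hx : x ∈ degreePart K V k) (h : π x = 0) : x = 0 := by
  ext1
  funext a b
  ext p
  by_contra hp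
  exact hp (coeff_eq_zero_of_hasRelationsOfDegreeGE hn h p ((hx a b p hp).trans_lt hk))

end PathAlgebra

/-! ### Paths acting on the cogenerators of a complex -/

namespace IsGradedFactor

variable {V : Type v₁} [Quiver.{v₂} V] [Fintype V] {π : PathAlgebra K V →ₐ[K] Λ}

open PathAlgebra GrMod

theorem IsDual.map {hπ : IsGradedFactor 𝒜 π} {M N : GrMod 𝒜} (f : M ⟶ N) {i k d : ℤ}
    {h : i + k = d} {a b : V} {p : Quiver.Path a b} {w : M.carrier d} {x : M.carrier i}
    (hx : hπ.IsDual h p w x) : hπ.IsDual h p (f.app d w) (f.app i x) := by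
  intro c e q hq
  rw [← f.app_act, hx q hq]
  split_ifs
  · rw [Hom.app_smul]
  · rw [map_zero]

theorem IsDual.eq_vertex_smul {hπ : IsGradedFactor 𝒜 π} {M : GrMod 𝒜} {i : ℤ} {b : V}
    {w x : M.carrier i} (h : hπ.IsDual (add_zero i) (Quiver.Path.nil : Quiver.Path b b) w x) :
    x = MulOpposite.op (hπ.vertex b) • w := by
  refine hπ.ext_vertex_smul fun c => (h Quiver.Path.nil (by simp)).trans ?_
  split_ifs with hc
  · obtain ⟨⟩ := hc
    rw [smul_smul, ← MulOpposite.op_mul, vertex_mul_self]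
  · rw [smul_smul, ← MulOpposite.op_mul, vertex_mul_vertex_of_ne hπ fun h => hc (by rw [h]),
      MulOpposite.op_zero]
    exact (zero_smul (𝒜 0)ᵐᵒᵖ w).symm

open Classical in
theorem IsDual.act_path_eq {hπ : IsGradedFactor 𝒜 π} {M : GrMod 𝒜} {l i k d : ℤ}
    {h : l + (k + 1) = d} {a b c : V} {p : Quiver.Path a b} {α : b ⟶ c} {w : M.carrier d}
    {x : M.carrier l} (hx : hπ.IsDual h (p.cons α) w x) (hM : M.IsCofree d) (hi : i + 1 = d)
    (hl : l + k = i) {e f : V} (q : Quiver.Path e f) (hq : (q.length : ℤ) = k) :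
    M.act hl x (hπ.path q hq) = if (⟨e, f, q⟩ : Σ a b : V, Quiver.Path a b) = ⟨a, b, p⟩ then
      hπ.dualArrow hM hi ⟨b, c, α⟩ w else 0 := by
  refine hπ.ext_arrow hM hi fun ⟨f', g, β⟩ => ?_
  rw [M.act_act hl hi rfl h]
  by_cases hf : f = f'
  · subst hf
    have hqβ : ((q.cons β).length : ℤ) = k + 1 := by simp [hq]
    have path_mul_arrow : (⟨hπ.path q hq * hπ.arrow ⟨f, g, β⟩, SetLike.GradedMul.mul_mem
        (hπ.path q hq).2 (hπ.arrow ⟨f, g, β⟩).2⟩ : 𝒜 (k + 1)) = hπ.path (q.cons β) hqβ :=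
      Subtype.ext (hπ.path_mul_path q β.toPath hq _ hqβ)
    rw [path_mul_arrow, hx]
    simp only [sigma_cons_inj, ite_and]
    split_ifs <;> simp_all [dualArrow_act]
  · have path_mul_arrow : (⟨hπ.path q hq * hπ.arrow ⟨f', g, β⟩, SetLike.GradedMul.mul_mem
        (hπ.path q hq).2 (hπ.arrow ⟨f', g, β⟩).2⟩ : 𝒜 (k + 1)) = 0 :=
      Subtype.ext (hπ.path_mul_path_of_ne q β.toPath hq _ hf)
    rw [path_mul_arrow, act_zero]
    split_ifs with hqp
    · cases hqp
      rw [dualArrow_act, if_neg]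
      rintro ⟨⟩
      exact hf rfl
    · exact (zero_act _ _ _).symm

theorem IsDual.transition {hπ : IsGradedFactor 𝒜 π} {I : ℤ ⥤ GrMod 𝒜}
    (hI : ∀ k, (I.obj k).IsCofree (-k)) {i j l k : ℤ} (h : i + 1 = j) (hl : l + k = -j)
    {hl' : l + (k + 1) = -i} {a b c : V} {p : Quiver.Path a b} {α : b ⟶ c}
    {w : (I.obj i).carrier (-i)} {x : (I.obj i).carrier l} (hx : hπ.IsDual hl' (p.cons α) w x) :
    hπ.IsDual hl p (hπ.arrowAction hI h ⟨b, c, α⟩ w)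
      ((transition I (show i ≤ j by omega)).app l x) := by
  intro d e q hq
  rw [← Hom.app_act, hx.act_path_eq (hI i) (show -j + 1 = -i by omega) hl q hq]
  split_ifs
  · exact (hπ.vertex_smul_arrowAction hI h ⟨b, c, α⟩ w).symm
  · rw [map_zero]

section PathAction

variable (hπ : IsGradedFactor 𝒜 π) {I J : ℤ ⥤ GrMod 𝒜} (hI : ∀ k, (I.obj k).IsCofree (-k))
  (hJ : ∀ k, (J.obj k).IsCofree (-k))

/-- The product of the actions of the arrows of a path, from its last arrow to its first one. -/
def pathAction {a : V} : ∀ {b : V} (p : Quiver.Path a b) {i j : ℤ} (_ : i + p.length = j),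
    (I.obj i).carrier (-i) →+ (I.obj j).carrier (-j)
  | _, .nil, i, _, h =>
    (show i = _ by simpa using h) ▸
      DistribSMul.toAddMonoidHom _ (MulOpposite.op (hπ.vertex a))
  | _, .cons p α, _, _, h =>
    (pathAction p (by rw [← h, Quiver.Path.length_cons]; push_cast; ring)).comp
      (hπ.arrowAction hI rfl ⟨_, _, α⟩)

theorem pathAction_nil {a : V} {i : ℤ} (h : i + (Quiver.Path.nil : Quiver.Path a a).length = i)
    (w : (I.obj i).carrier (-i)) :
    hπ.pathAction hI .nil h w = MulOpposite.op (hπ.vertex a) • w := rfl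

theorem pathAction_cons {a b c : V} (p : Quiver.Path a b) (α : b ⟶ c) {i j : ℤ}
    (h : i + (p.cons α).length = j) (h' : i + 1 + p.length = j) (w : (I.obj i).carrier (-i)) :
    hπ.pathAction hI (p.cons α) h w =
      hπ.pathAction hI p h' (hπ.arrowAction hI rfl ⟨b, c, α⟩ w) := rfl

theorem pathAction_arrowAction_of_ne {a b : V} (p : Quiver.Path a b) {i j : ℤ}
    (h : i + 1 + p.length = j) {s : Quiver.Total V} (hs : s.left ≠ b)
    (w : (I.obj i).carrier (-i)) : hπ.pathAction hI p h (hπ.arrowAction hI rfl s w) = 0 := by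
  cases p with
  | nil =>
    obtain rfl : i + 1 = j := by simpa using h
    rw [pathAction_nil, vertex_smul_arrowAction_of_ne hπ hI rfl s w hs]
  | cons p α =>
    rw [pathAction_cons hπ hI p α h (by rw [← h, Quiver.Path.length_cons]; push_cast; ring),
      ← arrowAction_vertex_smul, vertex_smul_arrowAction_of_ne hπ hI rfl s w hs, map_zero, map_zero]

theorem transition_eq_pathAction_of_isDual {a b : V} (p : Quiver.Path a b) {i j k : ℤ}
    (hk : (p.length : ℤ) = k) (hij : i + p.length = j) (hk' : -j + k = -i)
    {w : (I.obj i).carrier (-i)} {x : (I.obj i).carrier (-j)} (hx : hπ.IsDual hk' p w x) :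
    (transition I (show i ≤ j by omega)).app (-j) x = hπ.pathAction hI p hij w := by
  induction p generalizing i k with
  | nil =>
    obtain rfl : k = 0 := by simpa using hk.symm
    obtain rfl : i = j := by omega
    rw [transition_self_app, pathAction_nil, hx.eq_vertex_smul]
  | cons p α ih =>
    obtain rfl : (p.length : ℤ) + 1 = k := by simpa using hk
    rw [pathAction_cons hπ hI p α hij (by omega),
      ← ih rfl (by omega) (by omega) (hx.transition hI rfl (by omega)), transition_transition_app]

theorem ext_pathAction {j : ℤ} {l : ℕ}
    (eq_zero_of_arrowAction : ∀ i, j ≤ i → i < j + l → ∀ w : (I.obj i).carrier (-i),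
      (∀ s, hπ.arrowAction hI rfl s w = 0) → w = 0)
    {w w' : (I.obj j).carrier (-j)} {t : ℤ} (ht : j + l = t)
    (hw : ∀ {a b : V} (p : Quiver.Path a b) (h : j + p.length = t),
      hπ.pathAction hI p h w = hπ.pathAction hI p h w') : w = w' := by
  induction l generalizing j with
  | zero =>
    obtain rfl : j = t := by simpa using ht
    refine hπ.ext_vertex_smul fun b => ?_
    exact hw (Quiver.Path.nil : Quiver.Path b b) (by simp)
  | succ l ih =>
    refine sub_eq_zero.1 (eq_zero_of_arrowAction j le_rfl (by omega) _ fun s => ?_)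
    rw [map_sub, sub_eq_zero]
    refine ih (fun i hi hit => eq_zero_of_arrowAction i (by omega) (by omega))
      (by omega) fun {a b} p h => ?_
    by_cases hs : s.left = b
    · subst hs
      exact hw (p.cons s.hom) (by rw [← h, Quiver.Path.length_cons]; push_cast; ring)
    · rw [hπ.pathAction_arrowAction_of_ne hI p h hs, hπ.pathAction_arrowAction_of_ne hI p h hs]

/-- The morphisms `f` and `g` commute with the actions of the paths of length `t - j`. -/
def IsPathEquivariant {j t : ℤ} (f : I.obj j ⟶ J.obj j) (g : I.obj t ⟶ J.obj t) : Prop :=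
  ∀ ⦃a b : V⦄ (p : Quiver.Path a b) (h : j + p.length = t) (w : (I.obj j).carrier (-j)),
    hπ.pathAction hJ p h (f.app (-j) w) = g.app (-t) (hπ.pathAction hI p h w)

variable {hπ hI hJ} {j t : ℤ} {f : I.obj j ⟶ J.obj j} {g : I.obj t ⟶ J.obj t}

theorem isPathEquivariant_of_transition (hjt : j ≤ t)
    (hinj : ∀ k : ℕ, j + k = t → ∀ x ∈ degreePart K V k, π x = 0 → x = 0)
    (hfg : ∀ x, (transition J hjt).app (-t) (f.app (-t) x) =
      g.app (-t) ((transition I hjt).app (-t) x)) : hπ.IsPathEquivariant hI hJ f g := by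
  intro a b p h w
  obtain ⟨x, hx⟩ := hπ.exists_isDual (hI j) (show -t + p.length = -j by omega) p rfl (hinj _ h) w
  rw [← hπ.transition_eq_pathAction_of_isDual hI p rfl h _ hx,
    ← hπ.transition_eq_pathAction_of_isDual hJ p rfl h _ (hx.map f)]
  exact hfg x

variable [∀ a b : V, Finite (a ⟶ b)]

theorem IsPathEquivariant.pathAction_transition (hf : hπ.IsPathEquivariant hI hJ f g) {a b : V}
    (p : Quiver.Path a b) (h : j + 1 + p.length = t) (x : (I.obj j).carrier (-(j + 1))) :
    hπ.pathAction hJ p h ((transition J (show j ≤ j + 1 by omega)).app _ (f.app _ x)) =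
      g.app (-t) (hπ.pathAction hI p h ((transition I (show j ≤ j + 1 by omega)).app _ x)) := by
  have := finite_total (V := V)
  have := Fintype.ofFinite (Quiver.Total V)
  rw [hπ.transition_eq_sum_arrowAction hI rfl, hπ.transition_eq_sum_arrowAction hJ rfl]
  simp only [map_sum]
  refine Finset.sum_congr rfl fun s _ => ?_
  by_cases hs : s.left = b
  · subst hs
    rw [← f.app_act]
    exact hf (p.cons s.hom) (by rw [← h, Quiver.Path.length_cons]; push_cast; ring) _
  · rw [hπ.pathAction_arrowAction_of_ne hI p h hs, hπ.pathAction_arrowAction_of_ne hJ p h hs,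
      map_zero]

theorem IsPathEquivariant.comp_transition {f : I.obj j ⟶ J.obj j}
    {g : I.obj (j + 1) ⟶ J.obj (j + 1)} (hf : hπ.IsPathEquivariant hI hJ f g) :
    f ≫ transition J (show j ≤ j + 1 by omega) = transition I (show j ≤ j + 1 by omega) ≫ g := by
  refine (hJ (j + 1)).hom_ext fun x => ?_
  refine hπ.ext_vertex_smul fun b => ?_
  rw [comp_app, comp_app, ← g.app_smul]
  exact hf.pathAction_transition (Quiver.Path.nil : Quiver.Path b b) (by simp) x

theorem IsPathEquivariant.exists_succ (hf : hπ.IsPathEquivariant hI hJ f g)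
    (hIs : Function.Surjective ((transition I (show j ≤ j + 1 by omega)).app (-(j + 1))))
    (hJe : ∀ w w' : (J.obj (j + 1)).carrier (-(j + 1)), (∀ {a b : V} (p : Quiver.Path a b)
      (h : j + 1 + p.length = t), hπ.pathAction hJ p h w = hπ.pathAction hJ p h w') → w = w') :
    ∃ f' : I.obj (j + 1) ⟶ J.obj (j + 1), hπ.IsPathEquivariant hI hJ f' g := by
  let d := (transition I (show j ≤ j + 1 by omega)).appLinear (-(j + 1))
  let e := (f ≫ transition J (show j ≤ j + 1 by omega)).appLinear (-(j + 1))
  have ker_le : LinearMap.ker d ≤ LinearMap.ker e := fun x hx => by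
    refine hJe _ _ fun p h => (hf.pathAction_transition p h x).trans ?_
    rw [show (transition I _).app _ x = 0 from hx, map_zero, map_zero, map_zero]
  let ψ := (LinearMap.ker d).liftQ e ker_le ∘ₗ (d.quotKerEquivOfSurjective hIs).symm.toLinearMap
  obtain ⟨f', hf'⟩ := (hJ (j + 1)).exists_hom_app_eq ψ
  refine ⟨f', fun a b p h w => ?_⟩
  obtain ⟨x, rfl⟩ := hIs w
  have ψ_d : ψ (d x) = e x := by
    simp only [ψ, LinearMap.comp_apply, LinearEquiv.coe_coe,
      d.quotKerEquivOfSurjective_symm_apply hIs, Submodule.liftQ_apply]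
  rw [hf', ← hf.pathAction_transition]
  exact congrArg _ ψ_d

end PathAction

end IsGradedFactor

/-! ### Fullness -/

/-- The morphism of complexes given by morphisms commuting with the differentials. -/
def natTransOfSucc {C : Type*} [Category* C] {F G : ℤ ⥤ C} (f : ∀ j, F.obj j ⟶ G.obj j)
    (hf : ∀ {i j : ℤ} (h : i ⟶ j), i + 1 = j → f i ≫ G.map h = F.map h ≫ f j) : F ⟶ G where
  app := f
  naturality i j h := by
    suffices ∀ j (h : i ≤ j), F.map (homOfLE h) ≫ f j = f i ≫ G.map (homOfLE h) from this j h.le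
    intro j h
    induction j, h using Int.leInduction with
    | base =>
      change F.map (𝟙 i) ≫ f i = f i ≫ G.map (𝟙 i)
      rw [F.map_id, G.map_id, Category.id_comp, Category.comp_id]
    | succ j h ih =>
      rw [← homOfLE_comp h (Int.le.intro 1 rfl), F.map_comp, G.map_comp, Category.assoc,
        ← hf _ rfl, reassoc_of% ih]

theorem stepsTo_lt {n : ℕ} (hn : n ≠ 0) (m j : ℤ) : stepsTo n m j < n :=
  (Int.toNat_lt' (Nat.pos_of_ne_zero hn)).2 (Int.emod_lt_of_pos _ (by omega))

theorem stepsTo_eq_sub_one {n : ℕ} (hn : 2 ≤ n) {m j : ℤ} (h : (n : ℤ) ∣ j - 1 - m) :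
    stepsTo n m j = n - 1 := by
  obtain ⟨k, hk⟩ := h
  rw [stepsTo, show m - j = n - 1 + n * (-k - 1) by linarith, Int.add_mul_emod_self_left,
    Int.emod_eq_of_lt (by omega) (by omega)]
  omega

theorem dvd_add_stepsTo_sub {n : ℕ} (hn : n ≠ 0) (m j : ℤ) : (n : ℤ) ∣ j + stepsTo n m j - m := by
  rw [stepsTo, Int.toNat_of_nonneg (Int.emod_nonneg _ (Nat.cast_ne_zero.2 hn)),
    show j + (m - j) % n - m = -(m - j - (m - j) % n) by ring, dvd_neg]
  exact Int.dvd_self_sub_emod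

theorem notMem_supportSet_of_lt_stepsTo {n : ℕ} (hn : n ≠ 0) {m j : ℤ} (hj : j ∉ supportSet n m)
    {i : ℤ} (hji : j ≤ i) (hi : i < j + stepsTo n m j) : i ∉ supportSet n m := by
  have dvd := dvd_add_stepsTo_sub hn m j
  have lt := stepsTo_lt hn m j
  intro hiS
  rcases mem_supportSet_iff.1 hiS with h | h
  · have := Int.le_of_dvd (by omega) (dvd_sub dvd h)
    omega
  · have := Int.le_of_dvd (by omega) (dvd_sub dvd h)
    obtain rfl : i = j := by omega
    exact hj hiS

theorem strictMono_contractionIndex {n : ℕ} (hn : 2 ≤ n) (m : ℤ) :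
    StrictMono (contractionIndex n m) := by
  refine strictMono_int_of_lt_succ fun k => ?_
  obtain ⟨l, rfl | rfl⟩ := Int.even_or_odd' k
  · rw [contractionIndex_even, contractionIndex_odd]
    omega
  · rw [show 2 * l + 1 + 1 = 2 * (l + 1) by ring, contractionIndex_even, contractionIndex_odd,
      add_mul]
    omega

theorem exists_eq_on_contractionIndex {n : ℕ} (hn : 2 ≤ n) (m : ℤ) {X : ℤ → Sort*}
    (f : ∀ k, X (contractionIndex n m k)) : ∃ φ : ∀ j ∈ supportSet n m, X j,
      ∀ k, φ _ (contractionIndex_mem_supportSet n m k) = f k := by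
  choose c hc using fun (j : ℤ) (hj : j ∈ supportSet n m) => exists_contractionIndex_eq hj
  refine ⟨fun j hj => hc j hj ▸ f (c j hj), fun k => ?_⟩
  have cast_eq (l : ℤ) (h : contractionIndex n m l = contractionIndex n m k) : h ▸ f l = f k := by
    obtain rfl := (strictMono_contractionIndex hn m).injective h
    rfl
  exact cast_eq _ _

namespace IsGradedFactor

variable {V : Type v₁} [Quiver.{v₂} V] [Fintype V] {π : PathAlgebra K V →ₐ[K] Λ}

open PathAlgebra GrMod

section

variable (hπ : IsGradedFactor 𝒜 π) {I J : ℤ ⥤ GrMod 𝒜} (hI : ∀ k, (I.obj k).IsCofree (-k))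
  (hJ : ∀ k, (J.obj k).IsCofree (-k)) {n : ℕ} {m : ℤ}
  (φ : ∀ j ∈ supportSet n m, I.obj j ⟶ J.obj j)

/-- The morphism `f : I^j ⟶ J^j` is compatible with the morphisms `φ` given on `𝒮`: it agrees with
them if `j ∈ 𝒮`, and it commutes with the actions of the paths leading to `m + nℤ`. -/
def IsCompatible {j : ℤ} (f : I.obj j ⟶ J.obj j) : Prop :=
  (∀ hj : j ∈ supportSet n m, f = φ j hj) ∧
    ∀ t (ht : t ∈ supportSet n m), j + stepsTo n m j = t → hπ.IsPathEquivariant hI hJ f (φ t ht)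

variable {φ} (hn : 2 ≤ n) (hinj : ∀ k < n, ∀ x ∈ degreePart K V k, π x = 0 → x = 0)
  (hφ : ∀ k {i j : ℤ} (hi : i ∈ supportSet n m) (hj : j ∈ supportSet n m) (h : i ≤ j),
    contractionIndex n m k = i → contractionIndex n m (k + 1) = j →
      φ i hi ≫ transition J h = transition I h ≫ φ j hj)

include hn hinj hφ in
theorem isCompatible_of_mem_supportSet {j : ℤ} (hj : j ∈ supportSet n m) :
    hπ.IsCompatible hI hJ φ (φ j hj) := by
  refine ⟨fun _ => rfl, fun t ht hjt => ?_⟩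
  have lt := stepsTo_lt (show n ≠ 0 by omega) m j
  have hle : j ≤ t := by omega
  refine isPathEquivariant_of_transition hle (fun k hk => hinj k (by omega)) fun x => ?_
  rcases mem_supportSet_iff.1 hj with h | h
  · obtain rfl : j = t := by rw [← hjt, stepsTo_eq_zero h, Nat.cast_zero, add_zero]
    rw [transition_self_app, transition_self_app]
  · rw [stepsTo_eq_sub_one hn h] at hjt
    obtain ⟨k, hk⟩ := h
    rw [mul_comm] at hk
    have hkj : contractionIndex n m (2 * k + 1) = j := by
      rw [contractionIndex_odd]
      omega
    have hkt : contractionIndex n m (2 * k + 1 + 1) = t := by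
      rw [show 2 * k + 1 + 1 = 2 * (k + 1) by ring, contractionIndex_even, add_mul]
      omega
    exact Hom.congr_app (hφ _ hj ht _ hkj hkt) _ x

variable (hIs : ∀ {i j : ℤ} (h : i + 1 = j), j ∉ supportSet n m →
    Function.Surjective ((transition I (show i ≤ j by omega)).app (-j)))
  (hJt : ∀ j ∉ supportSet n m, ∀ w : (J.obj j).carrier (-j),
    (∀ s, hπ.arrowAction hJ rfl s w = 0) → w = 0)

include hJt in
theorem ext_pathAction_of_notMem_supportSet (hn : n ≠ 0) {j : ℤ} (hj : j ∉ supportSet n m)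
    {w w' : (J.obj j).carrier (-j)} (hw : ∀ {a b : V} (p : Quiver.Path a b)
      (h : j + p.length = j + stepsTo n m j),
      hπ.pathAction hJ p h w = hπ.pathAction hJ p h w') : w = w' :=
  hπ.ext_pathAction hJ
    (fun i hji hi => hJt i (notMem_supportSet_of_lt_stepsTo hn hj hji hi)) rfl hw

variable [∀ a b : V, Finite (a ⟶ b)]

include hn hinj hφ hIs hJt in
theorem exists_isCompatible (j : ℤ) : ∃ f : I.obj j ⟶ J.obj j, hπ.IsCompatible hI hJ φ f := by
  have hn0 : n ≠ 0 := by omega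
  induction j using supportSet_induction hn0 m with
  | mem j hj => exact ⟨_, hπ.isCompatible_of_mem_supportSet hI hJ hn hinj hφ hj⟩
  | succ j hj ih =>
    obtain ⟨f, -, hf⟩ := ih
    have not_dvd : ¬(n : ℤ) ∣ j - m := fun h =>
      hj (mem_supportSet_iff.2 (Or.inr (by rwa [add_sub_cancel_right])))
    have ht := mem_supportSet_of_dvd (dvd_add_stepsTo_sub hn0 m (j + 1))
    have steps_eq : j + stepsTo n m j = j + 1 + stepsTo n m (j + 1) := by
      rw [stepsTo_eq_succ hn0 not_dvd]
      push_cast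
      ring
    obtain ⟨f', hf'⟩ := (hf _ ht steps_eq).exists_succ (hIs rfl hj)
      fun w w' => hπ.ext_pathAction_of_notMem_supportSet hJ hJt hn0 hj
    exact ⟨f', fun h => absurd h hj, by rintro _ _ rfl; exact hf'⟩

variable {hπ hI hJ}

include hn hφ hJt in
theorem IsCompatible.comp_transition {j : ℤ} {f : I.obj j ⟶ J.obj j}
    {f' : I.obj (j + 1) ⟶ J.obj (j + 1)} (hf : hπ.IsCompatible hI hJ φ f)
    (hf' : hπ.IsCompatible hI hJ φ f') :
    f ≫ transition J (show j ≤ j + 1 by omega) = transition I (show j ≤ j + 1 by omega) ≫ f' := by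
  have hn0 : n ≠ 0 := by omega
  by_cases dvd : (n : ℤ) ∣ j - m
  · have hj := mem_supportSet_of_dvd dvd
    have hj' : j + 1 ∈ supportSet n m :=
      mem_supportSet_iff.2 (Or.inr (by rwa [add_sub_cancel_right]))
    rw [hf.1 hj, hf'.1 hj']
    obtain ⟨k, hk⟩ := dvd
    rw [mul_comm] at hk
    refine hφ (2 * k) hj hj' _ ?_ ?_
    · rw [contractionIndex_even]
      omega
    · rw [contractionIndex_odd]
      omega
  have steps_eq : (stepsTo n m j : ℤ) = stepsTo n m (j + 1) + 1 := by
    rw [stepsTo_eq_succ hn0 dvd, Nat.cast_succ]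
  by_cases hj' : j + 1 ∈ supportSet n m
  · have dvd' := (mem_supportSet_iff.1 hj').resolve_right (by rwa [add_sub_cancel_right])
    rw [stepsTo_eq_zero dvd'] at steps_eq
    rw [hf'.1 hj']
    exact (hf.2 _ hj' (by omega)).comp_transition
  · have ht := mem_supportSet_of_dvd (dvd_add_stepsTo_sub hn0 m (j + 1))
    refine (hJ (j + 1)).hom_ext fun x => ?_
    refine hπ.ext_pathAction_of_notMem_supportSet hJ hJt hn0 hj' fun p h => ?_
    exact ((hf.2 _ ht (by omega)).pathAction_transition p h x).trans (hf'.2 _ ht rfl p h _).symm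

include hI hn hinj hφ hIs hJt in
theorem exists_hom_app_eq_of_mem_supportSet :
    ∃ g : I ⟶ J, ∀ j (hj : j ∈ supportSet n m), g.app j = φ j hj := by
  choose f hf using hπ.exists_isCompatible hI hJ hn hinj hφ hIs hJt
  refine ⟨natTransOfSucc f ?_, fun j hj => (hf j).1 hj⟩
  rintro j _ _ rfl
  exact (hf j).comp_transition hn hφ hJt (hf (j + 1))

end

variable [∀ a b : V, Finite (a ⟶ b)]

theorem full_restriction (hπ : IsGradedFactor 𝒜 π) {n : ℕ} (hn : 2 ≤ n) (m : ℤ)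
    (hrel : HasRelationsOfDegreeGE π n) : ((isGStar 𝒜 n m).ι ⋙ contraction 𝒜 hn m).Full where
  map_surjective {I J} f := by
    have hI := hπ.isCofree_obj I.obj
    have hJ := hπ.isCofree_obj J.obj
    let f' (k : ℤ) : I.obj.obj.obj (contractionIndex n m k) ⟶
      J.obj.obj.obj (contractionIndex n m k) := f.f k
    obtain ⟨φ, hφ⟩ := exists_eq_on_contractionIndex hn m
      (X := fun j => I.obj.obj.obj j ⟶ J.obj.obj.obj j) f'
    have comm (k : ℤ) {i j : ℤ} (hi : i ∈ supportSet n m) (hj : j ∈ supportSet n m) (h : i ≤ j)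
        (hki : contractionIndex n m k = i) (hkj : contractionIndex n m (k + 1) = j) :
        φ i hi ≫ transition J.obj.obj h = transition I.obj.obj h ≫ φ j hj := by
      subst hki hkj
      have := f.comm k (k + 1)
      change f' k ≫ ((contraction 𝒜 hn m).obj J.obj).d k (k + 1) =
        ((contraction 𝒜 hn m).obj I.obj).d k (k + 1) ≫ f' (k + 1) at this
      rw [contraction_obj_d hn m _ rfl, contraction_obj_d hn m _ rfl] at this
      rwa [hφ, hφ]
    obtain ⟨g, hg⟩ := hπ.exists_hom_app_eq_of_mem_supportSet (hI := hI) (hJ := hJ) hn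
      (fun k hk x hx h => eq_zero_of_hasRelationsOfDegreeGE hrel hk hx h) comm
      (fun h hj => ((hπ.isGStar_iff I.obj).1 I.property (two_lt_of_notMem_supportSet hn hj)).2 h
        (mt mem_supportSet_of_dvd hj))
      (fun j hj => ((hπ.isGStar_iff J.obj).1 J.property (two_lt_of_notMem_supportSet hn hj)).1 j hj)
    refine ⟨ObjectProperty.homMk (ObjectProperty.homMk g), ?_⟩
    ext k : 1
    exact (hg _ (contractionIndex_mem_supportSet n m k)).trans (hφ k)

end IsGradedFactor

end

theorem mainTheorem4 {K : Type w} [Field K] {Λ : Type u} [Ring Λ] [Algebra K Λ]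
    (𝒜 : ℤ → Submodule K Λ) [GradedAlgebra 𝒜]
    {V : Type v₁} [Quiver.{v₂} V] [Fintype V] [∀ a b : V, Finite (a ⟶ b)]
    (π : PathAlgebra K V →ₐ[K] Λ) (hπ : IsGradedFactor 𝒜 π)
    (n : ℕ) (hn : 2 ≤ n) (m : ℤ) :
    -- `H` is an exact (additive) functor on the abelian category of linear `n`-complexes
    (IsAbelianCategory (LinearNComplex 𝒜 n) ∧
      (contraction 𝒜 hn m).Additive ∧
      Limits.PreservesFiniteLimits (contraction 𝒜 hn m) ∧
      Limits.PreservesFiniteColimits (contraction 𝒜 hn m)) ∧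
    -- `Ker H = 𝒯*`, and the functor induced by `H` on the quotient category is faithful
    ((∀ I : LinearNComplex 𝒜 n,
        Limits.IsZero ((contraction 𝒜 hn m).obj I) ↔ torsionClass 𝒜 n m I) ∧
      ∃ hH : (isoModulo (torsionClass 𝒜 n m)).IsInvertedBy (contraction 𝒜 hn m),
        (Localization.Construction.lift (contraction 𝒜 hn m) hH).Faithful) ∧
    -- the restriction of `H` to `𝒢*(𝒮, 𝒰)` is faithful, with the following essential image
    (((isGStar 𝒜 n m).ι ⋙ contraction 𝒜 hn m).Faithful ∧
      ∀ C : CochainComplex (GrMod 𝒜) ℤ,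
        ((isGStar 𝒜 n m).ι ⋙ contraction 𝒜 hn m).essImage C ↔
          (contraction 𝒜 hn m).essImage C ∧
          (∀ j : ℤ, (C.X j).IsAlmostInjective ∧
            (C.X j).IsCogeneratedInDegree (-contractionIndex n m j)) ∧
          (2 < n → ∀ j : ℤ, GrMod.SocleLERange (C.d (2 * j) (2 * j + 1)))) ∧
    -- if `Λ` has relations of degree `≥ n`, this restriction is also full
    (HasRelationsOfDegreeGE π n →
      ((isGStar 𝒜 n m).ι ⋙ contraction 𝒜 hn m).Full) := by
  refine ⟨⟨hπ.isAbelianCategory n, inferInstance, hπ.preservesFiniteLimits_contraction hn m,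
    hπ.preservesFiniteColimits_contraction hn m⟩, ⟨isZero_contraction_iff hn m, ?_⟩,
    ⟨hπ.faithful_restriction hn m, hπ.essImage_iff hn m⟩, hπ.full_restriction hn m⟩
  exact hπ.exists_faithful_lift_contraction hn m
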